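/- **Network.** Let $\mathbb J$ (resources) and $\mathbb I$ (routes) be finite nonempty sets. Each route uses a nonempty set of resources; $A\in\{0,1\}^{\mathbb J\times\mathbb I}$ is the incidence matrix ($A_{ji}=1$ iff route $i$ uses $j$) and has full row rank. Let $C_j>0$ be the capacities and $\kappa_i>0$ the weights. For $n\in\mathbb R_+^{\mathbb I}$ let $\Lambda(n)$ be the weighted proportionally fair allocation ($\alpha=1$): $\Lambda_i(n)=0$ if $n_i=0$, and $(\Lambda_i(n))_{n_i>0}$ maximizes $\sum_{i:n_i>0}\kappa_in_i\log\Lambda_i$ over $\Lambda_i\ge0$ subject to $\sum_{i:n_i>0} A_{ji}\Lambda_i\le C_j$ for all $j$ (the objective is $-\infty$ if $\Lambda_i=0$ for some $i$ with $n_i>0$). **Models.** Let $r$ run through an increasing sequence of positive numbers tending to infinity. For each $r$ there are, on a probability space of its own, $\nu^r_i,\mu^r_i>0$, i.i.d. exponential sequences $(x^r_i(l))_{l\ge1}$ with mean $1/\nu^r_i$ and $(y^r_i(l))_{l\ge1}$ with mean $1/\mu^r_i$, and a $\mathbb Z_+^{\mathbb I}$-valued random vector $N^r(0)$; all these sequences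 and the vector $N^r(0)$ are mutually independent. With $E^r_i(t)=\sup\{n\ge 0:\sum_{l\le n}x^r_i(l)\le t\}$ and $S^r_i(t)=\sup\{n\ge 0:\sum_{l\le n}y^r_i(l)\le t\}$, the flow count process $N^r$ has values in $\mathbb Z_+^{\mathbb I}$, right-continuous paths with left limits, and satisfies for all $t\ge0$, almost surely, $$N^r_i(t)=N^r_i(0)+E^r_i(t)-S^r_i(T^r_i(t)),\qquad T^r_i(t)=\int_0^t\Lambda_i(N^r(s))\,ds .$$ Put $U^r(t)=Ct-AT^r(t)$, $M^r=\operatorname{diag}(\mu^r)$, $W^r(t)=A(M^r)^{-1}N^r(t)$, and $\hat N^r(t)=N^r(r^2t)/r$, $\hat W^r(t)=W^r(r^2t)/r$, $\hat U^r(t)=U^r(r^2t)/r$. **Standing assumptions.** There are $\nu_i,\mu_i>0$ and $\theta\in\mathbb R^{\mathbb J}$ with $\nu^r\to\nu$, $\mu^r\to\mu$ and $r(A\rho^r-C)\to\theta$ as $r\to\infty$, where $\rho^r_i=\nu^r_i/\mu^r_i$; and $\hat W^r(0)$ converges in distribution to a random vector in $\mathbb R^{\mathbb J}$. Put $M=\operatorname{diag}(\mu)$,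 $\rho_i=\nu_i/\mu_i$. **Limit objects.** For $w\in\mathbb R_+^{\mathbb J}$ let $\Delta(w)$ be the minimizer of $F(n)=\frac12\sum_i\nu_i\kappa_i(n_i/\nu_i)^2$ over $n\in\mathbb R_+^{\mathbb I}$ with $AM^{-1}n\ge w$. For $j\in\mathbb J$ let $\mathcal W_1^j=\{AM^{-1}n: n_i=\rho_i\kappa_i^{-1}\sum_kq_kA_{ki}\ (i\in\mathbb I)\text{ for some }q\in\mathbb R_+^{\mathbb J}\text{ with }q_j=0\}$. Put $\tilde W^r(t)=AM^{-1}\Delta(\hat W^r(t))$, $$\hat\xi^r(t)=AM^{-1}\bigl(\hat N^r(t)-\Delta(\hat W^r(t))\bigr)+A\bigl((M^r)^{-1}-M^{-1}\bigr)\hat N^r(t)=\hat W^r(t)-\tilde W^r(t),$$ and, with the Euclidean distance $d$, $$\hat\zeta^{r,\delta}_j(t)=\int_{(0,t]}1_{\{d(\tilde W^r(s),\mathcal W^j_1)>\delta\}}\,d\hat U^r_j(s).$$ Write $\|x(\cdot)\|_T=\sup_{0\le t\le T}|x(t)|$ with the Euclidean norm. **Lemma 7.5.** Suppose in addition that for each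 $j\in\mathbb J$ there is $i\in\mathbb I$ with $A_{ji}>0$ and $A_{ki}=0$ for all $k\ne j$ (local traffic), and that $|\hat N^r(0)-\Delta(\hat W^r(0))|\to0$ in probability as $r\to\infty$. Then for each $T>0$ and $\delta>0$ there are constants $K(T,\delta)>0$ and $r(T,\delta)>0$ such that for each $r\ge r(T,\delta)$, $$P\Bigl(\|\hat N^r-\Delta(\hat W^r)\|_T\le\delta,\ \|\hat\xi^r\|_T\le\delta,\ \|\hat\zeta^{r,\delta}_j\|_T=0\ \text{for all }j\in\mathbb J,\ \|\hat W^r\|_T\le K(T,\delta),\ \|\hat U^r\|_T\le K(T,\delta)\Bigr)\ge1-\delta .$$ -/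

import Mathlib

open MeasureTheory ProbabilityTheory Filter Topology
open scoped ENNReal

noncomputable section

namespace BandwidthSharing

/-- A network with finitely many resources `J` and routes `I`.  Each route is a nonempty set of
resources; `capacity` holds the bandwidth capacities and `weight` the weights of the sharing policy.
The resource-route incidence matrix has full row rank. -/
structure Network (J I : Type*) [Fintype J] [Fintype I] [DecidableEq J] where
  route : I → Finset J
  route_nonempty : ∀ i, (route i).Nonempty
  capacity : J → ℝ
  capacity_pos : ∀ j, 0 < capacity j
  weight : I → ℝ
  weight_pos : ∀ i, 0 < weight i
  rank_eq : (Matrix.of fun (j : J) (i : I) => if j ∈ route i then (1 : ℝ) else 0).rank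
    = Fintype.card J

/-- `supNorm x T` is `sup {|x u| : 0 ≤ u ≤ T}`, as an extended nonnegative real. -/
def supNorm {E : Type*} [ENorm E] (x : ℝ → E) (T : ℝ) : ℝ≥0∞ :=
  ⨆ t ∈ Set.Icc (0 : ℝ) T, ‖x t‖ₑ

/-- The renewal counting function `t ↦ sup {n ≥ 0 : x 0 + ⋯ + x (n - 1) ≤ t}`. -/
def count (x : ℕ → ℝ) (t : ℝ) : ℕ :=
  sSup {n : ℕ | ∑ k ∈ Finset.range n, x k ≤ t}

open Classical in
/-- The Lebesgue-Stieltjes measure `df` of a nondecreasing function `f` on `[0, ∞)`, which is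
extended to the negative half-line by the constant `f 0`.  (If `f` is not nondecreasing the value
is the infinite measure `⊤`, so that no nonempty set is null by convention.) -/
def stieltjesMeasure (f : ℝ → ℝ) : Measure ℝ :=
  if h : Monotone (fun t : ℝ => f (max t 0)) then h.stieltjesFunction.measure else ⊤

section Network

variable {J I : Type*} [Fintype J] [Fintype I] [DecidableEq J]

namespace Network

/-- The incidence matrix `A`. -/
def incidence (net : Network J I) : Matrix J I ℝ :=
  Matrix.of fun j i => if j ∈ net.route i then (1 : ℝ) else 0

/-- Local traffic: each resource has a route which uses that resource only. -/
def LocalTraffic (net : Network J I) : Prop :=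
  ∀ j, ∃ i, 0 < net.incidence j i ∧ ∀ k, k ≠ j → net.incidence k i = 0

open Classical in
/-- The objective `∑ κ_i n_i log Λ_i`, summed over the routes with `n_i > 0`; it is `-∞` when
`Λ_i = 0` for one of these routes. -/
def objective (net : Network J I) (n Λ : I → ℝ) : EReal :=
  if ∀ i, 0 < n i → 0 < Λ i then
    ((∑ i with 0 < n i, net.weight i * n i * Real.log (Λ i) : ℝ) : EReal)
  else ⊥

/-- `Λ` is a feasible allocation in state `n`: it is nonnegative, vanishes on the empty routes and
respects the capacity constraints. -/
def Feasible (net : Network J I) (n Λ : I → ℝ) : Prop :=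
  (∀ i, 0 ≤ Λ i) ∧ (∀ i, n i = 0 → Λ i = 0) ∧
    ∀ j, ∑ i, net.incidence j i * Λ i ≤ net.capacity j

/-- `Λ` solves the utility maximization problem of weighted proportional fairness in state `n`. -/
def IsOptimalAllocation (net : Network J I) (n Λ : I → ℝ) : Prop :=
  net.Feasible n Λ ∧ ∀ Λ', net.Feasible n Λ' → net.objective n Λ' ≤ net.objective n Λ

/-- The weighted proportionally fair (`α = 1`) allocation `Λ(n)`, `n ≥ 0`: the solution of the
maximization problem. -/
def allocation (net : Network J I) (n : I → ℝ) : I → ℝ :=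
  Classical.epsilon fun Λ => net.IsOptimalAllocation n Λ

/-- The workload `A M⁻¹ n` of the state `n`, where `M = diag μ`. -/
def workload (net : Network J I) (μ : I → ℝ) (n : EuclideanSpace ℝ I) : EuclideanSpace ℝ J :=
  WithLp.toLp 2 fun j => ∑ i, net.incidence j i * (n i / μ i)

/-- The function `F` for `α = 1`:
`F(n) = (1/2) ∑ ν_i κ_i (n_i / ν_i) ^ 2`. -/
def liftObjective (net : Network J I) (ν : I → ℝ) (n : EuclideanSpace ℝ I) : ℝ :=
  1 / 2 * ∑ i, ν i * net.weight i * (n i / ν i) ^ 2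

/-- `n` is feasible for the lifting problem at `w`: `n ≥ 0` and its workload is at least `w`. -/
def LiftFeasible (net : Network J I) (μ : I → ℝ) (w : EuclideanSpace ℝ J)
    (n : EuclideanSpace ℝ I) : Prop :=
  (∀ i, 0 ≤ n i) ∧ ∀ j, w j ≤ net.workload μ n j

/-- The lifting map `Δ` for `α = 1`: `Δ(w)` is the minimizer of `F` among the states `n ≥ 0` whose
workload is at least `w`. -/
def lift (net : Network J I) (ν μ : I → ℝ) (w : EuclideanSpace ℝ J) : EuclideanSpace ℝ I :=
  Classical.epsilon fun n => net.LiftFeasible μ w n ∧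
    ∀ n', net.LiftFeasible μ w n' → net.liftObjective ν n ≤ net.liftObjective ν n'

/-- The set of invariant states `n_i = ρ_i (q' A)_i / κ_i`, `ρ_i = ν_i / μ_i`, with `q ≥ 0` and
`q_j = 0`. -/
def manifoldFace (net : Network J I) (ν μ : I → ℝ) (j : J) : Set (EuclideanSpace ℝ I) :=
  {n | ∃ q : J → ℝ, (∀ k, 0 ≤ q k) ∧ q j = 0 ∧
    ∀ i, n i = ν i / μ i * ((∑ k, q k * net.incidence k i) / net.weight i)}

/-- The `j`th face of the workload cone. -/
def workloadFace (net : Network J I) (ν μ : I → ℝ) (j : J) : Set (EuclideanSpace ℝ J) :=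
  net.workload μ '' net.manifoldFace ν μ j

/-- The cumulative bandwidth `T_i(t) = ∫₀ᵗ Λ_i(n(s)) ds` given to route `i` along a path `n` of the
flow count process. -/
def cumulativeBandwidth (net : Network J I) (n : ℝ → I → ℕ) (i : I) (t : ℝ) : ℝ :=
  ∫ s in (0 : ℝ)..t, net.allocation (fun i' => (n s i' : ℝ)) i

end Network

/-- A flow-level model on the probability space `(Ω, P)`: arrival rates `ν`, mean document sizes
`1 / μ`, interarrival times `arr i k` and document sizes `size i k` (`k ≥ 0`), which are
independent exponential variables, and the flow count process `N`, with values in `ℤ₊^I`, whose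
paths are right-continuous with left limits and satisfy
`N_i(t) = N_i(0) + E_i(t) - S_i(T_i(t))`, where `E_i` and `S_i` are the counting processes of
`arr i` and `size i` and `T_i(t) = ∫₀ᵗ Λ_i(N(s)) ds`.  Only times `t ≥ 0` matter. -/
structure FlowModel (net : Network J I) {Ω : Type*} [MeasurableSpace Ω] (P : Measure Ω) where
  ν : I → ℝ
  μ : I → ℝ
  ν_pos : ∀ i, 0 < ν i
  μ_pos : ∀ i, 0 < μ i
  arr : I → ℕ → Ω → ℝ
  size : I → ℕ → Ω → ℝ
  N : ℝ → Ω → I → ℕ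
  law_arr : ∀ i k, HasLaw (arr i k) (expMeasure (ν i)) P
  law_size : ∀ i k, HasLaw (size i k) (expMeasure (μ i)) P
  measurable_N : ∀ t, 0 ≤ t → Measurable (N t)
  indep : iIndepFun (Sum.elim (fun p : I × ℕ => arr p.1 p.2) fun p : I × ℕ => size p.1 p.2) P
  indep_init : IndepFun (N 0) (fun ω => ((fun i k => arr i k ω), fun i k => size i k ω)) P
  rightContinuous : ∀ᵐ ω ∂P, ∀ t, 0 ≤ t →
    ContinuousWithinAt (fun s => N s ω) (Set.Ici t) t
  leftLimits : ∀ᵐ ω ∂P, ∀ t, 0 < t → ∃ n : I → ℕ, Tendsto (fun s => N s ω) (𝓝[<] t) (𝓝 n)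
  dynamics : ∀ᵐ ω ∂P, ∀ t, 0 ≤ t → ∀ i,
    (N t ω i : ℝ) = N 0 ω i + count (fun k => arr i k ω) t
      - count (fun k => size i k ω) (net.cumulativeBandwidth (fun s => N s ω) i t)

namespace FlowModel

variable {net : Network J I} {Ω : Type*} [MeasurableSpace Ω] {P : Measure Ω}

/-- The flow count process as a Euclidean vector. -/
def flow (X : FlowModel net P) (t : ℝ) (ω : Ω) : EuclideanSpace ℝ I :=
  WithLp.toLp 2 fun i => (X.N t ω i : ℝ)

/-- The cumulative unused capacity `U_j(t) = C_j t - ∑ A_{ji} T_i(t)`. -/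
def unused (X : FlowModel net P) (t : ℝ) (ω : Ω) : EuclideanSpace ℝ J :=
  WithLp.toLp 2 fun j => net.capacity j * t
    - ∑ i, net.incidence j i * net.cumulativeBandwidth (fun s => X.N s ω) i t

/-- Diffusion scaled flow count `N(r² t) / r`. -/
def hatN (X : FlowModel net P) (r t : ℝ) (ω : Ω) : EuclideanSpace ℝ I :=
  r⁻¹ • X.flow (r ^ 2 * t) ω

/-- Diffusion scaled workload `W(r² t) / r`, where `W = A M⁻¹ N` with the `M` of the model. -/
def hatW (X : FlowModel net P) (r t : ℝ) (ω : Ω) : EuclideanSpace ℝ J :=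
  r⁻¹ • net.workload X.μ (X.flow (r ^ 2 * t) ω)

/-- Diffusion scaled unused capacity `U(r² t) / r`. -/
def hatU (X : FlowModel net P) (r t : ℝ) (ω : Ω) : EuclideanSpace ℝ J :=
  r⁻¹ • X.unused (r ^ 2 * t) ω

/-- `Δ(Ŵ(t))`, for the lifting map `Δ` with the limit parameters `ν`, `μ`. -/
def liftW (X : FlowModel net P) (ν μ : I → ℝ) (r t : ℝ) (ω : Ω) : EuclideanSpace ℝ I :=
  net.lift ν μ (X.hatW r t ω)

/-- `W̃(t) = A M⁻¹ Δ(Ŵ(t))`, with the limit parameters. -/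
def tildeW (X : FlowModel net P) (ν μ : I → ℝ) (r t : ℝ) (ω : Ω) : EuclideanSpace ℝ J :=
  net.workload μ (X.liftW ν μ r t ω)

/-- `ξ̂(t) = A M⁻¹ (N̂(t) - Δ(Ŵ(t))) + A ((M^r)⁻¹ - M⁻¹) N̂(t)`, which is `Ŵ(t) - W̃(t)`. -/
def xiHat (X : FlowModel net P) (ν μ : I → ℝ) (r t : ℝ) (ω : Ω) : EuclideanSpace ℝ J :=
  net.workload μ (X.hatN r t ω - X.liftW ν μ r t ω)
    + (net.workload X.μ (X.hatN r t ω) - net.workload μ (X.hatN r t ω))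

open Classical in
/-- `ζ̂_j^δ(t) = ∫_{(0,t]} 1{d(W̃(s), face j) > δ} dÛ_j(s)`, a Lebesgue-Stieltjes integral. -/
def zetaHat (X : FlowModel net P) (ν μ : I → ℝ) (r δ : ℝ) (j : J) (t : ℝ) (ω : Ω) : ℝ≥0∞ :=
  ∫⁻ s in Set.Ioc 0 t,
    (if δ < Metric.infDist (X.tildeW ν μ r s ω) (net.workloadFace ν μ j) then 1 else 0)
      ∂(stieltjesMeasure fun s => X.hatU r s ω j)

end FlowModel

end Network

end BandwidthSharing

end

/-!
The argument is pathwise.  Along a path of the flow count process, the noise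
`N(t) - N(0) - ν t + μ T(t)` is what remains of the counting processes after centring; on an event
of high probability it is of order `r` on the time scale `r ^ 2`, and its increments over windows of
length of order `r` are at most a small multiple of `r`.  Everything else is deterministic.

*Statics.*  The objective of the lifting problem is half the squared norm of a weighted inner
product (`energy`).  Its optimality conditions are a linear complementarity problem
(`IsMultiplier`), which says that `Δ(A M⁻¹ n)` is the projection of `n` onto the cone of invariant
states.  Local traffic makes the problem coercive, so that multipliers exist and are Lipschitz in
the workload.

*State space collapse.*  The squared distance to the cone is a Lyapunov function: testing the
optimality of the proportionally fair allocation with `ρ + ε M⁻¹ (n - Π n)`, where `Π` is the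
projection, shows that the mean velocity `ν - μ Λ(n)` points towards the cone
(`exists_drift_bound`).  As the noise has small increments, a path of order `r` that starts near the
cone remains near it (`exists_collapse`).

*Boundedness.*  By local traffic, capacity of the resource `j` is left unused only while the local
route of `j` is empty, hence, near the cone, only while the `j`th multiplier is small.  With `G` the
symmetric matrix `q ↦ A M⁻¹ n(q)`, where `n(q)` is the invariant state with multipliers `q`, this
controls the derivative of the quadratic form `U ⬝ G⁻¹ U / 2` of the unused capacity, which bounds `U`
(`exists_unused_bound`) and then workload and state.  Collapse and boundedness presuppose each
other, and `exists_path_bound` combines them by continuation in time.  The statement on `ζ̂` follows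
in the same way: away from the `j`th face of the workload cone the local route of `j` is nonempty,
and the density of `U_j` vanishes.

*Probability.*  Chernoff bounds and a union bound over the polynomially many windows, together with
the exponential maximal inequality, control the partial sums of the exponential variables, hence the
counting processes (`exists_count_deviation_le`) and the noise (`exists_noise_bound`).  Convergence
in distribution gives tightness of the initial workload.
-/

noncomputable section

namespace BandwidthSharing

variable {J I : Type*} [Fintype J] [Fintype I] [DecidableEq J]

namespace Network

variable (net : Network J I) (ν μ : I → ℝ)

/-! ### The lifting problem as a projection onto the cone of invariant states -/

/-- The workload `A M⁻¹ n` as a linear map between coordinate spaces (with the sup norm). -/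
def workloadMap : (I → ℝ) →ₗ[ℝ] (J → ℝ) where
  toFun n j := ∑ i, net.incidence j i * (n i / μ i)
  map_add' a b := by
    ext j; simp only [Pi.add_apply, add_div, mul_add, Finset.sum_add_distrib]
  map_smul' c a := by
    ext j
    simp only [Pi.smul_apply, smul_eq_mul, RingHom.id_apply, Finset.mul_sum]
    exact Finset.sum_congr rfl fun i _ => by ring

/-- The invariant state `n_i = ρ_i (q' A)_i / κ_i` with multipliers `q`, as a linear map. -/
def invariantState : (J → ℝ) →ₗ[ℝ] (I → ℝ) where
  toFun q i := ν i / μ i * ((∑ k, q k * net.incidence k i) / net.weight i)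
  map_add' a b := by
    ext i
    simp only [Pi.add_apply, add_mul, Finset.sum_add_distrib]
    ring
  map_smul' c a := by
    ext i
    simp only [Pi.smul_apply, smul_eq_mul, RingHom.id_apply, mul_assoc, ← Finset.mul_sum]
    ring

/-- The inner product `∑ κ_i a_i b_i / ν_i`, for which the objective of the lifting problem is
half the squared norm. -/
def energy (a b : I → ℝ) : ℝ := ∑ i, net.weight i / ν i * (a i * b i)

lemma workloadMap_apply (n : I → ℝ) (j : J) :
    net.workloadMap μ n j = ∑ i, net.incidence j i * (n i / μ i) := rfl

lemma invariantState_apply (q : J → ℝ) (i : I) : net.invariantState ν μ q i =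
    ν i / μ i * ((∑ k, q k * net.incidence k i) / net.weight i) := rfl

lemma incidence_nonneg (j : J) (i : I) : 0 ≤ net.incidence j i := by
  simp only [incidence, Matrix.of_apply]; split_ifs <;> norm_num

lemma incidence_le_one (j : J) (i : I) : net.incidence j i ≤ 1 := by
  simp only [incidence, Matrix.of_apply]; split_ifs <;> norm_num

lemma incidence_eq_one {j : J} {i : I} (h : 0 < net.incidence j i) : net.incidence j i = 1 := by
  simp only [incidence, Matrix.of_apply] at h ⊢; split_ifs at h ⊢ <;> simp_all

section Energy

variable {net ν}

lemma energy_comm (a b : I → ℝ) : net.energy ν a b = net.energy ν b a := by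
  simp only [energy, mul_comm (a _)]

lemma energy_add_right (a b c : I → ℝ) :
    net.energy ν a (b + c) = net.energy ν a b + net.energy ν a c := by
  simp only [energy, Pi.add_apply, mul_add, Finset.sum_add_distrib]

lemma energy_sub_right (a b c : I → ℝ) :
    net.energy ν a (b - c) = net.energy ν a b - net.energy ν a c := by
  simp only [energy, Pi.sub_apply, mul_sub, Finset.sum_sub_distrib]

lemma energy_smul_right (a b : I → ℝ) (c : ℝ) :
    net.energy ν a (c • b) = c * net.energy ν a b := by
  simp only [energy, Pi.smul_apply, smul_eq_mul, Finset.mul_sum]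
  exact Finset.sum_congr rfl fun i _ => by ring

lemma energy_sub_left (a b c : I → ℝ) :
    net.energy ν (a - b) c = net.energy ν a c - net.energy ν b c := by
  rw [energy_comm, energy_sub_right, energy_comm c, energy_comm c]

lemma energy_add_left (a b c : I → ℝ) :
    net.energy ν (a + b) c = net.energy ν a c + net.energy ν b c := by
  rw [energy_comm, energy_add_right, energy_comm c, energy_comm c]

lemma energy_smul_left (a b : I → ℝ) (c : ℝ) :
    net.energy ν (c • a) b = c * net.energy ν a b := by
  rw [energy_comm, energy_smul_right, energy_comm]

lemma energy_self_nonneg (hν : ∀ i, 0 < ν i) (a : I → ℝ) : 0 ≤ net.energy ν a a :=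
  Finset.sum_nonneg fun i _ =>
    mul_nonneg (div_nonneg (net.weight_pos i).le (hν i).le) (mul_self_nonneg _)

lemma energy_self_eq_zero (hν : ∀ i, 0 < ν i) {a : I → ℝ} (h : net.energy ν a a = 0) : a = 0 := by
  have h0 := (Finset.sum_eq_zero_iff_of_nonneg fun i _ =>
    mul_nonneg (div_nonneg (net.weight_pos i).le (hν i).le) (mul_self_nonneg (a i))).1 h
  ext i
  have h1 := h0 i (Finset.mem_univ i)
  have h2 := div_pos (net.weight_pos i) (hν i)
  simpa [h2.ne'] using h1

variable {μ}

/-- `invariantState` is the adjoint of the workload map for `energy`. -/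
lemma energy_invariantState (hν : ∀ i, 0 < ν i) (q : J → ℝ) (n : I → ℝ) :
    net.energy ν (net.invariantState ν μ q) n = ∑ k, q k * net.workloadMap μ n k := by
  simp only [energy, invariantState_apply, workloadMap_apply, Finset.mul_sum, Finset.sum_mul,
    Finset.sum_div]
  rw [Finset.sum_comm]
  refine Finset.sum_congr rfl fun k _ => Finset.sum_congr rfl fun i _ => ?_
  have := (hν i).ne'; have := (net.weight_pos i).ne'
  field_simp

variable (net)

/-- The norm of the inner product `energy` is equivalent to the sup norm. -/
lemma exists_energy_bounds [Nonempty I] (hν : ∀ i, 0 < ν i) : ∃ c : ℝ, 0 < c ∧ ∃ C : ℝ, 0 < C ∧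
    (∀ a : I → ℝ, c * ‖a‖ ^ 2 ≤ net.energy ν a a) ∧
    ∀ a b : I → ℝ, |net.energy ν a b| ≤ C * (‖a‖ * ‖b‖) := by
  have hpos : ∀ i, 0 < net.weight i / ν i := fun i => div_pos (net.weight_pos i) (hν i)
  obtain ⟨i0, -, hi0⟩ := Finset.exists_min_image Finset.univ (fun i => net.weight i / ν i)
    Finset.univ_nonempty
  refine ⟨_, hpos i0, ∑ i, net.weight i / ν i, Finset.sum_pos (fun i _ => hpos i)
    Finset.univ_nonempty, fun a => ?_, fun a b => ?_⟩
  · obtain ⟨i1, hi1⟩ : ∃ i, ‖a‖ = |a i| := by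
      obtain ⟨i1, -, h⟩ := Finset.exists_max_image Finset.univ (fun i => |a i|)
        Finset.univ_nonempty
      refine ⟨i1, le_antisymm ?_ (norm_le_pi_norm a i1)⟩
      exact (pi_norm_le_iff_of_nonneg (abs_nonneg _)).2 fun i => h i (Finset.mem_univ i)
    calc _ ≤ net.weight i1 / ν i1 * (a i1 * a i1) := by
          rw [hi1, sq_abs, ← sq]
          exact mul_le_mul_of_nonneg_right (hi0 i1 (Finset.mem_univ _)) (sq_nonneg _)
      _ ≤ _ := Finset.single_le_sum (f := fun i => net.weight i / ν i * (a i * a i))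
          (fun i _ => mul_nonneg (hpos i).le (mul_self_nonneg _)) (Finset.mem_univ i1)
  · refine (Finset.abs_sum_le_sum_abs _ _).trans ?_
    rw [Finset.sum_mul]
    refine Finset.sum_le_sum fun i _ => ?_
    rw [abs_mul, abs_mul, abs_of_pos (hpos i)]
    exact mul_le_mul_of_nonneg_left (mul_le_mul (norm_le_pi_norm a i) (norm_le_pi_norm b i)
      (abs_nonneg _) (norm_nonneg _)) (hpos i).le

end Energy

/-- Linear maps between coordinate spaces are bounded. -/
lemma _root_.LinearMap.exists_pos_bound {X Y : Type*} [Fintype X] [Fintype Y]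
    (f : (X → ℝ) →ₗ[ℝ] (Y → ℝ)) : ∃ C : ℝ, 0 < C ∧ ∀ x, ‖f x‖ ≤ C * ‖x‖ :=
  ⟨‖LinearMap.toContinuousLinearMap f‖ + 1, by positivity, fun x =>
    (ContinuousLinearMap.le_opNorm (LinearMap.toContinuousLinearMap f) x).trans
      (mul_le_mul_of_nonneg_right (by linarith) (norm_nonneg _))⟩

lemma _root_.abs_sum_mul_le_card_mul_norm {X : Type*} [Fintype X] (a b : X → ℝ) :
    |∑ k, a k * b k| ≤ Fintype.card X * (‖a‖ * ‖b‖) := by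
  refine (Finset.abs_sum_le_sum_abs _ _).trans ?_
  calc _ ≤ ∑ _k : X, ‖a‖ * ‖b‖ := Finset.sum_le_sum fun k _ => by
        rw [abs_mul]
        exact mul_le_mul (norm_le_pi_norm a k) (norm_le_pi_norm b k) (abs_nonneg _) (norm_nonneg _)
    _ = _ := by simp

section Lift

variable {net ν μ}

lemma LocalTraffic.sum_mul_incidence {j : J} {i : I} (hi : 0 < net.incidence j i)
    (h : ∀ k, k ≠ j → net.incidence k i = 0) (q : J → ℝ) :
    ∑ k, q k * net.incidence k i = q j := by
  rw [Finset.sum_eq_single j (fun k _ hk => by rw [h k hk, mul_zero]) (by simp),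
    net.incidence_eq_one hi, mul_one]

/-- On a route which uses only resource `j`, the invariant state is proportional to `q j`. -/
lemma invariantState_local {j : J} {i : I} (hi : 0 < net.incidence j i)
    (h : ∀ k, k ≠ j → net.incidence k i = 0) (q : J → ℝ) :
    net.invariantState ν μ q i = ν i / μ i * (q j / net.weight i) := by
  rw [invariantState_apply, LocalTraffic.sum_mul_incidence hi h]

/-- With local traffic the multipliers are controlled by the invariant state. -/
lemma exists_le_norm_invariantState [Nonempty J] (hν : ∀ i, 0 < ν i) (hμ : ∀ i, 0 < μ i)
    (hlocal : net.LocalTraffic) :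
    ∃ C : ℝ, 0 < C ∧ ∀ q : J → ℝ, ‖q‖ ≤ C * ‖net.invariantState ν μ q‖ := by
  choose loc hloc hloc' using hlocal
  have hpos : ∀ j, 0 < μ (loc j) / ν (loc j) * net.weight (loc j) := fun j =>
    mul_pos (div_pos (hμ _) (hν _)) (net.weight_pos _)
  refine ⟨∑ j, μ (loc j) / ν (loc j) * net.weight (loc j),
    Finset.sum_pos (fun j _ => hpos j) Finset.univ_nonempty, fun q => ?_⟩
  have hC0 := Finset.sum_nonneg fun j (_ : j ∈ Finset.univ) => (hpos j).le
  refine (pi_norm_le_iff_of_nonneg (mul_nonneg hC0 (norm_nonneg _))).2 fun j => ?_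
  have e : q j = μ (loc j) / ν (loc j) * net.weight (loc j) *
      net.invariantState ν μ q (loc j) := by
    rw [invariantState_local (hloc j) (hloc' j)]
    have := (hν (loc j)).ne'; have := (hμ (loc j)).ne'; have := (net.weight_pos (loc j)).ne'
    field_simp
  rw [e, norm_mul, Real.norm_of_nonneg (hpos j).le]
  refine mul_le_mul ?_ (norm_le_pi_norm _ _) (norm_nonneg _) hC0
  exact Finset.single_le_sum (f := fun j => μ (loc j) / ν (loc j) * net.weight (loc j))
    (fun j _ => (hpos j).le) (Finset.mem_univ j)

/-- With local traffic the quadratic form `q ↦ ‖n(q)‖²` of the invariant states is coercive. -/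
lemma exists_coercive [Nonempty J] [Nonempty I] (hν : ∀ i, 0 < ν i) (hμ : ∀ i, 0 < μ i)
    (hlocal : net.LocalTraffic) : ∃ c : ℝ, 0 < c ∧ ∀ q : J → ℝ,
      c * ‖q‖ ^ 2 ≤ net.energy ν (net.invariantState ν μ q) (net.invariantState ν μ q) := by
  obtain ⟨C, hC, hq⟩ := exists_le_norm_invariantState hν hμ hlocal
  obtain ⟨c, hc, -, -, hE, -⟩ := exists_energy_bounds net hν
  refine ⟨c / C ^ 2, by positivity, fun q => le_trans ?_ (hE _)⟩
  have h1 : ‖q‖ ^ 2 ≤ C ^ 2 * ‖net.invariantState ν μ q‖ ^ 2 := by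
    rw [← mul_pow]; exact pow_le_pow_left₀ (norm_nonneg _) (hq q) 2
  calc c / C ^ 2 * ‖q‖ ^ 2 ≤ c / C ^ 2 * (C ^ 2 * ‖net.invariantState ν μ q‖ ^ 2) := by gcongr
    _ = _ := by field_simp

variable (net ν μ) in
/-- The optimality conditions of the lifting problem at the workload `w`, for the multipliers `q` of
the workload constraints: a linear complementarity problem. -/
structure IsMultiplier (w q : J → ℝ) : Prop where
  nonneg : ∀ k, 0 ≤ q k
  le_workload : ∀ k, w k ≤ net.workloadMap μ (net.invariantState ν μ q) k
  complementary : ∑ k, q k * (net.workloadMap μ (net.invariantState ν μ q) k - w k) = 0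

/-- A multiplier exists: it minimizes the (coercive) dual objective over the orthant. -/
lemma exists_isMultiplier [Nonempty J] [Nonempty I] (hν : ∀ i, 0 < ν i) (hμ : ∀ i, 0 < μ i)
    (hlocal : net.LocalTraffic) (w : J → ℝ) : ∃ q, net.IsMultiplier ν μ w q := by
  classical
  obtain ⟨c, hc, hcoer⟩ := exists_coercive hν hμ hlocal
  set B := net.invariantState ν μ with hB
  set φ : (J → ℝ) → ℝ := fun q => 1 / 2 * net.energy ν (B q) (B q) - ∑ k, q k * w k with hφ
  have hBc : Continuous B := LinearMap.continuous_of_finiteDimensional B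
  have hφc : Continuous φ := by
    have h1 : ∀ i, Continuous fun q => B q i := fun i => (continuous_apply i).comp hBc
    simp only [hφ, energy]
    fun_prop
  set S : Set (J → ℝ) := {q | (∀ k, 0 ≤ q k) ∧ φ q ≤ 0} with hS
  have hScl : IsClosed S := by
    exact (isClosed_Ici (a := (0 : J → ℝ))).inter (isClosed_le hφc continuous_const)
  have hSb : Bornology.IsBounded S := by
    refine (Metric.isBounded_closedBall (x := (0 : J → ℝ))
      (r := 2 * (Fintype.card J * ‖w‖) / c)).subset fun q hq => ?_
    rw [mem_closedBall_zero_iff]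
    have h1 := hcoer q
    have h2 := (abs_le.1 (abs_sum_mul_le_card_mul_norm q w)).2
    have h3 : φ q ≤ 0 := hq.2
    simp only [hφ] at h3
    rw [le_div_iff₀ hc]
    rcases (norm_nonneg q).eq_or_lt with h0 | h0
    · rw [← h0, zero_mul]; positivity
    · have : ‖q‖ * (‖q‖ * c) ≤ ‖q‖ * (2 * (Fintype.card J * ‖w‖)) := by nlinarith
      exact le_of_mul_le_mul_left this h0
  have hφ0 : φ 0 = 0 := by simp [hφ, energy]
  obtain ⟨q, hqS, hqmin⟩ := (Metric.isCompact_of_isClosed_isBounded hScl hSb).exists_isMinOn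
    ⟨0, fun k => le_rfl, hφ0.le⟩ hφc.continuousOn
  have hmin : ∀ p : J → ℝ, (∀ k, 0 ≤ p k) → φ q ≤ φ p := fun p hp => by
    by_cases h : φ p ≤ 0
    · exact hqmin ⟨hp, h⟩
    · exact hqS.2.trans (not_le.1 h).le
  set g : J → ℝ := fun k => net.workloadMap μ (B q) k - w k with hg
  -- the variational inequality, from the minimality along the segment to `p`
  have hVI : ∀ p : J → ℝ, (∀ k, 0 ≤ p k) → 0 ≤ ∑ k, (p k - q k) * g k := fun p hp => by
    set D := net.energy ν (B (p - q)) (B (p - q)) with hD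
    have hDnn : 0 ≤ D := energy_self_nonneg hν _
    have key : ∀ t : ℝ, 0 < t → t ≤ 1 → 0 ≤ t * (∑ k, (p k - q k) * g k) + t ^ 2 * (1 / 2 * D) := by
      intro t ht ht1
      have h1 := hmin (q + t • (p - q)) fun k => by
        have : 0 ≤ (1 - t) * q k + t * p k :=
          add_nonneg (mul_nonneg (by linarith) (hqS.1 k)) (mul_nonneg ht.le (hp k))
        simpa [mul_sub] using by linarith
      have h2 : φ (q + t • (p - q)) = φ q + t * (∑ k, (p k - q k) * g k) + t ^ 2 * (1 / 2 * D) := by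
        have e1 : ∑ k, (p k - q k) * g k = net.energy ν (B (p - q)) (B q)
            - ∑ k, (p k - q k) * w k := by
          rw [energy_invariantState hν, ← Finset.sum_sub_distrib]
          exact Finset.sum_congr rfl fun k _ => by simp only [hg, Pi.sub_apply]; ring
        have e2 : ∑ k, (q + t • (p - q)) k * w k
            = ∑ k, q k * w k + t * ∑ k, (p k - q k) * w k := by
          rw [Finset.mul_sum, ← Finset.sum_add_distrib]
          exact Finset.sum_congr rfl fun k _ => by
            simp only [Pi.add_apply, Pi.smul_apply, Pi.sub_apply, smul_eq_mul]; ring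
        simp only [hφ]
        rw [e1, e2, map_add, map_smul, energy_add_left, energy_add_right, energy_add_right,
          energy_smul_left, energy_smul_left, energy_smul_right, energy_smul_right,
          energy_comm (B q) (B (p - q))]
        ring
      linarith
    by_contra! hneg
    -- a negative linear term would dominate in `key` for small `t`
    set s := ∑ k, (p k - q k) * g k
    have hDp : 0 < 1 / 2 * D + (-s) := by linarith
    have h3 := key ((-s) / (2 * (1 / 2 * D + (-s)))) (div_pos (by linarith) (by linarith))
      (by rw [div_le_one (by linarith)]; linarith)
    set t := (-s) / (2 * (1 / 2 * D + (-s))) with ht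
    have htpos : 0 < t := div_pos (by linarith) (by linarith)
    have h4 : t * (2 * (1 / 2 * D + (-s))) = -s := div_mul_cancel₀ _ (by linarith)
    nlinarith
  refine ⟨q, hqS.1, fun k => ?_, ?_⟩
  -- feasibility: the test direction of the `k`th unit vector
  · have h1 := hVI (q + Pi.single k 1) fun l => add_nonneg (hqS.1 l) (by
      by_cases h : l = k
      · subst h; simp
      · simp [Pi.single_eq_of_ne h])
    simp only [Pi.add_apply, add_sub_cancel_left] at h1
    rw [Finset.sum_eq_single k (fun l _ hl => by rw [Pi.single_eq_of_ne hl, zero_mul]) (by simp),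
      Pi.single_eq_same, one_mul] at h1
    simp only [hg] at h1
    linarith
  -- complementarity: the test points `0` and `2 q`
  · have h1 := hVI 0 fun _ => le_rfl
    have h2 := hVI (2 • q) fun k => by simpa using hqS.1 k
    have e1 : ∑ k, ((0 : J → ℝ) k - q k) * g k = -∑ k, q k * g k := by
      rw [← Finset.sum_neg_distrib]; exact Finset.sum_congr rfl fun k _ => by simp
    have e2 : ∑ k, ((2 • q) k - q k) * g k = ∑ k, q k * g k :=
      Finset.sum_congr rfl fun k _ => by simp [two_mul]
    rw [e1] at h1; rw [e2] at h2
    exact le_antisymm (by linarith) h2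

/-- Multipliers depend monotonically on the workload (in the sense of monotone operators). -/
lemma IsMultiplier.energy_sub_le (hν : ∀ i, 0 < ν i) {w w' q q' : J → ℝ}
    (h : net.IsMultiplier ν μ w q) (h' : net.IsMultiplier ν μ w' q') :
    net.energy ν (net.invariantState ν μ (q - q')) (net.invariantState ν μ (q - q'))
      ≤ ∑ k, (q k - q' k) * (w k - w' k) := by
  rw [energy_invariantState hν]
  have h1 : 0 ≤ ∑ k, q' k * (net.workloadMap μ (net.invariantState ν μ q) k - w k) :=
    Finset.sum_nonneg fun k _ => mul_nonneg (h'.nonneg k) (sub_nonneg.2 (h.le_workload k))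
  have h2 : 0 ≤ ∑ k, q k * (net.workloadMap μ (net.invariantState ν μ q') k - w' k) :=
    Finset.sum_nonneg fun k _ => mul_nonneg (h.nonneg k) (sub_nonneg.2 (h'.le_workload k))
  have h3 := h.complementary
  have h4 := h'.complementary
  have e : ∑ k, (q - q') k * net.workloadMap μ (net.invariantState ν μ (q - q')) k
      - ∑ k, (q k - q' k) * (w k - w' k) =
      ∑ k, q k * (net.workloadMap μ (net.invariantState ν μ q) k - w k)
      - ∑ k, q' k * (net.workloadMap μ (net.invariantState ν μ q) k - w k)
      - (∑ k, q k * (net.workloadMap μ (net.invariantState ν μ q') k - w' k)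
      - ∑ k, q' k * (net.workloadMap μ (net.invariantState ν μ q') k - w' k)) := by
    simp only [← Finset.sum_sub_distrib, map_sub, Pi.sub_apply]
    exact Finset.sum_congr rfl fun k _ => by ring
  linarith

/-- Multipliers are Lipschitz in the workload. -/
lemma exists_lipschitz_multiplier [Nonempty J] [Nonempty I] (hν : ∀ i, 0 < ν i)
    (hμ : ∀ i, 0 < μ i) (hlocal : net.LocalTraffic) : ∃ L : ℝ, 0 < L ∧ ∀ w w' q q' : J → ℝ,
      net.IsMultiplier ν μ w q → net.IsMultiplier ν μ w' q' → ‖q - q'‖ ≤ L * ‖w - w'‖ := by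
  obtain ⟨c, hc, hcoer⟩ := exists_coercive hν hμ hlocal
  refine ⟨Fintype.card J / c, div_pos (by exact_mod_cast Fintype.card_pos) hc,
    fun w w' q q' h h' => ?_⟩
  have h1 := (hcoer (q - q')).trans (h.energy_sub_le hν h')
  have h2 := (abs_le.1 (abs_sum_mul_le_card_mul_norm (q - q') (w - w'))).2
  simp only [Pi.sub_apply] at h2
  rw [div_mul_eq_mul_div, le_div_iff₀ hc]
  rcases (norm_nonneg (q - q')).eq_or_lt with h0 | h0
  · rw [← h0]; simp; positivity
  · have : ‖q - q'‖ * (‖q - q'‖ * c) ≤ ‖q - q'‖ * (Fintype.card J * ‖w - w'‖) := by nlinarith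
    exact le_of_mul_le_mul_left this h0

lemma isMultiplier_zero : net.IsMultiplier ν μ 0 0 :=
  ⟨fun _ => le_rfl, fun k => by simp, by simp⟩

lemma IsMultiplier.smul {w q : J → ℝ} (h : net.IsMultiplier ν μ w q) {c : ℝ} (hc : 0 ≤ c) :
    net.IsMultiplier ν μ (c • w) (c • q) where
  nonneg k := mul_nonneg hc (h.nonneg k)
  le_workload k := by
    rw [map_smul, map_smul]; exact mul_le_mul_of_nonneg_left (h.le_workload k) hc
  complementary := by
    have e : ∀ k, (c • q) k * (net.workloadMap μ (net.invariantState ν μ (c • q)) k - (c • w) k) =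
        c ^ 2 * (q k * (net.workloadMap μ (net.invariantState ν μ q) k - w k)) := fun k => by
      rw [map_smul, map_smul]; simp only [Pi.smul_apply, smul_eq_mul]; ring
    simp only [e, ← Finset.mul_sum, h.complementary, mul_zero]

lemma invariantState_nonneg (hν : ∀ i, 0 < ν i) (hμ : ∀ i, 0 < μ i) {q : J → ℝ}
    (hq : ∀ k, 0 ≤ q k) (i : I) : 0 ≤ net.invariantState ν μ q i :=
  mul_nonneg (div_nonneg (hν i).le (hμ i).le) (div_nonneg
    (Finset.sum_nonneg fun k _ => mul_nonneg (hq k) (net.incidence_nonneg k i))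
    (net.weight_pos i).le)

/-- The optimality conditions are sufficient: `Δ(w)` is the invariant state of the multipliers. -/
lemma IsMultiplier.lift_eq (hν : ∀ i, 0 < ν i) (hμ : ∀ i, 0 < μ i)
    {w : EuclideanSpace ℝ J} {q : J → ℝ} (h : net.IsMultiplier ν μ w.ofLp q) :
    net.lift ν μ w = WithLp.toLp 2 (net.invariantState ν μ q) := by
  set B := net.invariantState ν μ q with hB
  have hobj : ∀ n : EuclideanSpace ℝ I,
      net.liftObjective ν n = 1 / 2 * net.energy ν n.ofLp n.ofLp := fun n => by
    simp only [liftObjective, energy]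
    congr 1
    refine Finset.sum_congr rfl fun i _ => ?_
    have := (hν i).ne'
    field_simp
  have hkey : ∀ n : EuclideanSpace ℝ I, net.LiftFeasible μ w n →
      1 / 2 * net.energy ν B B + 1 / 2 * net.energy ν (n.ofLp - B) (n.ofLp - B)
        ≤ net.liftObjective ν n := fun n hn => by
    have h1 : net.energy ν B B ≤ net.energy ν B n.ofLp := by
      rw [energy_invariantState hν, energy_invariantState hν]
      have h2 := h.complementary
      have h3 : ∑ k, q k * w k ≤ ∑ k, q k * net.workloadMap μ n.ofLp k :=
        Finset.sum_le_sum fun k _ => mul_le_mul_of_nonneg_left (hn.2 k) (h.nonneg k)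
      simp only [mul_sub, Finset.sum_sub_distrib] at h2
      linarith
    rw [hobj, energy_sub_left, energy_sub_right, energy_sub_right, energy_comm n.ofLp B]
    linarith
  have hfeas : net.LiftFeasible μ w (WithLp.toLp 2 B) :=
    ⟨fun i => invariantState_nonneg hν hμ h.nonneg i, fun j => h.le_workload j⟩
  have hspec := Classical.epsilon_spec (p := fun n => net.LiftFeasible μ w n ∧
    ∀ n', net.LiftFeasible μ w n' → net.liftObjective ν n ≤ net.liftObjective ν n')
    ⟨WithLp.toLp 2 B, hfeas, fun n' hn' => by
      refine (hobj _).le.trans ?_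
      have := energy_self_nonneg (net := net) hν (n'.ofLp - B)
      linarith [hkey n' hn']⟩
  change net.LiftFeasible μ w (net.lift ν μ w) ∧ ∀ n', net.LiftFeasible μ w n' →
    net.liftObjective ν (net.lift ν μ w) ≤ net.liftObjective ν n' at hspec
  have h1 := hkey _ hspec.1
  have h2 := (hspec.2 _ hfeas).trans_eq (hobj _)
  have h3 : net.energy ν ((net.lift ν μ w).ofLp - B) ((net.lift ν μ w).ofLp - B) = 0 :=
    le_antisymm (by linarith) (energy_self_nonneg hν _)
  have h4 := energy_self_eq_zero hν h3
  rw [sub_eq_zero] at h4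
  rw [← h4]

/-- If `q` are the multipliers of the workload of `n`, the invariant state of `q` is the projection
of `n` onto the cone of invariant states, for the inner product `energy`. -/
lemma IsMultiplier.energy_sub_invariantState_le (hν : ∀ i, 0 < ν i) {n : I → ℝ} {q : J → ℝ}
    (h : net.IsMultiplier ν μ (net.workloadMap μ n) q) {p : J → ℝ} (hp : ∀ k, 0 ≤ p k) :
    net.energy ν (n - net.invariantState ν μ q) (net.invariantState ν μ p) ≤ 0 := by
  rw [energy_comm, energy_invariantState hν, map_sub]
  exact Finset.sum_nonpos fun k _ =>
    mul_nonpos_of_nonneg_of_nonpos (hp k) (sub_nonpos.2 (h.le_workload k))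

lemma IsMultiplier.energy_sub_invariantState_self (hν : ∀ i, 0 < ν i) {n : I → ℝ} {q : J → ℝ}
    (h : net.IsMultiplier ν μ (net.workloadMap μ n) q) :
    net.energy ν (n - net.invariantState ν μ q) (net.invariantState ν μ q) = 0 := by
  rw [energy_comm, energy_invariantState hν, map_sub, ← neg_eq_zero, ← Finset.sum_neg_distrib,
    ← h.complementary]
  exact Finset.sum_congr rfl fun k _ => by simp only [Pi.sub_apply]; ring

/-- The projection is the nearest point. -/
lemma IsMultiplier.energy_sub_le_of_nonneg (hν : ∀ i, 0 < ν i) {n : I → ℝ} {q : J → ℝ}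
    (h : net.IsMultiplier ν μ (net.workloadMap μ n) q) {p : J → ℝ} (hp : ∀ k, 0 ≤ p k) :
    net.energy ν (n - net.invariantState ν μ q) (n - net.invariantState ν μ q) ≤
      net.energy ν (n - net.invariantState ν μ p) (n - net.invariantState ν μ p) := by
  have h1 := h.energy_sub_invariantState_le hν hp
  have h2 := h.energy_sub_invariantState_self hν
  generalize ha : n - net.invariantState ν μ q = a at *
  have e : n - net.invariantState ν μ p =
      a + (net.invariantState ν μ q - net.invariantState ν μ p) := by rw [← ha]; abel
  rw [e, energy_add_left, energy_add_right, energy_add_right,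
    energy_comm (_ - _) a, energy_sub_right a]
  linarith [energy_self_nonneg (net := net) hν
    (net.invariantState ν μ q - net.invariantState ν μ p)]

end Lift

end Network

namespace Network

/-! ### Proportionally fair allocations -/

section Allocation

variable {net : Network J I}

lemma Feasible.le_capacity {n Λ : I → ℝ} (h : net.Feasible n Λ) {i : I} {j : J}
    (hj : j ∈ net.route i) : Λ i ≤ net.capacity j := by
  have h1 : net.incidence j i = 1 := by simp [incidence, hj]
  calc Λ i = net.incidence j i * Λ i := by rw [h1, one_mul]
    _ ≤ ∑ i, net.incidence j i * Λ i := Finset.single_le_sum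
        (f := fun i => net.incidence j i * Λ i)
        (fun i _ => mul_nonneg (net.incidence_nonneg j i) (h.1 i)) (Finset.mem_univ i)
    _ ≤ _ := h.2.2 j

lemma Feasible.le_sum_capacity {n Λ : I → ℝ} (h : net.Feasible n Λ) (i : I) :
    Λ i ≤ ∑ j, net.capacity j := by
  obtain ⟨j, hj⟩ := net.route_nonempty i
  exact (h.le_capacity hj).trans
    (Finset.single_le_sum (fun j _ => (net.capacity_pos j).le) (Finset.mem_univ j))

open Classical in
lemma objective_of_pos {n Λ : I → ℝ} (h : ∀ i, 0 < n i → 0 < Λ i) : net.objective n Λ =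
    ((∑ i with 0 < n i, net.weight i * n i * Real.log (Λ i) : ℝ) : EReal) := by
  simp only [objective]; rw [if_pos h]

lemma exists_pos_feasible [Nonempty J] [Nonempty I] (n : I → ℝ) :
    ∃ Λ, net.Feasible n Λ ∧ ∀ i, 0 < n i → 0 < Λ i := by
  classical
  obtain ⟨j0, -, hj0⟩ := Finset.exists_min_image Finset.univ net.capacity Finset.univ_nonempty
  have hI : (0 : ℝ) < Fintype.card I := by exact_mod_cast Fintype.card_pos
  have hc : 0 < net.capacity j0 / Fintype.card I := div_pos (net.capacity_pos j0) hI
  refine ⟨fun i => if n i = 0 then 0 else net.capacity j0 / Fintype.card I, ⟨fun i => ?_,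
    fun i hi => by simp [hi], fun j => ?_⟩, fun i hi => by simp [hi.ne', hc]⟩
  · dsimp only; split_ifs
    · exact le_rfl
    · exact hc.le
  · calc _ ≤ ∑ _i : I, net.capacity j0 / Fintype.card I := Finset.sum_le_sum fun i _ => by
          dsimp only; split_ifs
          · simpa using hc.le
          · exact mul_le_of_le_one_left hc.le (net.incidence_le_one j i)
      _ = net.capacity j0 := by simp; field_simp
      _ ≤ _ := hj0 j (Finset.mem_univ j)

/-- The optimization problem of proportional fairness has a solution.  It maximizes the continuous
function `∏ Λ_i ^ (κ_i n_i)` over the compact set of feasible allocations. -/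
lemma exists_isOptimalAllocation [Nonempty J] [Nonempty I] {n : I → ℝ} :
    ∃ Λ, net.IsOptimalAllocation n Λ := by
  classical
  set g : (I → ℝ) → ℝ := fun Λ => ∏ i with 0 < n i, Λ i ^ (net.weight i * n i) with hg
  set S : Set (I → ℝ) := {Λ | net.Feasible n Λ} with hS
  have hexp : ∀ i ∈ Finset.univ.filter fun i => 0 < n i, 0 < net.weight i * n i := fun i hi =>
    mul_pos (net.weight_pos i) (Finset.mem_filter.1 hi).2
  have hgc : Continuous g := continuous_finsetProd _ fun i hi =>
    (continuous_apply i).rpow_const fun _ => Or.inr (hexp i hi).le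
  have hScl : IsClosed S := by
    have h2 : IsClosed {Λ : I → ℝ | ∀ i, n i = 0 → Λ i = 0} := by
      have e : {Λ : I → ℝ | ∀ i, n i = 0 → Λ i = 0} = ⋂ i, ⋂ _ : n i = 0, {Λ | Λ i = 0} := by
        ext Λ; simp
      rw [e]
      exact isClosed_iInter fun i => isClosed_iInter fun _ =>
        isClosed_eq (continuous_apply i) continuous_const
    have h3 : IsClosed {Λ : I → ℝ | ∀ j, ∑ i, net.incidence j i * Λ i ≤ net.capacity j} := by
      have e : {Λ : I → ℝ | ∀ j, ∑ i, net.incidence j i * Λ i ≤ net.capacity j} =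
          ⋂ j, {Λ | ∑ i, net.incidence j i * Λ i ≤ net.capacity j} := by
        ext Λ; simp
      rw [e]
      exact isClosed_iInter fun j => isClosed_le (by fun_prop) continuous_const
    exact (isClosed_Ici (a := (0 : I → ℝ))).inter (h2.inter h3)
  have hSb : Bornology.IsBounded S :=
    (Metric.isBounded_closedBall (x := (0 : I → ℝ)) (r := ∑ j, net.capacity j)).subset
      fun Λ hΛ => by
        rw [mem_closedBall_zero_iff]
        refine (pi_norm_le_iff_of_nonneg
          (Finset.sum_nonneg fun j _ => (net.capacity_pos j).le)).2 fun i => ?_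
        rw [Real.norm_of_nonneg (hΛ.1 i)]
        exact Feasible.le_sum_capacity hΛ i
  obtain ⟨Λ0, hΛ0, hpos0⟩ := exists_pos_feasible (net := net) n
  obtain ⟨Λ, hΛ, hmax⟩ := (Metric.isCompact_of_isClosed_isBounded hScl hSb).exists_isMaxOn
    ⟨Λ0, hΛ0⟩ hgc.continuousOn
  have hgpos : ∀ Λ' : I → ℝ, (∀ i, 0 < n i → 0 < Λ' i) → 0 < g Λ' := fun Λ' h =>
    Finset.prod_pos fun i hi => Real.rpow_pos_of_pos (h i (Finset.mem_filter.1 hi).2) _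
  have hlog : ∀ Λ' : I → ℝ, (∀ i, 0 < n i → 0 < Λ' i) →
      net.objective n Λ' = ((Real.log (g Λ') : ℝ) : EReal) := fun Λ' h => by
    rw [objective_of_pos h, hg, Real.log_prod fun i hi =>
      (Real.rpow_pos_of_pos (h i (Finset.mem_filter.1 hi).2) _).ne']
    congr 1
    refine Finset.sum_congr (by ext; simp) fun i hi => ?_
    rw [Real.log_rpow (h i (Finset.mem_filter.1 hi).2)]
  have hΛpos : ∀ i, 0 < n i → 0 < Λ i := fun i hi => by
    refine lt_of_le_of_ne (hΛ.1 i) fun h0 => ?_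
    have h1 : g Λ = 0 := Finset.prod_eq_zero (Finset.mem_filter.2 ⟨Finset.mem_univ i, hi⟩) (by
      rw [← h0, Real.zero_rpow (mul_pos (net.weight_pos i) hi).ne'])
    have h2 := (hgpos Λ0 hpos0).trans_le (hmax hΛ0)
    exact h2.ne' h1
  refine ⟨Λ, hΛ, fun Λ' hΛ' => ?_⟩
  by_cases h : ∀ i, 0 < n i → 0 < Λ' i
  · rw [hlog Λ' h, hlog Λ hΛpos]
    exact EReal.coe_le_coe_iff.2 (Real.log_le_log (hgpos Λ' h) (hmax hΛ'))
  · simp [objective, h]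

lemma isOptimalAllocation_allocation [Nonempty J] [Nonempty I] (n : I → ℝ) :
    net.IsOptimalAllocation n (net.allocation n) :=
  Classical.epsilon_spec exists_isOptimalAllocation

lemma IsOptimalAllocation.pos [Nonempty J] [Nonempty I] {n Λ : I → ℝ}
    (h : net.IsOptimalAllocation n Λ) {i : I} (hi : 0 < n i) : 0 < Λ i := by
  obtain ⟨Λ0, hΛ0, hpos0⟩ := exists_pos_feasible (net := net) n
  have h1 := h.2 Λ0 hΛ0
  rw [objective_of_pos hpos0] at h1
  by_contra hneg
  have h2 : net.objective n Λ = ⊥ := by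
    simp only [objective]; rw [if_neg fun h' => hneg (h' i hi)]
  rw [h2] at h1
  exact EReal.coe_ne_bot _ (le_bot_iff.1 h1)

/-- Optimality compared with a positive allocation which need not vanish on the empty routes. -/
lemma IsOptimalAllocation.sum_log_le [Nonempty J] [Nonempty I] {n Λ Λ' : I → ℝ}
    (hn : ∀ i, 0 ≤ n i) (h : net.IsOptimalAllocation n Λ) (hpos : ∀ i, 0 < Λ' i)
    (hcap : ∀ j, ∑ i, net.incidence j i * Λ' i ≤ net.capacity j) :
    ∑ i, net.weight i * n i * Real.log (Λ' i) ≤ ∑ i, net.weight i * n i * Real.log (Λ i) := by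
  classical
  set Λ'' : I → ℝ := fun i => if n i = 0 then 0 else Λ' i with hΛ''
  have hle : ∀ i, Λ'' i ≤ Λ' i := fun i => by
    simp only [hΛ'']; split_ifs
    · exact (hpos i).le
    · exact le_rfl
  have hf : net.Feasible n Λ'' := ⟨fun i => by
      simp only [hΛ'']; split_ifs
      · exact le_rfl
      · exact (hpos i).le, fun i hi => by simp [hΛ'', hi], fun j =>
      (Finset.sum_le_sum fun i _ => mul_le_mul_of_nonneg_left (hle i)
        (net.incidence_nonneg j i)).trans (hcap j)⟩
  have hp'' : ∀ i, 0 < n i → 0 < Λ'' i := fun i hi => by simp [hΛ'', hi.ne', hpos i]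
  have h1 := h.2 _ hf
  rw [objective_of_pos hp'', objective_of_pos fun i hi => h.pos hi, EReal.coe_le_coe_iff] at h1
  have e : ∀ Θ : I → ℝ, ∑ i, net.weight i * n i * Real.log (Θ i) =
      ∑ i with 0 < n i, net.weight i * n i * Real.log (Θ i) := fun Θ => by
    rw [Finset.sum_filter]
    refine Finset.sum_congr rfl fun i _ => ?_
    split_ifs with hi
    · rfl
    · rw [le_antisymm (not_lt.1 hi) (hn i)]; simp
  have e' : ∑ i with 0 < n i, net.weight i * n i * Real.log (Λ' i) =
      ∑ i with 0 < n i, net.weight i * n i * Real.log (Λ'' i) :=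
    Finset.sum_congr rfl fun i hi => by
      simp [hΛ'', (Finset.mem_filter.1 hi).2.ne']
  rw [e, e, e']
  convert h1

/-- A resource is saturated as soon as a route which uses only that resource is nonempty:
otherwise that route could be given more bandwidth. -/
lemma IsOptimalAllocation.saturated [Nonempty J] [Nonempty I] {n Λ : I → ℝ}
    (h : net.IsOptimalAllocation n Λ) {j : J} {i : I} (hi : 0 < n i) (hji : 0 < net.incidence j i)
    (hloc : ∀ k, k ≠ j → net.incidence k i = 0) :
    ∑ i, net.incidence j i * Λ i = net.capacity j := by
  classical
  refine le_antisymm (h.1.2.2 j) (not_lt.1 fun hlt => ?_)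
  set s := net.capacity j - ∑ i, net.incidence j i * Λ i with hs
  have hspos : 0 < s := sub_pos.2 hlt
  set Λ' : I → ℝ := Λ + Pi.single i s with hΛ'
  have hsingle : ∀ i', 0 ≤ (Pi.single i s : I → ℝ) i' := fun i' => by
    by_cases hii : i' = i
    · subst hii; simpa using hspos.le
    · simp [Pi.single_eq_of_ne hii]
  have hsum : ∀ k, ∑ i', net.incidence k i' * Λ' i' =
      ∑ i', net.incidence k i' * Λ i' + net.incidence k i * s := fun k => by
    simp only [hΛ', Pi.add_apply, mul_add, Finset.sum_add_distrib]
    congr 1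
    rw [Finset.sum_eq_single i (fun i' _ hii => by rw [Pi.single_eq_of_ne hii, mul_zero])
      (by simp), Pi.single_eq_same]
  have hf : net.Feasible n Λ' := ⟨fun i' => add_nonneg (h.1.1 i') (hsingle i'), fun i' hi' => by
      have hii : i' ≠ i := fun hii => hi.ne' (hii ▸ hi')
      simp [hΛ', h.1.2.1 i' hi', Pi.single_eq_of_ne hii], fun k => by
      rw [hsum]
      by_cases hk : k = j
      · subst hk; rw [net.incidence_eq_one hji]; linarith
      · rw [hloc k hk, zero_mul, add_zero]; exact h.1.2.2 k⟩
  have hp' : ∀ i', 0 < n i' → 0 < Λ' i' := fun i' hi' =>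
    add_pos_of_pos_of_nonneg (h.pos hi') (hsingle i')
  have h1 := h.2 _ hf
  rw [objective_of_pos hp', objective_of_pos fun i hi => h.pos hi, EReal.coe_le_coe_iff] at h1
  refine absurd h1 (not_le.2 (Finset.sum_lt_sum (fun i' hi' => ?_) ⟨i, by simpa using hi, ?_⟩))
  · have := (Finset.mem_filter.1 hi').2
    refine mul_le_mul_of_nonneg_left (Real.log_le_log (h.pos this) ?_)
      (mul_nonneg (net.weight_pos _).le this.le)
    exact le_add_of_nonneg_right (hsingle i')
  · refine mul_lt_mul_of_pos_left (Real.log_lt_log (h.pos hi) ?_)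
      (mul_pos (net.weight_pos _) hi)
    simpa [hΛ'] using hspos

end Allocation

section Drift

variable {net : Network J I} {ν μ : I → ℝ}

lemma sub_two_mul_sq_le_log_one_add {x : ℝ} (hx : -(1 / 2) ≤ x) :
    x - 2 * x ^ 2 ≤ Real.log (1 + x) := by
  have h1 : 0 < 1 + x := by linarith
  refine le_trans ?_ (Real.one_sub_inv_le_log_of_pos h1)
  rw [← sub_nonneg]
  have e : 1 - (1 + x)⁻¹ - (x - 2 * x ^ 2) = x ^ 2 * (1 + 2 * x) / (1 + x) := by
    field_simp; ring
  rw [e]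
  exact div_nonneg (mul_nonneg (sq_nonneg _) (by linarith)) h1.le

/-- The solution of the lifting problem is Lipschitz in the workload. -/
lemma exists_lipschitz_invariantState [Nonempty J] [Nonempty I] (hν : ∀ i, 0 < ν i)
    (hμ : ∀ i, 0 < μ i) (hlocal : net.LocalTraffic) : ∃ L : ℝ, 0 < L ∧ ∀ w w' q q' : J → ℝ,
      net.IsMultiplier ν μ w q → net.IsMultiplier ν μ w' q' →
      ‖net.invariantState ν μ q - net.invariantState ν μ q'‖ ≤ L * ‖w - w'‖ := by
  obtain ⟨L, hL, hq⟩ := exists_lipschitz_multiplier hν hμ hlocal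
  obtain ⟨C, hC, hB⟩ := LinearMap.exists_pos_bound (net.invariantState ν μ)
  refine ⟨C * L, by positivity, fun w w' q q' h h' => ?_⟩
  rw [← map_sub, mul_assoc]
  exact (hB _).trans (mul_le_mul_of_nonneg_left (hq w w' q q' h h') hC.le)

/-- The mean velocity `ν - μ Λ(n)` points towards the cone of invariant states, in critical
loading: half the squared distance to the cone decreases at a rate which is proportional to the
squared distance divided by the size of the state.  The comparison allocation in the proof moves
`ρ` a little in the direction of `M⁻¹ (n - Π n)`, where `Π n` is the projection of `n`. -/
lemma exists_drift_bound [Nonempty J] [Nonempty I] (hν : ∀ i, 0 < ν i) (hμ : ∀ i, 0 < μ i)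
    (hlocal : net.LocalTraffic)
    (hcrit : ∀ j, ∑ i, net.incidence j i * (ν i / μ i) = net.capacity j) :
    ∃ c : ℝ, 0 < c ∧ ∀ K : ℝ, 0 < K → ∀ n : I → ℝ, (∀ i, 0 ≤ n i) → ‖n‖ ≤ K →
      ∀ q, net.IsMultiplier ν μ (net.workloadMap μ n) q →
      net.energy ν (n - net.invariantState ν μ q) (fun i => ν i - μ i * net.allocation n i) ≤
        -(c / K) * net.energy ν (n - net.invariantState ν μ q) (n - net.invariantState ν μ q) := by
  obtain ⟨L, hL, hLip⟩ := exists_lipschitz_invariantState hν hμ hlocal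
  obtain ⟨C, hC, hwl⟩ := LinearMap.exists_pos_bound (net.workloadMap μ)
  obtain ⟨i0, -, hi0⟩ := Finset.exists_min_image Finset.univ ν Finset.univ_nonempty
  have hD : 1 ≤ 1 + L * C := by nlinarith
  set a := ν i0 / (4 * (1 + L * C)) with ha
  have hapos : 0 < a := div_pos (hν i0) (by linarith)
  refine ⟨a / 2, by positivity, fun K hK n hn hnK q hq => ?_⟩
  set B := net.invariantState ν μ q with hB
  set h := n - B with hh
  set Λ := net.allocation n with hΛ
  have hopt := isOptimalAllocation_allocation (net := net) n
  rw [← hΛ] at hopt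
  have hhK : ‖h‖ ≤ (1 + L * C) * K := by
    have h1 := hLip _ _ _ _ hq isMultiplier_zero
    rw [map_zero, sub_zero, sub_zero] at h1
    calc ‖h‖ ≤ ‖n‖ + ‖B‖ := norm_sub_le _ _
      _ ≤ ‖n‖ + L * (C * ‖n‖) := by
        gcongr; exact h1.trans (mul_le_mul_of_nonneg_left (hwl n) hL.le)
      _ = (1 + L * C) * ‖n‖ := by ring
      _ ≤ _ := by gcongr
  set ε := a / K with hε
  have hεpos : 0 < ε := div_pos hapos hK
  set x : I → ℝ := fun i => ε * h i / ν i with hx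
  have hx2 : ∀ i, -(1 / 2) ≤ x i := fun i => by
    have h1 : |h i| ≤ (1 + L * C) * K := (norm_le_pi_norm h i).trans hhK
    have h2 : ε * |h i| ≤ ν i / 2 := by
      calc ε * |h i| ≤ ε * ((1 + L * C) * K) := by gcongr
        _ = ν i0 / 4 := by rw [hε, ha]; field_simp
        _ ≤ ν i / 2 := by linarith [hi0 i (Finset.mem_univ i), hν i0]
    have h3 : -(1 / 2 * ν i) ≤ ε * h i := by
      nlinarith [neg_abs_le (h i), mul_le_mul_of_nonneg_left (neg_abs_le (h i)) hεpos.le]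
    simp only [hx]
    rw [le_div_iff₀ (hν i)]
    linarith
  -- the comparison allocation `ρ + ε M⁻¹ h`; the factor `a` makes `|x| ≤ 1 / 2` and `4 ε n ≤ ν`
  set Λ' : I → ℝ := fun i => ν i / μ i * (1 + x i) with hΛ'
  have hρ : ∀ i, 0 < ν i / μ i := fun i => div_pos (hν i) (hμ i)
  have hΛ'pos : ∀ i, 0 < Λ' i := fun i => mul_pos (hρ i) (by linarith [hx2 i])
  have hcap : ∀ j, ∑ i, net.incidence j i * Λ' i ≤ net.capacity j := fun j => by
    have e : ∑ i, net.incidence j i * Λ' i = net.capacity j + ε * net.workloadMap μ h j := by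
      rw [workloadMap_apply, ← hcrit j, Finset.mul_sum, ← Finset.sum_add_distrib]
      refine Finset.sum_congr rfl fun i _ => ?_
      have := (hν i).ne'; have := (hμ i).ne'
      simp only [hΛ', hx]; field_simp
    have h1 : net.workloadMap μ h j ≤ 0 := by
      rw [hh, map_sub]; exact sub_nonpos.2 (hq.le_workload j)
    rw [e]
    nlinarith
  have hlog := hopt.sum_log_le hn hΛ'pos hcap
  have hκn : ∀ i, 0 ≤ net.weight i * n i := fun i => mul_nonneg (net.weight_pos i).le (hn i)
  -- `log y ≤ y - 1` at `y = Λ / ρ`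
  have hstep1 : net.energy ν n (fun i => ν i - μ i * Λ i) ≤
      ∑ i, net.weight i * n i * Real.log (ν i / μ i)
        - ∑ i, net.weight i * n i * Real.log (Λ i) := by
    rw [← Finset.sum_sub_distrib]
    refine Finset.sum_le_sum fun i _ => ?_
    rcases (hn i).eq_or_lt with h0 | h0
    · simp [← h0]
    have hΛi := hopt.pos h0
    have h1 := Real.log_le_sub_one_of_pos (div_pos hΛi (hρ i))
    rw [Real.log_div hΛi.ne' (hρ i).ne'] at h1
    have e : net.weight i / ν i * (n i * (ν i - μ i * Λ i)) =
        net.weight i * n i * (1 - Λ i / (ν i / μ i)) := by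
      have := (hν i).ne'; have := (hμ i).ne'
      field_simp
    rw [e, ← mul_sub]
    exact mul_le_mul_of_nonneg_left (by linarith) (hκn i)
  have hstep2 : ∑ i, net.weight i * n i * Real.log (Λ' i) ≥
      ∑ i, net.weight i * n i * Real.log (ν i / μ i) +
        ∑ i, net.weight i * n i * (x i - 2 * x i ^ 2) := by
    rw [← Finset.sum_add_distrib]
    refine Finset.sum_le_sum fun i _ => ?_
    rw [← mul_add]
    refine mul_le_mul_of_nonneg_left ?_ (hκn i)
    simp only [hΛ']
    rw [Real.log_mul (hρ i).ne' (by linarith [hx2 i])]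
    linarith [sub_two_mul_sq_le_log_one_add (hx2 i)]
  -- the linear term is `ε` times the squared distance, and dominates the quadratic one
  have hstep3 : ε / 2 * net.energy ν h h ≤ ∑ i, net.weight i * n i * (x i - 2 * x i ^ 2) := by
    have e1 : net.energy ν h h = net.energy ν n h := by
      conv_lhs => rw [hh, energy_sub_left, energy_comm B (n - B),
        hq.energy_sub_invariantState_self hν, sub_zero]
    have e2 : ∑ i, net.weight i * n i * (x i - 2 * x i ^ 2) = ε * net.energy ν n h
        - ∑ i, net.weight i * n i * (2 * x i ^ 2) := by
      simp only [energy]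
      rw [Finset.mul_sum, ← Finset.sum_sub_distrib]
      refine Finset.sum_congr rfl fun i _ => ?_
      have := (hν i).ne'
      simp only [hx]; field_simp
    have e3 : ∑ i, net.weight i * n i * (2 * x i ^ 2) ≤ ε / 2 * net.energy ν h h := by
      simp only [energy]
      rw [Finset.mul_sum]
      refine Finset.sum_le_sum fun i _ => ?_
      have h1 : n i ≤ K := (le_abs_self _).trans ((norm_le_pi_norm n i).trans hnK)
      have h2 : 4 * ε * n i ≤ ν i := by
        calc 4 * ε * n i ≤ 4 * ε * K := by gcongr
          _ = ν i0 / (1 + L * C) := by rw [hε, ha]; field_simp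
          _ ≤ ν i0 := div_le_self (hν i0).le hD
          _ ≤ ν i := hi0 i (Finset.mem_univ i)
      have e : net.weight i * n i * (2 * x i ^ 2) =
          ε / 2 * (net.weight i / ν i * (h i * h i)) * (4 * ε * n i / ν i) := by
        have := (hν i).ne'
        simp only [hx]; field_simp; ring
      rw [e]
      refine mul_le_of_le_one_right ?_ ((div_le_one (hν i)).2 h2)
      exact mul_nonneg (by positivity) (mul_nonneg
        (div_nonneg (net.weight_pos i).le (hν i).le) (mul_self_nonneg _))
    rw [e2, ← e1]; linarith
  -- the projection contributes the unused capacity, weighted by the multipliers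
  have hstep4 : 0 ≤ net.energy ν B (fun i => ν i - μ i * Λ i) := by
    rw [hB, energy_invariantState hν]
    refine Finset.sum_nonneg fun k _ => mul_nonneg (hq.nonneg k) ?_
    have e : net.workloadMap μ (fun i => ν i - μ i * Λ i) k =
        net.capacity k - ∑ i, net.incidence k i * Λ i := by
      rw [workloadMap_apply, ← hcrit k, ← Finset.sum_sub_distrib]
      refine Finset.sum_congr rfl fun i _ => ?_
      have := (hμ i).ne'
      field_simp
    rw [e]
    exact sub_nonneg.2 (hopt.1.2.2 k)
  have e5 : a / 2 / K = ε / 2 := by rw [hε]; ring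
  rw [e5, hh, energy_sub_left]
  rw [← hh]
  linarith

end Drift

end Network

/-! ### Right-continuous functions and their integrals -/

/-- A right-continuous function is the limit of step functions with grid points to the right. -/
lemma measurable_of_forall_continuousWithinAt_Ici {g : ℝ → ℝ}
    (hg : ∀ t, ContinuousWithinAt g (Set.Ici t) t) : Measurable g := by
  have hlim : Tendsto (fun k : ℕ => fun t : ℝ => g ((⌊((k : ℝ) + 1) * t⌋ + 1) / ((k : ℝ) + 1)))
      atTop (𝓝 g) := by
    rw [tendsto_pi_nhds]
    intro t
    have hk : ∀ k : ℕ, (0 : ℝ) < (k : ℝ) + 1 := fun k => by positivity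
    have hlow : ∀ k : ℕ, t ≤ (⌊((k : ℝ) + 1) * t⌋ + 1) / ((k : ℝ) + 1) := fun k => by
      rw [le_div_iff₀ (hk k), mul_comm]; exact (Int.lt_floor_add_one _).le
    have hup : ∀ k : ℕ, (⌊((k : ℝ) + 1) * t⌋ + 1) / ((k : ℝ) + 1) ≤ t + 1 / ((k : ℝ) + 1) :=
      fun k => by
        rw [div_le_iff₀ (hk k), add_mul t, one_div, inv_mul_cancel₀ (hk k).ne', mul_comm t]
        linarith [Int.floor_le (((k : ℝ) + 1) * t)]
    refine (hg t).tendsto.comp (tendsto_nhdsWithin_iff.2 ⟨?_, Eventually.of_forall hlow⟩)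
    refine tendsto_of_tendsto_of_tendsto_of_le_of_le tendsto_const_nhds ?_ hlow hup
    simpa using tendsto_const_nhds.add (tendsto_one_div_add_atTop_nhds_zero_nat (𝕜 := ℝ))
  refine measurable_of_tendsto_metrizable (fun k => ?_) hlim
  have h1 : Measurable fun t : ℝ => ⌊((k : ℝ) + 1) * t⌋ :=
    Int.measurable_floor.comp (measurable_const.mul measurable_id)
  exact (measurable_from_top (f := fun z : ℤ => g ((z + 1) / ((k : ℝ) + 1)))).comp h1

section RightContinuous

variable {g : ℝ → ℝ}

lemma intervalIntegrable_of_continuousWithinAt_Ici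
    (hg : ∀ t, ContinuousWithinAt g (Set.Ici t) t) {C : ℝ} (hC : ∀ t, |g t| ≤ C) (a b : ℝ) :
    IntervalIntegrable g volume a b := by
  rw [intervalIntegrable_iff]
  refine Measure.integrableOn_of_bounded (M := C) (by simp) ?_ (Eventually.of_forall hC)
  exact (measurable_of_forall_continuousWithinAt_Ici hg).aestronglyMeasurable

lemma hasDerivWithinAt_integral_Ici (hg : ∀ t, ContinuousWithinAt g (Set.Ici t) t) {C : ℝ}
    (hC : ∀ t, |g t| ≤ C) (a t : ℝ) :
    HasDerivWithinAt (fun t => ∫ s in a..t, g s) (g t) (Set.Ici t) t :=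
  intervalIntegral.integral_hasDerivWithinAt_right
    (intervalIntegrable_of_continuousWithinAt_Ici hg hC a t)
    (measurable_of_forall_continuousWithinAt_Ici hg).stronglyMeasurable.stronglyMeasurableAtFilter
    ((hg t).mono Set.Ioi_subset_Ici_self)

lemma continuous_integral_of_continuousWithinAt_Ici
    (hg : ∀ t, ContinuousWithinAt g (Set.Ici t) t) {C : ℝ} (hC : ∀ t, |g t| ≤ C) (a : ℝ) :
    Continuous fun t => ∫ s in a..t, g s :=
  intervalIntegral.continuous_primitive
    (fun a b => intervalIntegrable_of_continuousWithinAt_Ici hg hC a b) a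

end RightContinuous

/-- A right-continuous function with small increments over intervals of length `r` is close to a
continuous function whose right derivative is small: its forward moving average. -/
lemma exists_smoothing {m : ℝ → ℝ} {ε r b : ℝ} (hr : 0 < r) (hε : 0 ≤ ε) (hb : 0 ≤ b)
    (hm : ∀ t, 0 ≤ t → ContinuousWithinAt m (Set.Ici t) t)
    (hmod : ∀ s t, 0 ≤ s → s ≤ t → t ≤ b + r → |m t - m s| ≤ ε * (r + (t - s))) :
    ∃ f f' : ℝ → ℝ, Continuous f ∧ (∀ t, HasDerivWithinAt f (f' t) (Set.Ici t) t) ∧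
      (∀ t ∈ Set.Icc 0 b, |f t - m t| ≤ 2 * ε * r) ∧ ∀ t ∈ Set.Icc 0 b, |f' t| ≤ 2 * ε := by
  set g : ℝ → ℝ := fun t => m (min (max t 0) (b + r)) with hg
  have hclip : ∀ t, min (max t 0) (b + r) ∈ Set.Icc 0 (b + r) := fun t =>
    ⟨le_min (le_max_right _ _) (by linarith), min_le_right _ _⟩
  have hid : ∀ t ∈ Set.Icc 0 (b + r), g t = m t := fun t ht => by
    simp only [hg]; rw [max_eq_left ht.1, min_eq_left ht.2]
  have hgc : ∀ t, ContinuousWithinAt g (Set.Ici t) t := fun t => by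
    refine (hm _ (hclip t).1).comp (f := fun t => min (max t 0) (b + r))
      (by fun_prop : Continuous fun t : ℝ => min (max t 0) (b + r)).continuousWithinAt ?_
    exact fun s hs => min_le_min_right _ (max_le_max_right _ (Set.mem_Ici.1 hs))
  have hgb : ∀ t, |g t| ≤ |m 0| + ε * (r + (b + r)) := fun t => by
    have h1 := hmod 0 _ le_rfl (hclip t).1 (hclip t).2
    have h2 : |g t| ≤ |m 0| + |g t - m 0| := by
      have := abs_add_le (m 0) (g t - m 0)
      rwa [add_sub_cancel] at this
    refine h2.trans (add_le_add le_rfl (h1.trans ?_))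
    have := (hclip t).2
    gcongr
    linarith
  set F : ℝ → ℝ := fun t => ∫ s in (0 : ℝ)..t, g s with hF
  have hFc : Continuous F := continuous_integral_of_continuousWithinAt_Ici hgc hgb 0
  have hFd : ∀ t, HasDerivWithinAt F (g t) (Set.Ici t) t := hasDerivWithinAt_integral_Ici hgc hgb 0
  have hFi := intervalIntegrable_of_continuousWithinAt_Ici hgc hgb
  refine ⟨fun t => r⁻¹ * (F (t + r) - F t), fun t => r⁻¹ * (g (t + r) - g t), by fun_prop,
    fun t => ?_, fun t ht => ?_, fun t ht => ?_⟩
  · refine HasDerivWithinAt.const_mul _ (HasDerivWithinAt.sub ?_ (hFd t))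
    have h1 := (hFd (t + r)).scomp t (h := fun t => t + r) (s := Set.Ici t)
      ((hasDerivWithinAt_id t _).add_const r) (fun s hs => by
        simp only [Set.mem_Ici] at hs ⊢; linarith)
    simpa [Function.comp_def] using h1
  · have e : r⁻¹ * (F (t + r) - F t) - m t = r⁻¹ * ∫ s in t..(t + r), (g s - m t) := by
      rw [intervalIntegral.integral_sub (hFi _ _) (by simp), intervalIntegral.integral_const,
        hF, intervalIntegral.integral_interval_sub_left (hFi _ _) (hFi _ _)]
      simp only [add_sub_cancel_left, smul_eq_mul]
      field_simp
    have h1 : ‖∫ s in t..(t + r), (g s - m t)‖ ≤ (2 * ε * r) * |t + r - t| := by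
      refine intervalIntegral.norm_integral_le_of_norm_le_const fun s hs => ?_
      rw [Set.uIoc_of_le (by linarith)] at hs
      rw [hid s ⟨ht.1.trans hs.1.le, by linarith [hs.2, ht.2]⟩]
      refine (hmod t s ht.1 hs.1.le (by linarith [hs.2, ht.2])).trans ?_
      have : s - t ≤ r := by linarith [hs.2]
      nlinarith
    rw [e, abs_mul, abs_of_pos (inv_pos.2 hr)]
    rw [add_sub_cancel_left, abs_of_pos hr, Real.norm_eq_abs] at h1
    rw [inv_mul_le_iff₀ hr]
    linarith
  · dsimp only
    rw [hid t ⟨ht.1, by linarith [ht.2]⟩, hid (t + r) ⟨by linarith [ht.1], by linarith [ht.2]⟩,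
      abs_mul, abs_of_pos (inv_pos.2 hr), inv_mul_le_iff₀ hr]
    refine (hmod t (t + r) ht.1 (by linarith) (by linarith [ht.2])).trans (le_of_eq ?_)
    ring

namespace Network

/-! ### The bandwidth received along a path -/

section Path

variable (net : Network J I)

/-- The bandwidth given to route `i` at time `t` along a path, extended to negative times by its
value at time `0`. -/
def pathRate (N : ℝ → I → ℕ) (i : I) (t : ℝ) : ℝ :=
  net.allocation (fun i' => (N (max t 0) i' : ℝ)) i

variable {net} {N : ℝ → I → ℕ}

lemma continuousWithinAt_comp_path {α : Type*} [TopologicalSpace α] (f : (I → ℕ) → α) {t : ℝ}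
    (hN : ContinuousWithinAt N (Set.Ici t) t) :
    ContinuousWithinAt (fun s => f (N s)) (Set.Ici t) t :=
  (continuous_of_discreteTopology (f := f)).continuousAt.comp_continuousWithinAt hN

lemma continuousWithinAt_pathRate (hN : ∀ t, 0 ≤ t → ContinuousWithinAt N (Set.Ici t) t) (i : I)
    (t : ℝ) : ContinuousWithinAt (net.pathRate N i) (Set.Ici t) t := by
  refine (continuousWithinAt_comp_path (fun n => net.allocation (fun i' => (n i' : ℝ)) i)
    (hN (max t 0) (le_max_right _ _))).comp (f := fun t => max t 0)
    (by fun_prop : Continuous fun t : ℝ => max t 0).continuousWithinAt ?_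
  exact fun s hs => max_le_max_right _ (Set.mem_Ici.1 hs)

variable (net) in
/-- The cumulative bandwidth given to route `i` along a path, as a function on the whole line. -/
def pathBandwidth (N : ℝ → I → ℕ) (i : I) (t : ℝ) : ℝ := ∫ s in (0 : ℝ)..t, net.pathRate N i s

lemma cumulativeBandwidth_eq (N : ℝ → I → ℕ) (i : I) {t : ℝ} (ht : 0 ≤ t) :
    net.cumulativeBandwidth N i t = net.pathBandwidth N i t := by
  refine intervalIntegral.integral_congr fun s hs => ?_
  rw [Set.uIcc_of_le ht] at hs
  simp only [pathRate]; rw [max_eq_left hs.1]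

lemma pathBandwidth_zero (N : ℝ → I → ℕ) (i : I) : net.pathBandwidth N i 0 = 0 :=
  intervalIntegral.integral_same

variable [Nonempty J] [Nonempty I]

lemma allocation_nonneg (n : I → ℝ) (i : I) : 0 ≤ net.allocation n i :=
  (isOptimalAllocation_allocation n).1.1 i

lemma allocation_le (n : I → ℝ) (i : I) : net.allocation n i ≤ ∑ j, net.capacity j :=
  (isOptimalAllocation_allocation n).1.le_sum_capacity i

lemma abs_pathRate_le (N : ℝ → I → ℕ) (i : I) (t : ℝ) :
    |net.pathRate N i t| ≤ ∑ j, net.capacity j := by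
  rw [pathRate, abs_of_nonneg (allocation_nonneg _ _)]; exact allocation_le _ _

lemma hasDerivWithinAt_pathBandwidth (hN : ∀ t, 0 ≤ t → ContinuousWithinAt N (Set.Ici t) t)
    (i : I) (t : ℝ) :
    HasDerivWithinAt (net.pathBandwidth N i) (net.pathRate N i t) (Set.Ici t) t :=
  hasDerivWithinAt_integral_Ici (continuousWithinAt_pathRate hN i) (abs_pathRate_le N i) 0 t

lemma continuous_pathBandwidth (hN : ∀ t, 0 ≤ t → ContinuousWithinAt N (Set.Ici t) t) (i : I) :
    Continuous (net.pathBandwidth N i) :=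
  continuous_integral_of_continuousWithinAt_Ici (continuousWithinAt_pathRate hN i)
    (abs_pathRate_le N i) 0

lemma pathBandwidth_sub_mem (hN : ∀ t, 0 ≤ t → ContinuousWithinAt N (Set.Ici t) t) (i : I)
    {s t : ℝ} (hst : s ≤ t) : net.pathBandwidth N i t - net.pathBandwidth N i s ∈
      Set.Icc 0 ((∑ j, net.capacity j) * (t - s)) := by
  have hI := intervalIntegrable_of_continuousWithinAt_Ici
    (continuousWithinAt_pathRate (net := net) hN i) (abs_pathRate_le N i)
  rw [pathBandwidth, pathBandwidth, intervalIntegral.integral_interval_sub_left (hI _ _) (hI _ _)]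
  refine ⟨intervalIntegral.integral_nonneg hst fun u _ => allocation_nonneg _ _, ?_⟩
  have h1 := intervalIntegral.integral_mono_on hst (hI s t)
    (intervalIntegrable_const (c := ∑ j, net.capacity j))
    fun u _ => (le_abs_self _).trans (abs_pathRate_le N i u)
  simpa [mul_comm] using h1

end Path
end Network

namespace Network

/-! ### State space collapse along a path -/

/-- The state of the path `N` at time `t`, as a real vector. -/
def pathState (N : ℝ → I → ℕ) (t : ℝ) : I → ℝ := fun i => (N t i : ℝ)

/-- The deviation of the path `N` from its mean dynamics with arrival rates `ν` and service rates
`μ`. -/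
def pathNoise (net : Network J I) (ν μ : I → ℝ) (N : ℝ → I → ℕ) (i : I) (t : ℝ) : ℝ :=
  N t i - N 0 i - ν i * t + μ i * net.pathBandwidth N i t

variable {net : Network J I} {ν μ : I → ℝ}

lemma _root_.Continuous.eventually_lt_nhdsGT_zero {F : ℝ → ℝ} (hF : Continuous F) {b : ℝ}
    (h0 : F 0 < b) : ∀ᶠ ε in 𝓝[>] (0 : ℝ), F ε < b :=
  (hF.continuousAt.eventually_lt continuousAt_const h0).filter_mono nhdsWithin_le_nhds

lemma continuousWithinAt_pathNoise [Nonempty J] [Nonempty I] {N : ℝ → I → ℕ}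
    (hN : ∀ t, 0 ≤ t → ContinuousWithinAt N (Set.Ici t) t) (i : I) (t : ℝ) (ht : 0 ≤ t) :
    ContinuousWithinAt (net.pathNoise ν μ N i) (Set.Ici t) t := by
  have h1 := continuousWithinAt_comp_path (fun n => (n i : ℝ)) (hN t ht)
  have h2 := (continuous_pathBandwidth (net := net) hN i).continuousWithinAt (s := Set.Ici t)
    (x := t)
  unfold pathNoise
  fun_prop

lemma hasDerivWithinAt_energy_self {y : ℝ → I → ℝ} {y' : I → ℝ} {t : ℝ} {s : Set ℝ}
    (p : I → ℝ) (hy : ∀ i, HasDerivWithinAt (fun u => y u i) (y' i) s t) :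
    HasDerivWithinAt (fun u => net.energy ν (y u - p) (y u - p))
      (2 * net.energy ν (y t - p) y') s t := by
  simp only [energy, Finset.mul_sum]
  refine HasDerivWithinAt.fun_sum fun i _ => ?_
  have h1 := (hy i).sub_const (p i)
  exact ((h1.mul h1).const_mul (net.weight i / ν i)).congr_deriv (by
    simp only [Pi.sub_apply]; ring)

/-- State space collapse.  Consider a path which stays of order `r` up to time `b`, starts near the
cone of invariant states, and whose noise has increments of small order `ε r` over intervals of
length `r`.  Then the path stays near its projections to the cone.  Indeed, replacing the noise by
its moving average changes the path by `O(ε r)`, and when the resulting differentiable path has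
distance `η r / 2` from the cone, the drift towards the cone exceeds the contribution `O(ε r)` of
the noise. -/
lemma exists_collapse [Nonempty J] [Nonempty I] (hν : ∀ i, 0 < ν i) (hμ : ∀ i, 0 < μ i)
    (hlocal : net.LocalTraffic)
    (hcrit : ∀ j, ∑ i, net.incidence j i * (ν i / μ i) = net.capacity j)
    {K η : ℝ} (hK : 0 < K) (hη : 0 < η) :
    ∀ᶠ ε in 𝓝[>] (0 : ℝ), ∀ r : ℝ, 0 < r → ∀ ν' μ' : I → ℝ,
      (∀ i, |ν' i - ν i| ≤ ε) → (∀ i, |μ' i - μ i| ≤ ε) →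
      ∀ N : ℝ → I → ℕ, (∀ t, 0 ≤ t → ContinuousWithinAt N (Set.Ici t) t) →
      ∀ b : ℝ, 0 ≤ b → (∀ i s t, 0 ≤ s → s ≤ t → t ≤ b + r →
        |net.pathNoise ν' μ' N i t - net.pathNoise ν' μ' N i s| ≤ ε * (r + (t - s))) →
      (∃ p : J → ℝ, (∀ k, 0 ≤ p k) ∧ ‖pathState N 0 - net.invariantState ν μ p‖ ≤ ε * r) →
      (∀ t ∈ Set.Icc 0 b, ‖pathState N t‖ ≤ K * r) →
      ∀ t ∈ Set.Icc 0 b, ∀ q, net.IsMultiplier ν μ (net.workloadMap μ (pathState N t)) q →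
        ‖pathState N t - net.invariantState ν μ q‖ ≤ η * r := by
  obtain ⟨L, hL, hLip⟩ := exists_lipschitz_invariantState hν hμ hlocal
  obtain ⟨C, hC, hwl⟩ := LinearMap.exists_pos_bound (net.workloadMap μ)
  obtain ⟨cE, hcE, D, hD, hElow, hEup⟩ := exists_energy_bounds net hν
  obtain ⟨c, hc, hdrift⟩ := exists_drift_bound hν hμ hlocal hcrit
  choose Q hQ using fun w => exists_isMultiplier (net := net) hν hμ hlocal w
  set Ct := ∑ j, net.capacity j with hCt
  have hCt0 : 0 ≤ Ct := Finset.sum_nonneg fun j _ => (net.capacity_pos j).le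
  set H := 1 + L * C with hH
  have hH0 : 0 < H := by positivity
  set V := ‖ν‖ + ‖μ‖ * Ct with hV
  have hV0 : 0 ≤ V := by positivity
  have hη2 : 0 < cE * (η / 2) ^ 2 / 2 := by positivity
  have ev1 : ∀ᶠ ε in 𝓝[>] (0 : ℝ), H * (2 * ε) < η / 2 :=
    Continuous.eventually_lt_nhdsGT_zero (by fun_prop) (by simpa using hη)
  have ev2 : ∀ᶠ ε in 𝓝[>] (0 : ℝ), D * (3 * ε) ^ 2 < cE * (η / 2) ^ 2 :=
    Continuous.eventually_lt_nhdsGT_zero (by fun_prop) (by simpa using by positivity)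
  have ev3 : ∀ᶠ ε in 𝓝[>] (0 : ℝ), 2 * (D * ((η / 2) * (H * (2 * ε)))) < cE * (η / 2) ^ 2 / 2 :=
    Continuous.eventually_lt_nhdsGT_zero (by fun_prop) (by simpa using hη2)
  have ev4 : ∀ᶠ ε in 𝓝[>] (0 : ℝ), D * (H * (2 * ε) * V) + D * (η / 2 * (ε * (3 + Ct)))
      < c / K * (cE * (η / 2) ^ 2 / 2) :=
    Continuous.eventually_lt_nhdsGT_zero (by fun_prop) (by simpa using by positivity)
  filter_upwards [ev1, ev2, ev3, ev4, self_mem_nhdsWithin] with ε e1 e2 e3 e4 hε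
  intro r hr ν' μ' hν' hμ' N hN b hb hmod hinit hbound
  have hε0 : 0 < ε := hε
  choose f f' hfc hfd hfm hfs using fun i =>
    exists_smoothing hr hε0.le hb (continuousWithinAt_pathNoise (ν := ν') (μ := μ') hN i) (hmod i)
  -- the smoothed path
  set Y : ℝ → I → ℝ := fun t i =>
    N 0 i + ν' i * t - μ' i * net.pathBandwidth N i t + f i t with hY
  set Y' : ℝ → I → ℝ := fun t i => ν' i - μ' i * net.pathRate N i t + f' i t with hY'
  have hYd : ∀ t i, HasDerivWithinAt (fun u => Y u i) (Y' t i) (Set.Ici t) t := fun t i => by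
    have h1 := ((hasDerivWithinAt_id t (Set.Ici t)).const_mul (ν' i)).const_add (N 0 i : ℝ)
    have h2 := (hasDerivWithinAt_pathBandwidth (net := net) hN i t).const_mul (μ' i)
    have h3 := (h1.sub h2).add (hfd i t)
    simp only [mul_one] at h3
    exact h3
  have hYc : Continuous Y := continuous_pi fun i => by
    have h2 := continuous_pathBandwidth (net := net) hN i
    have := hfc i
    simp only [hY]; fun_prop
  have hYn : ∀ t ∈ Set.Icc 0 b, ‖Y t - pathState N t‖ ≤ 2 * ε * r := fun t ht => by
    refine (pi_norm_le_iff_of_nonneg (by positivity)).2 fun i => ?_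
    have e : (Y t - pathState N t) i = f i t - net.pathNoise ν' μ' N i t := by
      simp only [hY, pathState, pathNoise, Pi.sub_apply]; ring
    rw [e]; exact hfm i t ht
  set proj : (I → ℝ) → (I → ℝ) := fun y => net.invariantState ν μ (Q (net.workloadMap μ y))
    with hproj
  have hprojLip : ∀ y z, ‖proj y - proj z‖ ≤ L * C * ‖y - z‖ := fun y z => by
    refine (hLip _ _ _ _ (hQ _) (hQ _)).trans ?_
    rw [← map_sub, mul_assoc]
    exact mul_le_mul_of_nonneg_left (hwl _) hL.le
  have hprojc : Continuous proj := (LipschitzWith.of_dist_le' (K := L * C) fun y z => by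
    rw [dist_eq_norm, dist_eq_norm]; exact hprojLip y z).continuous
  set h : (I → ℝ) → (I → ℝ) := fun y => y - proj y with hh
  have hhc : Continuous h := continuous_id.sub hprojc
  have hhLip : ∀ y z, ‖h y - h z‖ ≤ H * ‖y - z‖ := fun y z => by
    have e : h y - h z = (y - z) - (proj y - proj z) := by simp only [hh]; abel
    rw [e]
    refine (norm_sub_le _ _).trans ?_
    have := hprojLip y z
    rw [hH]; linarith
  set φ : ℝ → ℝ := fun t => net.energy ν (h (Y t)) (h (Y t)) with hφ
  have hφc : Continuous φ := by
    have h1 : ∀ i, Continuous fun t => h (Y t) i := fun i =>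
      (continuous_apply i).comp (hhc.comp hYc)
    simp only [hφ, energy]; fun_prop
  set e := cE * (η / 2 * r) ^ 2 with he
  have hnorm : ∀ y, net.energy ν (h y) (h y) ≤ e → ‖h y‖ ≤ η / 2 * r := fun y hy => by
    have h1 := (hElow (h y)).trans hy
    exact le_of_sq_le_sq (le_of_mul_le_mul_left h1 hcE) (by positivity)
  have hmain : ∀ ⦃t⦄, t ∈ Set.Icc 0 b → φ t ≤ e := by
    refine image_le_of_liminf_slope_right_lt_deriv_boundary' (B := fun _ => e) (B' := fun _ => 0)
      (f' := fun t => 2 * net.energy ν (h (Y t)) (Y' t)) hφc.continuousOn ?_ ?_ continuousOn_const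
      (fun t _ => hasDerivWithinAt_const _ _ _) ?_
    · intro t ht ρ hρ
      -- compare with the squared distance to the projection at the time `t`
      have hd := hasDerivWithinAt_energy_self (net := net) (ν := ν) (proj (Y t)) (hYd t)
      have hs := ((hasDerivWithinAt_iff_tendsto_slope' (Set.self_notMem_Ioi)).1
        (hd.mono Set.Ioi_subset_Ici_self)).eventually_lt_const hρ
      refine (hs.and self_mem_nhdsWithin).frequently.mono fun z hz => lt_of_le_of_lt ?_ hz.1
      have hz2 : 0 < z - t := sub_pos.2 hz.2
      simp only [slope_def_field]
      refine (div_le_div_iff_of_pos_right hz2).2 (sub_le_sub_right ?_ _)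
      exact (hQ (net.workloadMap μ (Y z))).energy_sub_le_of_nonneg hν (hQ _).nonneg
    · obtain ⟨p, hp, hp'⟩ := hinit
      have h1 : φ 0 ≤ _ := (hQ (net.workloadMap μ (Y 0))).energy_sub_le_of_nonneg hν hp
      have h2 : ‖Y 0 - net.invariantState ν μ p‖ ≤ 3 * ε * r := by
        have e : Y 0 - net.invariantState ν μ p =
            (Y 0 - pathState N 0) + (pathState N 0 - net.invariantState ν μ p) := by abel
        rw [e]
        refine (norm_add_le _ _).trans ?_
        linarith [hYn 0 ⟨le_rfl, hb⟩]
      refine h1.trans (((le_abs_self _).trans (hEup _ _)).trans ?_)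
      calc _ ≤ D * ((3 * ε * r) * (3 * ε * r)) := by gcongr
        _ = D * (3 * ε) ^ 2 * r ^ 2 := by ring
        _ ≤ cE * (η / 2) ^ 2 * r ^ 2 := by gcongr
        _ = e := by rw [he]; ring
    · intro t ht hte
      have htb : t ∈ Set.Icc 0 b := ⟨ht.1, ht.2.le⟩
      set x := pathState N t with hx
      set a := h (Y t) with ha
      set v : I → ℝ := fun i => ν i - μ i * net.allocation x i with hv
      have hrate : ∀ i, net.pathRate N i t = net.allocation x i := fun i => by
        simp only [pathRate]; rw [max_eq_left ht.1]; rfl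
      have hanorm : ‖a‖ ≤ η / 2 * r := hnorm _ hte.le
      have hd : ‖a - h x‖ ≤ H * (2 * ε * r) :=
        (hhLip _ _).trans (mul_le_mul_of_nonneg_left (hYn t htb) hH0.le)
      have hal : ∀ i, |net.allocation x i| ≤ Ct := fun i => by
        rw [abs_of_nonneg (allocation_nonneg _ _)]; exact allocation_le _ _
      have hvn : ‖v‖ ≤ V := (pi_norm_le_iff_of_nonneg hV0).2 fun i => by
        refine (norm_sub_le _ _).trans (add_le_add (norm_le_pi_norm ν i) ?_)
        rw [norm_mul]
        exact mul_le_mul (norm_le_pi_norm μ i) (hal i) (norm_nonneg _) (norm_nonneg _)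
      have hen : ‖Y' t - v‖ ≤ ε * (3 + Ct) := by
        refine (pi_norm_le_iff_of_nonneg (by positivity)).2 fun i => ?_
        have e : (Y' t - v) i = (ν' i - ν i) - (μ' i - μ i) * net.allocation x i + f' i t := by
          simp only [hY', hv, Pi.sub_apply, hrate]; ring
        rw [e, Real.norm_eq_abs]
        refine (abs_add_le _ _).trans ?_
        have h1 := abs_sub (ν' i - ν i) ((μ' i - μ i) * net.allocation x i)
        have h2 : |(μ' i - μ i) * net.allocation x i| ≤ ε * Ct := by
          rw [abs_mul]; exact mul_le_mul (hμ' i) (hal i) (abs_nonneg _) hε0.le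
        linarith [hν' i, hfs i t htb]
      have hdr : net.energy ν (h x) v ≤ -(c / (K * r)) * net.energy ν (h x) (h x) :=
        hdrift (K * r) (by positivity) x (fun i => Nat.cast_nonneg _) (hbound t htb) _ (hQ _)
      have hE1 : e / 2 ≤ net.energy ν (h x) (h x) := by
        have e5 : net.energy ν (h x) (h x) = e - 2 * net.energy ν a (a - h x)
            + net.energy ν (a - h x) (a - h x) := by
          have h1 := energy_sub_left (net := net) (ν := ν) a (h x) (a - h x)
          have h2 := energy_sub_right (net := net) (ν := ν) a a (h x)
          have h3 := energy_sub_right (net := net) (ν := ν) (h x) a (h x)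
          have h4 := energy_comm (net := net) (ν := ν) (h x) a
          have h5 : net.energy ν a a = e := hte
          linarith
        have h1 : net.energy ν a (a - h x) ≤ D * ((η / 2 * r) * (H * (2 * ε * r))) :=
          ((le_abs_self _).trans (hEup _ _)).trans (by gcongr)
        have h2 : 2 * (D * ((η / 2 * r) * (H * (2 * ε * r)))) ≤ e / 2 := by
          calc _ = 2 * (D * ((η / 2) * (H * (2 * ε)))) * r ^ 2 := by ring
            _ ≤ cE * (η / 2) ^ 2 / 2 * r ^ 2 := by gcongr
            _ = _ := by rw [he]; ring
        have h3 := energy_self_nonneg (net := net) hν (a - h x)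
        linarith
      have hsplit : net.energy ν a (Y' t) = net.energy ν (h x) v + net.energy ν (a - h x) v
          + net.energy ν a (Y' t - v) := by
        have h1 := energy_sub_left (net := net) (ν := ν) a (h x) v
        have h2 := energy_sub_right (net := net) (ν := ν) a (Y' t) v
        linarith
      have h1 : net.energy ν (a - h x) v ≤ D * (H * (2 * ε * r) * V) :=
        ((le_abs_self _).trans (hEup _ _)).trans (by gcongr)
      have h2 : net.energy ν a (Y' t - v) ≤ D * (η / 2 * r * (ε * (3 + Ct))) :=
        ((le_abs_self _).trans (hEup _ _)).trans (by gcongr)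
      have h3 : -(c / (K * r)) * net.energy ν (h x) (h x) ≤
          -(c / K * (cE * (η / 2) ^ 2 / 2)) * r := by
        have : c / (K * r) * (e / 2) ≤ c / (K * r) * net.energy ν (h x) (h x) := by gcongr
        have e6 : c / (K * r) * (e / 2) = c / K * (cE * (η / 2) ^ 2 / 2) * r := by
          rw [he]; field_simp
        linarith
      have h4 := mul_lt_mul_of_pos_right e4 hr
      have : net.energy ν a (Y' t) < 0 := by
        rw [hsplit]
        calc _ ≤ -(c / K * (cE * (η / 2) ^ 2 / 2)) * r + D * (H * (2 * ε * r) * V)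
              + D * (η / 2 * r * (ε * (3 + Ct))) := by linarith
          _ < 0 := by linarith
      linarith
  intro t ht q hq
  have h1 := hnorm _ (hmain ht)
  have h2 : ‖h (pathState N t)‖ ≤ η * r := by
    have e7 : h (pathState N t) = h (Y t) - (h (Y t) - h (pathState N t)) := by abel
    rw [e7]
    refine (norm_sub_le _ _).trans ?_
    have h3 := (hhLip (Y t) (pathState N t)).trans
      (mul_le_mul_of_nonneg_left (hYn t ht) hH0.le)
    have h4 := mul_lt_mul_of_pos_right e1 hr
    linarith
  have h5 : net.invariantState ν μ q = proj (pathState N t) := by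
    have := hLip _ _ _ _ hq (hQ (net.workloadMap μ (pathState N t)))
    rw [sub_self, norm_zero, mul_zero] at this
    exact sub_eq_zero.1 (norm_le_zero_iff.1 this)
  rw [h5]; exact h2

end Network

namespace Network

/-! ### Pathwise bounds for the unused capacity and the state -/

/-- The cumulative unused capacity along a path. -/
def pathUnused (net : Network J I) (N : ℝ → I → ℕ) (t : ℝ) : J → ℝ := fun j =>
  net.capacity j * t - ∑ i, net.incidence j i * net.pathBandwidth N i t

/-- The rate at which capacity is left unused along a path. -/
def pathIdleRate (net : Network J I) (N : ℝ → I → ℕ) (t : ℝ) : J → ℝ := fun j =>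
  net.capacity j - ∑ i, net.incidence j i * net.pathRate N i t

variable {net : Network J I} {ν μ : I → ℝ}

lemma pathUnused_zero (N : ℝ → I → ℕ) : net.pathUnused N 0 = 0 := by
  ext j; simp [pathUnused, pathBandwidth_zero]

section Unused

variable [Nonempty J] [Nonempty I] {N : ℝ → I → ℕ}

lemma hasDerivWithinAt_pathUnused (hN : ∀ t, 0 ≤ t → ContinuousWithinAt N (Set.Ici t) t) (t : ℝ) :
    HasDerivWithinAt (net.pathUnused N) (net.pathIdleRate N t) (Set.Ici t) t := by
  refine hasDerivWithinAt_pi.2 fun j => ?_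
  have h1 := (hasDerivWithinAt_id t (Set.Ici t)).const_mul (net.capacity j)
  have h2 : HasDerivWithinAt (fun t => ∑ i, net.incidence j i * net.pathBandwidth N i t)
      (∑ i, net.incidence j i * net.pathRate N i t) (Set.Ici t) t :=
    HasDerivWithinAt.fun_sum fun i _ =>
      (hasDerivWithinAt_pathBandwidth (net := net) hN i t).const_mul _
  have h3 := h1.sub h2
  rw [mul_one] at h3
  exact h3

lemma continuous_pathUnused (hN : ∀ t, 0 ≤ t → ContinuousWithinAt N (Set.Ici t) t) :
    Continuous (net.pathUnused N) := continuous_pi fun j => by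
  have := continuous_pathBandwidth (net := net) hN
  unfold pathUnused; fun_prop

lemma pathIdleRate_nonneg (N : ℝ → I → ℕ) (t : ℝ) (j : J) : 0 ≤ net.pathIdleRate N t j :=
  sub_nonneg.2 ((isOptimalAllocation_allocation _).1.2.2 j)

lemma pathIdleRate_eq_zero {j : J} {i : I} (hji : 0 < net.incidence j i)
    (hloc : ∀ k, k ≠ j → net.incidence k i = 0) {t : ℝ} (ht : 0 ≤ t) (hi : 0 < N t i) :
    net.pathIdleRate N t j = 0 := by
  refine sub_eq_zero.2 (Eq.symm ((isOptimalAllocation_allocation _).saturated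
    (i := i) ?_ hji hloc))
  rw [max_eq_left ht]; exact_mod_cast hi

/-- The matrix `q ↦ A M⁻¹ n(q)`, which maps multipliers to the workload of their invariant state,
is invertible. -/
lemma exists_inverse_workload_invariantState (hν : ∀ i, 0 < ν i) (hμ : ∀ i, 0 < μ i)
    (hlocal : net.LocalTraffic) :
    ∃ R : (J → ℝ) →ₗ[ℝ] (J → ℝ),
      (∀ u, net.workloadMap μ (net.invariantState ν μ (R u)) = u) ∧
      ∀ q, R (net.workloadMap μ (net.invariantState ν μ q)) = q := by
  obtain ⟨c, hc, hcoer⟩ := exists_coercive (net := net) hν hμ hlocal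
  set G := (net.workloadMap μ).comp (net.invariantState ν μ) with hG
  have hinj : Function.Injective G := by
    rw [injective_iff_map_eq_zero]
    intro q hq
    have h1 := hcoer q
    rw [energy_invariantState hν] at h1
    have h2 : net.workloadMap μ (net.invariantState ν μ q) = 0 := hq
    rw [h2] at h1
    simp only [Pi.zero_apply, mul_zero, Finset.sum_const_zero] at h1
    have h3 : ‖q‖ ^ 2 ≤ 0 := nonpos_of_mul_nonpos_right h1 hc
    exact norm_eq_zero.1 (pow_eq_zero_iff two_ne_zero |>.1 (le_antisymm h3 (sq_nonneg _)))
  set e := LinearEquiv.ofInjectiveEndo G hinj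
  exact ⟨e.symm, fun u => e.apply_symm_apply u, fun q => e.symm_apply_apply q⟩

/-- A bound for the unused capacity.  Suppose that along a path the state is within `r` of an
invariant state with multipliers `q`, and that the workload of the latter differs from the unused
capacity `U` by at most `x`.  Then `U = O(r + x)`.  With `R` the inverse of the matrix
`q ↦ A M⁻¹ n(q)`, the derivative of `½ U ⬝ R U` is `R U ⬝ U'`, in which `R U = q + O(x)`, and
`U_j` increases only while `q_j` is `O(r)`, as the local route of the resource `j` is then empty.
Hence `½ U ⬝ R U` is at most a multiple of `(r + x) ∑ U_j`. -/
lemma exists_unused_bound (hν : ∀ i, 0 < ν i) (hμ : ∀ i, 0 < μ i)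
    (hlocal : net.LocalTraffic) : ∃ C : ℝ, 0 < C ∧ ∀ r x : ℝ, 0 ≤ r → 0 ≤ x →
      ∀ N : ℝ → I → ℕ, (∀ t, 0 ≤ t → ContinuousWithinAt N (Set.Ici t) t) →
      ∀ b : ℝ, ∀ q : ℝ → J → ℝ,
      (∀ t ∈ Set.Icc 0 b, ‖pathState N t - net.invariantState ν μ (q t)‖ ≤ r) →
      (∀ t ∈ Set.Icc 0 b,
        ‖net.workloadMap μ (net.invariantState ν μ (q t)) - net.pathUnused N t‖ ≤ x) →
      ∀ t ∈ Set.Icc 0 b, ‖net.pathUnused N t‖ ≤ C * (r + x) := by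
  obtain ⟨R, hR1, hR2⟩ := exists_inverse_workload_invariantState hν hμ hlocal
  obtain ⟨g, hg, hRb⟩ := LinearMap.exists_pos_bound R
  obtain ⟨g', hg', hGb⟩ := LinearMap.exists_pos_bound
    ((net.workloadMap μ).comp (net.invariantState ν μ))
  obtain ⟨c, hc, hcoer⟩ := exists_coercive (net := net) hν hμ hlocal
  choose loc hloc hloc' using hlocal
  have hposj : ∀ j, 0 < μ (loc j) * net.weight (loc j) / ν (loc j) := fun j =>
    div_pos (mul_pos (hμ _) (net.weight_pos _)) (hν _)
  set c1 := ∑ j, μ (loc j) * net.weight (loc j) / ν (loc j) with hc1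
  have hc1pos : 0 < c1 := Finset.sum_pos (fun j _ => hposj j) Finset.univ_nonempty
  have hform : ∀ u v, ∑ k, R u k * v k =
      net.energy ν (net.invariantState ν μ (R u)) (net.invariantState ν μ (R v)) := fun u v => by
    rw [energy_invariantState hν, hR1]
  have hsymm : ∀ u v, ∑ k, R u k * v k = ∑ k, R v k * u k := fun u v => by
    rw [hform, hform, energy_comm]
  have hlow : ∀ u, c / g' ^ 2 * ‖u‖ ^ 2 ≤ ∑ k, R u k * u k := fun u => by
    rw [hform]
    refine le_trans ?_ (hcoer _)
    have h1 : ‖u‖ ≤ g' * ‖R u‖ := by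
      have := hGb (R u)
      rwa [LinearMap.comp_apply, hR1] at this
    rw [div_mul_eq_mul_div, div_le_iff₀ (by positivity)]
    calc c * ‖u‖ ^ 2 ≤ c * (g' * ‖R u‖) ^ 2 := by gcongr
      _ = _ := by ring
  set d : ℝ := (Fintype.card J : ℝ) with hd
  have hd0 : 0 < d := by rw [hd]; exact_mod_cast Fintype.card_pos
  refine ⟨2 * (c1 + g) * d / (c / g' ^ 2), by positivity,
    fun r x hr hx N hN b q hstate hU t ht => ?_⟩
  set U := net.pathUnused N with hUdef
  set u := net.pathIdleRate N with hudef
  have hUd : ∀ t, HasDerivWithinAt U (u t) (Set.Ici t) t := hasDerivWithinAt_pathUnused hN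
  have hUc : Continuous U := continuous_pathUnused hN
  have hRc : Continuous R := LinearMap.continuous_of_finiteDimensional R
  have hRd : ∀ t, HasDerivWithinAt (fun t => R (U t)) (R (u t)) (Set.Ici t) t := fun t =>
    (LinearMap.toContinuousLinearMap R).hasFDerivAt.comp_hasDerivWithinAt t (hUd t)
  set β := c1 * r + g * x with hβ
  have hβ0 : 0 ≤ β := by positivity
  have hcomp : ∀ ⦃t⦄, t ∈ Set.Icc 0 b → ∑ k, R (U t) k * U t k ≤ 2 * β * ∑ k, U t k := by
    refine image_le_of_deriv_right_le_deriv_boundary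
      (f' := fun t => 2 * ∑ k, R (U t) k * u t k) (B' := fun t => 2 * β * ∑ k, u t k)
      ?_ ?_ ?_ ?_ ?_ ?_
    · have h1 : ∀ k, Continuous fun t => R (U t) k := fun k =>
        (continuous_apply k).comp (hRc.comp hUc)
      have h2 : ∀ k, Continuous fun t => U t k := fun k => (continuous_apply k).comp hUc
      exact (continuous_finsetSum _ fun k _ => (h1 k).mul (h2 k)).continuousOn
    · intro t _
      have h1 : HasDerivWithinAt (fun t => ∑ k, R (U t) k * U t k)
          (∑ k, (R (u t) k * U t k + R (U t) k * u t k)) (Set.Ici t) t :=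
        HasDerivWithinAt.fun_sum fun k _ =>
          (hasDerivWithinAt_pi.1 (hRd t) k).mul (hasDerivWithinAt_pi.1 (hUd t) k)
      refine h1.congr_deriv ?_
      rw [Finset.sum_add_distrib, hsymm (u t) (U t), two_mul]
    · rw [hUdef, pathUnused_zero]; simp
    · have h2 : ∀ k, Continuous fun t => U t k := fun k => (continuous_apply k).comp hUc
      exact (continuous_const.mul (continuous_finsetSum _ fun k _ => h2 k)).continuousOn
    · intro t _
      exact (HasDerivWithinAt.fun_sum fun k _ => hasDerivWithinAt_pi.1 (hUd t) k).const_mul _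
    · intro t ht
      have htb : t ∈ Set.Icc 0 b := ⟨ht.1, ht.2.le⟩
      suffices h : ∀ k, R (U t) k * u t k ≤ β * u t k by
        have h1 := Finset.sum_le_sum fun k (_ : k ∈ Finset.univ) => h k
        rw [← Finset.mul_sum] at h1
        linarith
      intro k
      -- either the local route of `k` is nonempty and `k` is saturated, or `q t k` is small
      by_cases hk : 0 < N t (loc k)
      · rw [hudef, pathIdleRate_eq_zero (hloc k) (hloc' k) ht.1 hk, mul_zero, mul_zero]
      · refine mul_le_mul_of_nonneg_right ?_ (pathIdleRate_nonneg N t k)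
        have hk0 : N t (loc k) = 0 := by omega
        have h1 := (norm_le_pi_norm _ (loc k)).trans (hstate t htb)
        rw [Pi.sub_apply, invariantState_local (hloc k) (hloc' k), pathState, hk0, Nat.cast_zero,
          zero_sub, norm_neg] at h1
        have h2 : q t k ≤ μ (loc k) * net.weight (loc k) / ν (loc k) * r := by
          have e : q t k = μ (loc k) * net.weight (loc k) / ν (loc k) *
              (ν (loc k) / μ (loc k) * (q t k / net.weight (loc k))) := by
            have := (hν (loc k)).ne'; have := (hμ (loc k)).ne'
            have := (net.weight_pos (loc k)).ne'
            field_simp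
          rw [e]
          exact mul_le_mul_of_nonneg_left ((le_abs_self _).trans h1) (hposj k).le
        have h3 : μ (loc k) * net.weight (loc k) / ν (loc k) ≤ c1 :=
          Finset.single_le_sum (f := fun k => μ (loc k) * net.weight (loc k) / ν (loc k))
            (fun k _ => (hposj k).le) (Finset.mem_univ k)
        have h4 : R (U t) k - q t k ≤ g * x := by
          have h5 := (hRb (U t - net.workloadMap μ (net.invariantState ν μ (q t)))).trans
            (mul_le_mul_of_nonneg_left ((norm_sub_rev _ _).trans_le (hU t htb)) hg.le)
          rw [map_sub, hR2] at h5
          exact (le_abs_self _).trans ((norm_le_pi_norm _ k).trans h5)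
        have h6 := mul_le_mul_of_nonneg_right h3 hr
        linarith
  have h1 := (hlow (U t)).trans (hcomp ht)
  have h2 : ∑ k, U t k ≤ d * ‖U t‖ := by
    calc ∑ k, U t k ≤ ∑ _k : J, ‖U t‖ := Finset.sum_le_sum fun k _ =>
          (le_abs_self _).trans (norm_le_pi_norm (U t) k)
      _ = _ := by simp [hd]
  have h3 : c / g' ^ 2 * ‖U t‖ ^ 2 ≤ 2 * β * (d * ‖U t‖) := h1.trans (by gcongr)
  have hβ' : β ≤ (c1 + g) * (r + x) := by
    rw [hβ]; nlinarith [mul_nonneg hc1pos.le hx, mul_nonneg hg.le hr]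
  have hpos : 0 < c / g' ^ 2 := by positivity
  rw [div_mul_eq_mul_div, le_div_iff₀ hpos]
  rcases (norm_nonneg (U t)).eq_or_lt with h0 | h0
  · rw [← h0, zero_mul]; positivity
  · have h4 : ‖U t‖ * (‖U t‖ * (c / g' ^ 2)) ≤ ‖U t‖ * (2 * β * d) := by nlinarith
    have h5 := le_of_mul_le_mul_left h4 h0
    refine h5.trans ?_
    calc 2 * β * d ≤ 2 * ((c1 + g) * (r + x)) * d := by gcongr
      _ = _ := by ring

end Unused

/-- The workload depends continuously on the service rates. -/
lemma exists_workloadMap_sub_le [Nonempty I] (hμ : ∀ i, 0 < μ i) : ∃ C : ℝ, 0 < C ∧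
    ∀ᶠ ε in 𝓝[>] (0 : ℝ), ∀ μ' : I → ℝ, (∀ i, |μ' i - μ i| ≤ ε) → (∀ i, 0 < μ' i) ∧
      ∀ n, ‖net.workloadMap μ' n - net.workloadMap μ n‖ ≤ C * ε * ‖n‖ := by
  have hpos : ∀ i, 0 < 2 / μ i ^ 2 := fun i => div_pos two_pos (pow_pos (hμ i) 2)
  refine ⟨∑ i, 2 / μ i ^ 2, Finset.sum_pos (fun i _ => hpos i) Finset.univ_nonempty, ?_⟩
  have h1 : ∀ i, ∀ᶠ ε in 𝓝[>] (0 : ℝ), ε < μ i / 2 := fun i =>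
    Continuous.eventually_lt_nhdsGT_zero (F := fun ε => ε) continuous_id (half_pos (hμ i))
  filter_upwards [eventually_all.2 h1, self_mem_nhdsWithin] with ε hε hε0 μ' hμ'
  have hε0' : 0 < ε := hε0
  have hlow : ∀ i, μ i / 2 ≤ μ' i := fun i => by
    have := (abs_le.1 (hμ' i)).1; linarith [hε i]
  have hμ'pos : ∀ i, 0 < μ' i := fun i => (half_pos (hμ i)).trans_le (hlow i)
  refine ⟨hμ'pos, fun n => ?_⟩
  have hC := Finset.sum_nonneg fun i (_ : i ∈ Finset.univ) => (hpos i).le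
  refine (pi_norm_le_iff_of_nonneg (by positivity)).2 fun j => ?_
  rw [Pi.sub_apply, workloadMap_apply, workloadMap_apply, ← Finset.sum_sub_distrib,
    Finset.sum_mul, Finset.sum_mul]
  refine (norm_sum_le _ _).trans (Finset.sum_le_sum fun i _ => ?_)
  have e : net.incidence j i * (n i / μ' i) - net.incidence j i * (n i / μ i) =
      net.incidence j i * (n i * ((μ i - μ' i) / (μ' i * μ i))) := by
    have := (hμ i).ne'; have := (hμ'pos i).ne'
    field_simp
  rw [e, norm_mul, norm_mul, norm_div, Real.norm_of_nonneg (net.incidence_nonneg j i)]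
  refine (mul_le_of_le_one_left (by positivity) (net.incidence_le_one j i)).trans ?_
  have h2 : ‖μ i - μ' i‖ / ‖μ' i * μ i‖ ≤ 2 / μ i ^ 2 * ε := by
    rw [Real.norm_of_nonneg (mul_pos (hμ'pos i) (hμ i)).le, norm_sub_rev,
      div_le_iff₀ (mul_pos (hμ'pos i) (hμ i))]
    calc ‖μ' i - μ i‖ ≤ ε := hμ' i
      _ = 2 / μ i ^ 2 * ε * (μ i / 2 * μ i) := by have := (hμ i).ne'; field_simp
      _ ≤ _ := by
        have := hlow i; have := hμ i; gcongr
  calc ‖n i‖ * (‖μ i - μ' i‖ / ‖μ' i * μ i‖) ≤ ‖n‖ * (2 / μ i ^ 2 * ε) := by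
        gcongr; exact norm_le_pi_norm n i
    _ = _ := by ring

/-- The balance equation of the workload: initial workload, noise, drift and unused capacity. -/
lemma workloadMap_pathState {ν' μ' : I → ℝ} (hμ' : ∀ i, 0 < μ' i) (N : ℝ → I → ℕ) (t : ℝ) (j : J) :
    net.workloadMap μ' (pathState N t) j = net.workloadMap μ' (pathState N 0) j
      + net.workloadMap μ' (fun i => net.pathNoise ν' μ' N i t) j
      + (∑ i, net.incidence j i * (ν' i / μ' i) - net.capacity j) * t + net.pathUnused N t j := by
  have h : ∑ i, net.incidence j i * (pathState N t i / μ' i) =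
      ∑ i, net.incidence j i * (pathState N 0 i / μ' i)
      + ∑ i, net.incidence j i * (net.pathNoise ν' μ' N i t / μ' i)
      + ∑ i, net.incidence j i * (ν' i / μ' i) * t
      - ∑ i, net.incidence j i * net.pathBandwidth N i t := by
    rw [← Finset.sum_add_distrib, ← Finset.sum_add_distrib, ← Finset.sum_sub_distrib]
    refine Finset.sum_congr rfl fun i _ => ?_
    have := (hμ' i).ne'
    simp only [pathState, pathNoise]
    field_simp
    ring
  simp only [workloadMap_apply, pathUnused, sub_mul, Finset.sum_mul]
  linarith

/-- A path whose noise has small increments moves slowly. -/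
lemma norm_pathState_sub_le [Nonempty J] [Nonempty I] {ε r s t : ℝ} (hr : 0 ≤ r) (hε0 : 0 ≤ ε)
    (hε1 : ε ≤ 1) {ν' μ' : I → ℝ} (hν' : ∀ i, |ν' i - ν i| ≤ ε) (hμ' : ∀ i, |μ' i - μ i| ≤ ε)
    {N : ℝ → I → ℕ} (hN : ∀ t, 0 ≤ t → ContinuousWithinAt N (Set.Ici t) t) (hst : s ≤ t)
    (hmod : ∀ i, |net.pathNoise ν' μ' N i t - net.pathNoise ν' μ' N i s| ≤ ε * (r + (t - s))) :
    ‖pathState N t - pathState N s‖ ≤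
      (‖ν‖ + 1 + (‖μ‖ + 1) * ∑ j, net.capacity j + 1) * (t - s) + ε * r := by
  have hCt0 : 0 ≤ ∑ j, net.capacity j := Finset.sum_nonneg fun j _ => (net.capacity_pos j).le
  have h0 : 0 ≤ t - s := by linarith
  refine (pi_norm_le_iff_of_nonneg (by positivity)).2 fun i => ?_
  have e : (pathState N t - pathState N s) i = ν' i * (t - s)
      - μ' i * (net.pathBandwidth N i t - net.pathBandwidth N i s)
      + (net.pathNoise ν' μ' N i t - net.pathNoise ν' μ' N i s) := by
    simp only [pathState, pathNoise, Pi.sub_apply]; ring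
  rw [e, Real.norm_eq_abs]
  have h2 := pathBandwidth_sub_mem (net := net) hN i hst
  have h3 : |ν' i| ≤ ‖ν‖ + 1 := by
    have := abs_add_le (ν i) (ν' i - ν i)
    rw [add_sub_cancel] at this
    have h4 : |ν i| ≤ ‖ν‖ := norm_le_pi_norm ν i
    linarith [hν' i]
  have h4 : |μ' i| ≤ ‖μ‖ + 1 := by
    have := abs_add_le (μ i) (μ' i - μ i)
    rw [add_sub_cancel] at this
    have h4 : |μ i| ≤ ‖μ‖ := norm_le_pi_norm μ i
    linarith [hμ' i]
  have h5 : |ν' i * (t - s)| ≤ (‖ν‖ + 1) * (t - s) := by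
    rw [abs_mul, abs_of_nonneg h0]; exact mul_le_mul_of_nonneg_right h3 h0
  have h6 : |μ' i * (net.pathBandwidth N i t - net.pathBandwidth N i s)| ≤
      (‖μ‖ + 1) * ((∑ j, net.capacity j) * (t - s)) := by
    rw [abs_mul, abs_of_nonneg h2.1]
    exact mul_le_mul h4 h2.2 h2.1 (by positivity)
  have h7 := abs_sub (ν' i * (t - s))
    (μ' i * (net.pathBandwidth N i t - net.pathBandwidth N i s))
  refine (abs_add_le _ _).trans ?_
  have h9 := mul_le_mul_of_nonneg_right hε1 h0
  linarith [hmod i]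

/-- The pathwise estimate.  The noise is of order `r` up to time `b` and has increments of small
order `ε r` over intervals of length `r`; the initial state is of order `r`, and within `ε r` of its
lift.  Then the whole path up to time `b` is of order `r` and near the lift of its workload.
As long as the path is at most a certain multiple of `r`, it is near the cone of invariant states;
then the bound for the unused capacity shows that it is at most half as large, and as it moves at
bounded speed up to small noise, it cannot leave this region.  The constant `K` does not depend on
the accuracy `δ` of the collapse. -/
theorem exists_path_bound [Nonempty J] [Nonempty I] (hν : ∀ i, 0 < ν i) (hμ : ∀ i, 0 < μ i)
    (hlocal : net.LocalTraffic)
    (hcrit : ∀ j, ∑ i, net.incidence j i * (ν i / μ i) = net.capacity j)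
    {κ : ℝ} (hκ : 0 < κ) : ∃ K : ℝ, 0 < K ∧ ∀ δ : ℝ, 0 < δ →
    ∀ᶠ ε in 𝓝[>] (0 : ℝ), ∀ r : ℝ, 0 < r → ∀ ν' μ' : I → ℝ,
      (∀ i, |ν' i - ν i| ≤ ε) → (∀ i, |μ' i - μ i| ≤ ε) →
      ∀ N : ℝ → I → ℕ, (∀ t, 0 ≤ t → ContinuousWithinAt N (Set.Ici t) t) →
      ∀ b : ℝ, 0 ≤ b → (∀ i s t, 0 ≤ s → s ≤ t → t ≤ b + r →
        |net.pathNoise ν' μ' N i t - net.pathNoise ν' μ' N i s| ≤ ε * (r + (t - s))) →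
      (∀ i, ∀ t ∈ Set.Icc 0 b, |net.pathNoise ν' μ' N i t| ≤ κ * r) →
      (∀ j, |∑ i, net.incidence j i * (ν' i / μ' i) - net.capacity j| * b ≤ κ * r) →
      (∀ q, net.IsMultiplier ν μ (net.workloadMap μ' (pathState N 0)) q →
        ‖pathState N 0 - net.invariantState ν μ q‖ ≤ ε * r) →
      ‖net.workloadMap μ' (pathState N 0)‖ ≤ κ * r →
      ∀ t ∈ Set.Icc 0 b, (∀ q, net.IsMultiplier ν μ (net.workloadMap μ' (pathState N t)) q →
        ‖pathState N t - net.invariantState ν μ q‖ ≤ δ * r) ∧ ‖pathState N t‖ ≤ K * r ∧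
        ‖net.workloadMap μ' (pathState N t)‖ ≤ K * r ∧ ‖net.pathUnused N t‖ ≤ K * r := by
  obtain ⟨L, hL, hLip⟩ := exists_lipschitz_invariantState hν hμ hlocal
  obtain ⟨Cw, hCw, hwl⟩ := LinearMap.exists_pos_bound (net.workloadMap μ)
  obtain ⟨Cp, hCp, hpert⟩ := exists_workloadMap_sub_le (net := net) hμ
  obtain ⟨C3, hC3, hunused⟩ := exists_unused_bound hν hμ hlocal
  choose Q hQ using fun w => exists_isMultiplier (net := net) hν hμ hlocal w
  set Ct := ∑ j, net.capacity j with hCt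
  have hCt0 : 0 ≤ Ct := Finset.sum_nonneg fun j _ => (net.capacity_pos j).le
  -- in units of `r`: `X0` bounds the workload without the unused capacity, `C4` the unused
  -- capacity, `C5` the workload and `C6` the state, all while the state is at most `K0`
  set X0 := κ + (Cw + 1) * κ + κ with hX0
  have hX0pos : 0 < X0 := by positivity
  set C4 := C3 * (1 + (X0 + Cw + 1)) with hC4
  have hC4pos : 0 < C4 := by positivity
  set C5 := C4 + X0 with hC5
  set C6 := L * C5 + 1 with hC6
  have hC5pos : 0 < C5 := by positivity
  have hC6pos : 0 < C6 := by positivity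
  set K0 := 2 * C6 with hK0
  have hK0pos : 0 < K0 := by positivity
  refine ⟨C4 + C5 + K0, by positivity, fun δ hδ => ?_⟩
  set η := min δ 1 / 2 with hη
  have hηpos : 0 < η := half_pos (lt_min hδ one_pos)
  have hηδ : 2 * η ≤ δ := by rw [hη]; linarith [min_le_left δ 1]
  have hη1 : 2 * η ≤ 1 := by rw [hη]; linarith [min_le_right δ 1]
  have ev1 : ∀ᶠ ε in 𝓝[>] (0 : ℝ), Cp * ε < 1 :=
    Continuous.eventually_lt_nhdsGT_zero (by fun_prop) (by simp)
  have ev2 : ∀ᶠ ε in 𝓝[>] (0 : ℝ), L * (Cp * ε * K0) < η :=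
    Continuous.eventually_lt_nhdsGT_zero (by fun_prop) (by simpa using hηpos)
  have ev3 : ∀ᶠ ε in 𝓝[>] (0 : ℝ), Cp * ε * K0 < 1 :=
    Continuous.eventually_lt_nhdsGT_zero (by fun_prop) (by simp)
  have ev4 : ∀ᶠ ε in 𝓝[>] (0 : ℝ), ε < min (C6 / 2) 1 :=
    Continuous.eventually_lt_nhdsGT_zero (F := fun ε => ε) continuous_id
      (lt_min (half_pos hC6pos) one_pos)
  filter_upwards [exists_collapse hν hμ hlocal hcrit hK0pos hηpos, hpert, ev1, ev2, ev3, ev4,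
    self_mem_nhdsWithin] with ε hcoll hpert' e1 e2 e3 e4 hε
  intro r hr ν' μ' hν' hμ' N hN b hb hmod hnoise hload hinit hw0
  have hε0 : 0 < ε := hε
  have hε1 : ε < 1 := e4.trans_le (min_le_right _ _)
  have hεC : ε < C6 / 2 := e4.trans_le (min_le_left _ _)
  obtain ⟨hμ'pos, hpert''⟩ := hpert' μ' hμ'
  have hwl' : ∀ n, ‖net.workloadMap μ' n‖ ≤ (Cw + 1) * ‖n‖ := fun n => by
    have h1 : net.workloadMap μ' n = net.workloadMap μ n
        + (net.workloadMap μ' n - net.workloadMap μ n) := by abel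
    rw [h1]
    refine (norm_add_le _ _).trans ?_
    have h2 := hpert'' n
    have h3 := mul_le_mul_of_nonneg_right e1.le (norm_nonneg n)
    linarith [hwl n]
  have hBle : ∀ w q, net.IsMultiplier ν μ w q → ‖net.invariantState ν μ q‖ ≤ L * ‖w‖ :=
    fun w q hq => by
      have h1 := hLip _ _ _ _ hq isMultiplier_zero
      rwa [map_zero, sub_zero, sub_zero] at h1
  -- the workload without the unused capacity
  have hWU : ∀ t ∈ Set.Icc 0 b,
      ‖net.workloadMap μ' (pathState N t) - net.pathUnused N t‖ ≤ X0 * r := fun t ht => by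
    refine (pi_norm_le_iff_of_nonneg (by positivity)).2 fun j => ?_
    rw [Pi.sub_apply, workloadMap_pathState (ν' := ν') hμ'pos, add_sub_cancel_right,
      Real.norm_eq_abs]
    have h1 : |net.workloadMap μ' (pathState N 0) j| ≤ κ * r := (norm_le_pi_norm _ j).trans hw0
    have h2 : |net.workloadMap μ' (fun i => net.pathNoise ν' μ' N i t) j| ≤
        (Cw + 1) * (κ * r) := by
      refine (norm_le_pi_norm _ j).trans ((hwl' _).trans ?_)
      refine mul_le_mul_of_nonneg_left ?_ (by positivity)
      exact (pi_norm_le_iff_of_nonneg (by positivity)).2 fun i => hnoise i t ht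
    have h3 : |(∑ i, net.incidence j i * (ν' i / μ' i) - net.capacity j) * t| ≤ κ * r := by
      rw [abs_mul, abs_of_nonneg ht.1]
      exact (mul_le_mul_of_nonneg_left ht.2 (abs_nonneg _)).trans (hload j)
    refine (abs_add_le _ _).trans ((add_le_add (abs_add_le _ _) le_rfl).trans ?_)
    rw [hX0]; linarith
  -- a path which is bounded by `K0 * r` is in fact bounded by `C6 * r = K0 * r / 2`
  have hstep : ∀ b' ∈ Set.Icc 0 b, (∀ t ∈ Set.Icc 0 b', ‖pathState N t‖ ≤ K0 * r) →
      ∀ t ∈ Set.Icc 0 b', (∀ q, net.IsMultiplier ν μ (net.workloadMap μ' (pathState N t)) q →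
        ‖pathState N t - net.invariantState ν μ q‖ ≤ 2 * η * r) ∧ ‖pathState N t‖ ≤ C6 * r ∧
        ‖net.workloadMap μ' (pathState N t)‖ ≤ C5 * r ∧ ‖net.pathUnused N t‖ ≤ C4 * r := by
    intro b' hb' hbound
    have hsub : ∀ t ∈ Set.Icc 0 b', t ∈ Set.Icc 0 b := fun t ht => ⟨ht.1, ht.2.trans hb'.2⟩
    have h1 := hcoll r hr ν' μ' hν' hμ' N hN b' hb'.1
      (fun i s t hs hst ht => hmod i s t hs hst (ht.trans (by linarith [hb'.2])))
      ⟨_, (hQ _).nonneg, hinit _ (hQ _)⟩ hbound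
    have hp : ∀ t ∈ Set.Icc 0 b', ‖net.workloadMap μ' (pathState N t)
        - net.workloadMap μ (pathState N t)‖ ≤ Cp * ε * K0 * r := fun t ht => by
      refine (hpert'' _).trans ?_
      rw [mul_assoc (Cp * ε)]
      exact mul_le_mul_of_nonneg_left (hbound t ht) (by positivity)
    have h2 : ∀ t ∈ Set.Icc 0 b', ∀ q,
        net.IsMultiplier ν μ (net.workloadMap μ' (pathState N t)) q →
        ‖pathState N t - net.invariantState ν μ q‖ ≤ 2 * η * r := fun t ht q hq => by
      have h3 := h1 t ht _ (hQ _)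
      have h4 := (hLip _ _ _ _ (hQ (net.workloadMap μ (pathState N t))) hq).trans
        (mul_le_mul_of_nonneg_left ((norm_sub_rev _ _).trans_le (hp t ht)) hL.le)
      have h5 := mul_le_mul_of_nonneg_right e2.le hr.le
      have h6 := norm_sub_le_norm_sub_add_norm_sub (pathState N t)
        (net.invariantState ν μ (Q (net.workloadMap μ (pathState N t))))
        (net.invariantState ν μ q)
      linarith
    have h3 : ∀ t ∈ Set.Icc 0 b', ‖net.pathUnused N t‖ ≤ C4 * r := by
      intro t ht
      refine (hunused r ((X0 + Cw + 1) * r) hr.le (by positivity) N hN b'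
        (fun t => Q (net.workloadMap μ' (pathState N t))) (fun t ht => ?_) (fun t ht => ?_)
        t ht).trans (le_of_eq (by rw [hC4]; ring))
      · exact (h2 t ht _ (hQ _)).trans (mul_le_of_le_one_left hr.le hη1)
      · set B := net.invariantState ν μ (Q (net.workloadMap μ' (pathState N t))) with hB
        have e : net.workloadMap μ B - net.pathUnused N t =
            (net.workloadMap μ' (pathState N t) - net.pathUnused N t)
            - net.workloadMap μ (pathState N t - B)
            - (net.workloadMap μ' (pathState N t) - net.workloadMap μ (pathState N t)) := by
          rw [map_sub]; abel
        rw [e]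
        have h4 := hWU t (hsub t ht)
        have h5 := (hwl (pathState N t - B)).trans
          (mul_le_mul_of_nonneg_left (h2 t ht _ (hQ _)) hCw.le)
        have h6 := mul_le_mul_of_nonneg_right e3.le hr.le
        have h7 : Cw * (2 * η * r) ≤ Cw * r := by
          exact mul_le_mul_of_nonneg_left (mul_le_of_le_one_left hr.le hη1) hCw.le
        refine (norm_sub_le _ _).trans ((add_le_add (norm_sub_le _ _) le_rfl).trans ?_)
        linarith [hp t ht]
    intro t ht
    have h4 : ‖net.workloadMap μ' (pathState N t)‖ ≤ C5 * r := by
      have h5 := norm_le_norm_sub_add (net.workloadMap μ' (pathState N t)) (net.pathUnused N t)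
      have h6 := hWU t (hsub t ht)
      rw [hC5]; linarith [h3 t ht]
    refine ⟨h2 t ht, ?_, h4, h3 t ht⟩
    have h5 := norm_le_norm_sub_add (pathState N t)
      (net.invariantState ν μ (Q (net.workloadMap μ' (pathState N t))))
    have h6 := h2 t ht _ (hQ _)
    have h7 := (hBle _ _ (hQ _)).trans (mul_le_mul_of_nonneg_left h4 hL.le)
    have h8 := mul_le_mul_of_nonneg_right hη1 hr.le
    rw [hC6]; linarith
  -- over a time `a` the path moves by at most `C6 * r`
  set V := ‖ν‖ + 1 + (‖μ‖ + 1) * Ct + 1 with hV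
  have hVpos : 0 < V := by positivity
  set a := C6 * r / 2 / V with ha
  have hapos : 0 < a := by positivity
  have hmove : ∀ s t, 0 ≤ s → s ≤ t → t ≤ s + a → t ≤ b →
      ‖pathState N t - pathState N s‖ ≤ C6 * r := fun s t hs hst hta htb => by
    refine (norm_pathState_sub_le hr.le hε0.le hε1.le hν' hμ' hN hst
      fun i => hmod i s t hs hst (by linarith)).trans ?_
    have h8 : V * (t - s) ≤ C6 * r / 2 := by
      calc V * (t - s) ≤ V * a := by gcongr; linarith
        _ = _ := by rw [ha]; field_simp
    have h9 := mul_le_mul_of_nonneg_right hεC.le hr.le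
    linarith
  have h0C6 : ‖pathState N 0‖ ≤ K0 * r := by
    have h1 := norm_le_norm_sub_add (pathState N 0)
      (net.invariantState ν μ (Q (net.workloadMap μ' (pathState N 0))))
    have h2 := hinit _ (hQ _)
    have h3 := (hBle _ _ (hQ _)).trans (mul_le_mul_of_nonneg_left hw0 hL.le)
    have h4 : κ ≤ C5 := by
      have : 0 ≤ (Cw + 1) * κ := by positivity
      rw [hC5, hX0]; linarith
    have h5 : L * (κ * r) ≤ L * (C5 * r) := by gcongr
    have h6 := mul_le_mul_of_nonneg_right hε1.le hr.le
    have h7 : 0 ≤ C6 * r := by positivity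
    rw [hK0]; rw [hC6] at h7 ⊢; linarith
  have hall : ∀ k : ℕ, ∀ t ∈ Set.Icc 0 b, t ≤ k * a → ‖pathState N t‖ ≤ K0 * r := by
    intro k
    induction k with
    | zero =>
      intro t ht htk
      have : t = 0 := le_antisymm (by simpa using htk) ht.1
      rw [this]; exact h0C6
    | succ k ih =>
      intro t ht htk
      by_cases hk : t ≤ k * a
      · exact ih t ht hk
      push Not at hk
      have hka : (k : ℝ) * a ∈ Set.Icc 0 b := ⟨by positivity, hk.le.trans ht.2⟩
      have h1 := (hstep _ hka (fun s hs => ih s ⟨hs.1, hs.2.trans hka.2⟩ hs.2) _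
        ⟨hka.1, le_rfl⟩).2.1
      have h2 := hmove _ t hka.1 hk.le (by push_cast at htk; linarith) ht.2
      have h3 := norm_le_norm_sub_add (pathState N t) (pathState N (k * a))
      rw [hK0]; linarith
  obtain ⟨k, hk⟩ := exists_nat_ge (b / a)
  rw [div_le_iff₀ hapos] at hk
  intro t ht
  obtain ⟨g1, g2, g3, g4⟩ := hstep b ⟨hb, le_rfl⟩ (fun s hs => hall k s hs (hs.2.trans hk)) t ht
  have hC4r : 0 ≤ C4 * r := by positivity
  have hC5r : 0 ≤ C5 * r := by positivity
  have hC6r : 0 ≤ C6 * r := by positivity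
  refine ⟨fun q hq => (g1 q hq).trans (by gcongr), ?_, ?_, ?_⟩ <;> rw [hK0] <;> linarith

end Network

/-! ### Lebesgue-Stieltjes measures with a density -/

/-- The Lebesgue-Stieltjes measure of a primitive does not charge the zeros of the density. -/
lemma stieltjesMeasure_eq_zero {f u : ℝ → ℝ} (hu : Measurable u) {C : ℝ} (hC : ∀ t, |u t| ≤ C)
    (hu0 : ∀ t, 0 ≤ u t) (hf : ∀ t, 0 ≤ t → f t = ∫ s in (0 : ℝ)..t, u s) {B : Set ℝ}
    (hB : ∀ s ∈ B, 0 < s → u s = 0) : stieltjesMeasure f B = 0 := by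
  set v : ℝ → ℝ := (Set.Ioi (0 : ℝ)).indicator u with hv
  have hvm : Measurable v := hu.indicator measurableSet_Ioi
  have hv0 : ∀ t, 0 ≤ v t := fun t => Set.indicator_nonneg (fun s _ => hu0 s) t
  have hC0 : 0 ≤ C := (abs_nonneg _).trans (hC 0)
  have hvC : ∀ t, |v t| ≤ C := fun t => by
    by_cases ht : t ∈ Set.Ioi (0 : ℝ)
    · rw [hv, Set.indicator_of_mem ht]; exact hC t
    · rw [hv, Set.indicator_of_notMem ht, abs_zero]; exact hC0
  have hvI : ∀ a b, IntervalIntegrable v volume a b := fun a b => by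
    rw [intervalIntegrable_iff]
    exact Measure.integrableOn_of_bounded (M := C) (by simp) hvm.aestronglyMeasurable
      (Eventually.of_forall hvC)
  have hg : ∀ t, f (max t 0) = ∫ s in (0 : ℝ)..t, v s := fun t => by
    rw [hf _ (le_max_right _ _)]
    rcases le_total 0 t with ht | ht
    · rw [max_eq_left ht, intervalIntegral.integral_of_le ht, intervalIntegral.integral_of_le ht]
      refine setIntegral_congr_fun measurableSet_Ioc fun s hs => ?_
      rw [hv, Set.indicator_of_mem (Set.mem_Ioi.2 hs.1)]
    · rw [max_eq_right ht, intervalIntegral.integral_same, intervalIntegral.integral_of_ge ht,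
        setIntegral_congr_fun (g := fun _ => 0) measurableSet_Ioc fun s hs => by
          rw [hv, Set.indicator_of_notMem (fun h => (not_lt.2 hs.2) (Set.mem_Ioi.1 h))]]
      simp
  have hsub : ∀ a b, f (max b 0) - f (max a 0) = ∫ s in a..b, v s := fun a b => by
    rw [hg, hg, intervalIntegral.integral_interval_sub_left (hvI _ _) (hvI _ _)]
  have hmono : Monotone fun t : ℝ => f (max t 0) := fun a b hab => by
    have h1 := hsub a b
    have h2 : 0 ≤ ∫ s in a..b, v s := intervalIntegral.integral_nonneg hab fun s _ => hv0 s
    dsimp only; linarith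
  have hcont : Continuous fun t : ℝ => f (max t 0) := by
    simp only [hg]
    exact intervalIntegral.continuous_primitive hvI 0
  have hmeas : stieltjesMeasure f = volume.withDensity fun s => ENNReal.ofReal (v s) := by
    rw [stieltjesMeasure, dif_pos hmono]
    refine Measure.ext_of_Ioc _ _ fun a b hab => ?_
    rw [StieltjesFunction.measure_Ioc, Monotone.stieltjesFunction_eq,
      Monotone.stieltjesFunction_eq, (hcont.continuousAt.continuousWithinAt).rightLim_eq,
      (hcont.continuousAt.continuousWithinAt).rightLim_eq, hsub,
      withDensity_apply _ measurableSet_Ioc, intervalIntegral.integral_of_le hab.le,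
      ofReal_integral_eq_lintegral_ofReal ((intervalIntegrable_iff_integrableOn_Ioc_of_le
        hab.le).1 (hvI a b)) (Eventually.of_forall hv0)]
  have hsubset : B ⊆ {s | v s = 0} := fun s hs => by
    by_cases h : 0 < s
    · simp [hv, h, hB s hs h]
    · simp [hv, h]
  refine measure_mono_null hsubset ?_
  have hms : MeasurableSet {s | v s = 0} := hvm (measurableSet_singleton 0)
  rw [hmeas, withDensity_apply _ hms, setLIntegral_congr_fun (g := fun _ => 0) hms
    fun s hs => by simp [show v s = 0 from hs]]
  simp

namespace FlowModel

/-! ### The scaled processes of a model along a path -/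

variable {net : Network J I} {Ω : Type*} [MeasurableSpace Ω] {P : Measure Ω}

/-- The sample path of the flow count process. -/
def path (X : FlowModel net P) (ω : Ω) (t : ℝ) : I → ℕ := X.N t ω

open Network

lemma hatN_eq (X : FlowModel net P) (r t : ℝ) (ω : Ω) :
    X.hatN r t ω = WithLp.toLp 2 (r⁻¹ • pathState (X.path ω) (r ^ 2 * t)) := rfl

lemma hatW_eq (X : FlowModel net P) (r t : ℝ) (ω : Ω) : X.hatW r t ω =
    WithLp.toLp 2 (r⁻¹ • net.workloadMap X.μ (pathState (X.path ω) (r ^ 2 * t))) := rfl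

lemma hatU_eq (X : FlowModel net P) (r : ℝ) {t : ℝ} (ht : 0 ≤ t) (ω : Ω) : X.hatU r t ω =
    WithLp.toLp 2 (r⁻¹ • net.pathUnused (X.path ω) (r ^ 2 * t)) := by
  have h0 : 0 ≤ r ^ 2 * t := mul_nonneg (sq_nonneg r) ht
  ext j
  simp only [hatU, unused, pathUnused, PiLp.smul_apply, Pi.smul_apply, smul_eq_mul]
  congr 2
  exact Finset.sum_congr rfl fun i _ => by rw [cumulativeBandwidth_eq _ i h0]; rfl

lemma lift_hatW_eq {ν μ : I → ℝ} (hν : ∀ i, 0 < ν i) (hμ : ∀ i, 0 < μ i) (X : FlowModel net P)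
    {r : ℝ} (hr : 0 < r) (t : ℝ) (ω : Ω) {q : J → ℝ} (hq : net.IsMultiplier ν μ
      (net.workloadMap X.μ (pathState (X.path ω) (r ^ 2 * t))) q) :
    net.lift ν μ (X.hatW r t ω) = WithLp.toLp 2 (r⁻¹ • net.invariantState ν μ q) := by
  rw [← map_smul]
  exact (hq.smul (inv_nonneg.2 hr.le)).lift_eq hν hμ (w := X.hatW r t ω)

lemma hatN_sub_lift_eq {ν μ : I → ℝ} (hν : ∀ i, 0 < ν i) (hμ : ∀ i, 0 < μ i) (X : FlowModel net P)
    {r : ℝ} (hr : 0 < r) (t : ℝ) (ω : Ω) {q : J → ℝ} (hq : net.IsMultiplier ν μ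
      (net.workloadMap X.μ (pathState (X.path ω) (r ^ 2 * t))) q) :
    X.hatN r t ω - net.lift ν μ (X.hatW r t ω) = WithLp.toLp 2
      (r⁻¹ • (pathState (X.path ω) (r ^ 2 * t) - net.invariantState ν μ q)) := by
  rw [X.lift_hatW_eq hν hμ hr t ω hq, hatN_eq, smul_sub]; rfl

lemma xiHat_eq {ν μ : I → ℝ} (hν : ∀ i, 0 < ν i) (hμ : ∀ i, 0 < μ i) (X : FlowModel net P)
    {r : ℝ} (hr : 0 < r) (t : ℝ) (ω : Ω) {q : J → ℝ} (hq : net.IsMultiplier ν μ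
      (net.workloadMap X.μ (pathState (X.path ω) (r ^ 2 * t))) q) :
    X.xiHat ν μ r t ω = WithLp.toLp 2
      (r⁻¹ • (net.workloadMap μ (pathState (X.path ω) (r ^ 2 * t) - net.invariantState ν μ q)
        + (net.workloadMap X.μ (pathState (X.path ω) (r ^ 2 * t))
          - net.workloadMap μ (pathState (X.path ω) (r ^ 2 * t))))) := by
  rw [xiHat, liftW, X.hatN_sub_lift_eq hν hμ hr t ω hq, hatN_eq]
  simp only [smul_add, smul_sub, ← map_smul]
  rfl

lemma tildeW_eq {ν μ : I → ℝ} (hν : ∀ i, 0 < ν i) (hμ : ∀ i, 0 < μ i) (X : FlowModel net P)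
    {r : ℝ} (hr : 0 < r) (t : ℝ) (ω : Ω) {q : J → ℝ} (hq : net.IsMultiplier ν μ
      (net.workloadMap X.μ (pathState (X.path ω) (r ^ 2 * t))) q) :
    X.tildeW ν μ r t ω = WithLp.toLp 2
      (net.workloadMap μ (net.invariantState ν μ (r⁻¹ • q))) := by
  rw [tildeW, liftW, X.lift_hatW_eq hν hμ hr t ω hq, ← map_smul]; rfl

/-- `ζ̂_j` vanishes if capacity of the resource `j` is left unused only while the workload is near
the `j`th face. -/
lemma zetaHat_eq_zero [Nonempty J] [Nonempty I] {ν μ : I → ℝ} (X : FlowModel net P) {r δ : ℝ}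
    (hr : 0 < r) {ω : Ω}
    (hN : ∀ t, 0 ≤ t → ContinuousWithinAt (X.path ω) (Set.Ici t) t) {j : J} {t : ℝ}
    (h : ∀ s ∈ Set.Ioc 0 t, δ < Metric.infDist (X.tildeW ν μ r s ω) (net.workloadFace ν μ j) →
      net.pathIdleRate (X.path ω) (r ^ 2 * s) j = 0) : X.zetaHat ν μ r δ j t ω = 0 := by
  set u : ℝ → ℝ := fun s => net.pathIdleRate (X.path ω) s j with hu
  have huc : ∀ s, ContinuousWithinAt u (Set.Ici s) s := fun s => by
    have := fun i => continuousWithinAt_pathRate (net := net) hN i s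
    have hsum : ContinuousWithinAt (fun s => ∑ i, net.incidence j i *
        net.pathRate (X.path ω) i s) (Set.Ici s) s :=
      tendsto_finsetSum _ fun i _ => (this i).const_mul _
    exact continuousWithinAt_const.sub hsum
  have hum : Measurable u := measurable_of_forall_continuousWithinAt_Ici huc
  have hu0 : ∀ s, 0 ≤ u s := fun s => pathIdleRate_nonneg _ _ _
  have huC : ∀ s, |u s| ≤ net.capacity j := fun s => by
    rw [abs_of_nonneg (hu0 s)]
    exact sub_le_self _ (Finset.sum_nonneg fun i _ =>
      mul_nonneg (net.incidence_nonneg j i) (allocation_nonneg _ _))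
  have hint : ∀ t, net.pathUnused (X.path ω) t j = ∫ s in (0 : ℝ)..t, u s := fun t => by
    have hI := fun i => intervalIntegrable_of_continuousWithinAt_Ici
      (continuousWithinAt_pathRate (net := net) hN i) (abs_pathRate_le (X.path ω) i) 0 t
    have hS : IntervalIntegrable (fun s => ∑ i, net.incidence j i * net.pathRate (X.path ω) i s)
        volume 0 t := by
      have := IntervalIntegrable.sum Finset.univ fun i _ => (hI i).const_mul (net.incidence j i)
      rwa [Finset.sum_fn] at this
    simp only [hu, pathIdleRate, pathUnused]
    rw [intervalIntegral.integral_sub (by simp) hS,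
      intervalIntegral.integral_finsetSum fun i _ => (hI i).const_mul _]
    simp only [intervalIntegral.integral_const, intervalIntegral.integral_const_mul, sub_zero,
      smul_eq_mul, mul_comm t]
    rfl
  have key : stieltjesMeasure (fun s => X.hatU r s ω j) {s | s ∈ Set.Ioc 0 t ∧
      δ < Metric.infDist (X.tildeW ν μ r s ω) (net.workloadFace ν μ j)} = 0 := by
    refine stieltjesMeasure_eq_zero (u := fun s => r * u (r ^ 2 * s)) (C := r * net.capacity j)
      (measurable_const.mul (hum.comp (measurable_const.mul measurable_id))) (fun s => ?_)
      (fun s => mul_nonneg hr.le (hu0 _)) (fun s hs => ?_) fun s hs _ => ?_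
    · rw [abs_mul, abs_of_pos hr]; exact mul_le_mul_of_nonneg_left (huC _) hr.le
    · rw [X.hatU_eq r hs, intervalIntegral.integral_const_mul,
        intervalIntegral.integral_comp_mul_left (fun s => u s) (pow_pos hr 2).ne', mul_zero, ← hint]
      simp only [Pi.smul_apply, smul_eq_mul]
      field_simp
    · have := h s hs.1 hs.2
      simp only [hu, this, mul_zero]
  rw [zetaHat]
  refine (lintegral_congr_ae (g := fun _ => 0) ?_).trans (by simp)
  rw [Filter.EventuallyEq, ae_restrict_iff' measurableSet_Ioc]
  refine measure_mono_null (fun s hs => ?_) key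
  simp only [Set.mem_compl_iff, Set.mem_ofPred_eq, Classical.not_imp] at hs
  refine ⟨hs.1, ?_⟩
  by_contra hcon
  exact hs.2 (if_neg hcon)

end FlowModel

namespace Network

/-- The distance of a point of the workload cone to the `j`th face is at most of the order of its
`j`th multiplier. -/
lemma exists_infDist_workloadFace_le (net : Network J I) (ν μ : I → ℝ) :
    ∃ C : ℝ, 0 < C ∧ ∀ q : J → ℝ, (∀ k, 0 ≤ q k) → ∀ j,
      Metric.infDist (WithLp.toLp 2 (net.workloadMap μ (net.invariantState ν μ q)))
        (net.workloadFace ν μ j) ≤ C * q j := by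
  set e : J → EuclideanSpace ℝ J := fun j =>
    WithLp.toLp 2 (net.workloadMap μ (net.invariantState ν μ (Pi.single j 1))) with he
  refine ⟨∑ j, ‖e j‖ + 1, by positivity, fun q hq j => ?_⟩
  set p : J → ℝ := q - q j • Pi.single j 1 with hp
  have hmem : WithLp.toLp 2 (net.workloadMap μ (net.invariantState ν μ p)) ∈
      net.workloadFace ν μ j := by
    refine ⟨WithLp.toLp 2 (net.invariantState ν μ p), ⟨p, fun k => ?_, ?_, fun i => rfl⟩, rfl⟩
    · by_cases hk : k = j
      · subst hk; simp [hp]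
      · simp [hp, Pi.single_eq_of_ne hk, hq k]
    · simp [hp]
  refine (Metric.infDist_le_dist_of_mem hmem).trans ?_
  have h1 : WithLp.toLp 2 (net.workloadMap μ (net.invariantState ν μ q)) -
      WithLp.toLp 2 (net.workloadMap μ (net.invariantState ν μ p)) = q j • e j := by
    rw [hp, map_sub, map_sub, map_smul, map_smul]
    simp only [he]
    rw [WithLp.toLp_sub, sub_sub_cancel, WithLp.toLp_smul]
  rw [dist_eq_norm, h1, norm_smul, Real.norm_of_nonneg (hq j), mul_comm]
  refine mul_le_mul_of_nonneg_right ?_ (hq j)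
  have := Finset.single_le_sum (f := fun j => ‖e j‖) (fun j _ => norm_nonneg _)
    (Finset.mem_univ j)
  linarith

end Network

lemma norm_toLp_le_card_mul {X : Type*} [Fintype X] (x : X → ℝ) :
    ‖WithLp.toLp 2 x‖ ≤ Fintype.card X * ‖x‖ := by
  rw [EuclideanSpace.norm_eq]
  refine Real.sqrt_le_iff.2 ⟨by positivity, ?_⟩
  calc ∑ i, ‖x i‖ ^ 2 ≤ ∑ _i : X, ‖x‖ ^ 2 := Finset.sum_le_sum fun i _ =>
        pow_le_pow_left₀ (norm_nonneg _) (norm_le_pi_norm x i) 2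
    _ = Fintype.card X * ‖x‖ ^ 2 := by simp
    _ ≤ (Fintype.card X * ‖x‖) ^ 2 := by
      have h1 : (Fintype.card X : ℝ) ≤ (Fintype.card X : ℝ) ^ 2 := by
        exact_mod_cast Nat.le_self_pow two_ne_zero _
      rw [mul_pow]; gcongr

lemma norm_le_norm_toLp {X : Type*} [Fintype X] (x : X → ℝ) : ‖x‖ ≤ ‖WithLp.toLp 2 x‖ :=
  (pi_norm_le_iff_of_nonneg (norm_nonneg _)).2 fun i =>
    PiLp.norm_apply_le (WithLp.toLp 2 x : EuclideanSpace ℝ X) i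

lemma supNorm_le_ofReal {E : Type*} [SeminormedAddCommGroup E] {x : ℝ → E} {T K : ℝ}
    (h : ∀ t ∈ Set.Icc 0 T, ‖x t‖ ≤ K) : supNorm x T ≤ ENNReal.ofReal K :=
  iSup₂_le fun t ht => by
    rw [← ofReal_norm]; exact ENNReal.ofReal_le_ofReal (h t ht)

lemma norm_toLp_inv_smul_le {Z : Type*} [Fintype Z] {r : ℝ} (hr : 0 < r) {x : Z → ℝ} {c : ℝ}
    (hx : ‖x‖ ≤ c * r) : ‖WithLp.toLp 2 (r⁻¹ • x)‖ ≤ Fintype.card Z * c := by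
  refine (norm_toLp_le_card_mul _).trans (mul_le_mul_of_nonneg_left ?_ (by positivity))
  rw [norm_smul, Real.norm_of_nonneg (inv_nonneg.2 hr.le), inv_mul_le_iff₀ hr, mul_comm r]
  exact hx

lemma norm_le_of_norm_toLp_inv_smul_le {Z : Type*} [Fintype Z] {r : ℝ} (hr : 0 < r) {x : Z → ℝ}
    {c : ℝ} (hx : ‖WithLp.toLp 2 (r⁻¹ • x)‖ ≤ c) : ‖x‖ ≤ c * r := by
  have h1 := (norm_le_norm_toLp _).trans hx
  rwa [norm_smul, Real.norm_of_nonneg (inv_nonneg.2 hr.le), inv_mul_le_iff₀ hr, mul_comm r] at h1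

namespace FlowModel

open Network

variable {net : Network J I} {ν μ : I → ℝ}

/-- The pathwise estimate in terms of the scaled processes of a model. -/
theorem exists_scaled_bound [Nonempty J] [Nonempty I] (hν : ∀ i, 0 < ν i) (hμ : ∀ i, 0 < μ i)
    (hlocal : net.LocalTraffic)
    (hcrit : ∀ j, ∑ i, net.incidence j i * (ν i / μ i) = net.capacity j)
    {κ : ℝ} (hκ : 0 < κ) : ∃ K : ℝ, 0 < K ∧ ∀ δ : ℝ, 0 < δ →
    ∀ᶠ ε in 𝓝[>] (0 : ℝ), ∀ (Ω : Type*) [MeasurableSpace Ω] (P : Measure Ω) (X : FlowModel net P)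
      (r T : ℝ) (ω : Ω), 0 < r → 0 < T →
      (∀ t, 0 ≤ t → ContinuousWithinAt (X.path ω) (Set.Ici t) t) →
      (∀ i, |X.ν i - ν i| ≤ ε) → (∀ i, |X.μ i - μ i| ≤ ε) →
      (∀ i s t, 0 ≤ s → s ≤ t → t ≤ r ^ 2 * T + r →
        |net.pathNoise X.ν X.μ (X.path ω) i t - net.pathNoise X.ν X.μ (X.path ω) i s|
          ≤ ε * (r + (t - s))) →
      (∀ i, ∀ t ∈ Set.Icc 0 (r ^ 2 * T), |net.pathNoise X.ν X.μ (X.path ω) i t| ≤ κ * r) →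
      (∀ j, |r * (∑ i, net.incidence j i * (X.ν i / X.μ i) - net.capacity j)| * T ≤ κ) →
      ‖X.hatN r 0 ω - net.lift ν μ (X.hatW r 0 ω)‖ ≤ ε →
      ‖X.hatW r 0 ω‖ ≤ κ →
      supNorm (fun t => X.hatN r t ω - net.lift ν μ (X.hatW r t ω)) T ≤ ENNReal.ofReal δ ∧
      supNorm (fun t => X.xiHat ν μ r t ω) T ≤ ENNReal.ofReal δ ∧
      (∀ j, supNorm (fun t => X.zetaHat ν μ r δ j t ω) T = 0) ∧
      supNorm (fun t => X.hatW r t ω) T ≤ ENNReal.ofReal K ∧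
      supNorm (fun t => X.hatU r t ω) T ≤ ENNReal.ofReal K := by
  obtain ⟨K, hK, hpath⟩ := exists_path_bound hν hμ hlocal hcrit hκ
  obtain ⟨Cw, hCw, hwl⟩ := LinearMap.exists_pos_bound (net.workloadMap μ)
  obtain ⟨Cp, hCp, hpert⟩ := exists_workloadMap_sub_le (net := net) hμ
  obtain ⟨Cf, hCf, hface⟩ := exists_infDist_workloadFace_le net ν μ
  choose Q hQ using fun w => exists_isMultiplier (net := net) hν hμ hlocal w
  choose loc hloc hloc' using hlocal
  set dJ : ℝ := (Fintype.card J : ℝ) with hdJ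
  set dI : ℝ := (Fintype.card I : ℝ) with hdI
  have hdJ0 : 0 < dJ := by rw [hdJ]; exact_mod_cast Fintype.card_pos
  have hdI0 : 0 < dI := by rw [hdI]; exact_mod_cast Fintype.card_pos
  refine ⟨dJ * K, by positivity, fun δ hδ => ?_⟩
  -- the accuracy of the state space collapse which the three claims require
  have ev : ∀ᶠ η in 𝓝[>] (0 : ℝ), dI * η < δ ∧ dJ * (Cw * η) < δ / 2 ∧
      ∀ j, η < ν (loc j) / μ (loc j) * (δ / Cf / net.weight (loc j)) := by
    refine (Continuous.eventually_lt_nhdsGT_zero (by fun_prop) (by simpa using hδ)).and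
      ((Continuous.eventually_lt_nhdsGT_zero (by fun_prop) (by simpa using hδ)).and
        (eventually_all.2 fun j => Continuous.eventually_lt_nhdsGT_zero (F := fun η => η)
          continuous_id ?_))
    have := hν (loc j); have := hμ (loc j); have := net.weight_pos (loc j)
    positivity
  obtain ⟨η, ⟨hη1, hη2, hη3⟩, hη⟩ := (ev.and self_mem_nhdsWithin).exists
  have hη0 : 0 < η := hη
  have ev2 : ∀ᶠ ε in 𝓝[>] (0 : ℝ), dJ * (Cp * ε * K) < δ / 2 :=
    Continuous.eventually_lt_nhdsGT_zero (by fun_prop) (by simpa using hδ)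
  filter_upwards [hpath η hη0, hpert, ev2, self_mem_nhdsWithin] with ε hmain hpert' e2 hε
  intro Ω _ P X r T ω hr hT hN hν' hμ' hmod hnoise hload hinit hw0
  have hε0 : 0 < ε := hε
  have hr2 : 0 < r ^ 2 := by positivity
  have hb : 0 ≤ r ^ 2 * T := by positivity
  have hres := hmain r hr X.ν X.μ hν' hμ' (X.path ω) hN (r ^ 2 * T) hb hmod hnoise
    (fun j => by
      have h1 := mul_le_mul_of_nonneg_right (hload j) hr.le
      rw [abs_mul, abs_of_pos hr] at h1
      calc _ = r * |∑ i, net.incidence j i * (X.ν i / X.μ i) - net.capacity j| * T * r := by ring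
        _ ≤ _ := h1)
    (fun q hq => by
      have h0 : r ^ 2 * 0 = 0 := mul_zero _
      rw [X.hatN_sub_lift_eq hν hμ hr 0 ω (q := q) (by rwa [h0]), h0] at hinit
      exact norm_le_of_norm_toLp_inv_smul_le hr hinit)
    (by
      rw [hatW_eq, mul_zero] at hw0
      exact norm_le_of_norm_toLp_inv_smul_le hr hw0)
  have htime : ∀ t ∈ Set.Icc 0 T, r ^ 2 * t ∈ Set.Icc 0 (r ^ 2 * T) := fun t ht =>
    ⟨mul_nonneg hr2.le ht.1, mul_le_mul_of_nonneg_left ht.2 hr2.le⟩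
  refine ⟨supNorm_le_ofReal fun t ht => ?_, supNorm_le_ofReal fun t ht => ?_, fun j => ?_,
    supNorm_le_ofReal fun t ht => ?_, supNorm_le_ofReal fun t ht => ?_⟩
  · obtain ⟨h1, -⟩ := hres _ (htime t ht)
    rw [X.hatN_sub_lift_eq hν hμ hr t ω (hQ _)]
    exact (norm_toLp_inv_smul_le hr (h1 _ (hQ _))).trans hη1.le
  · obtain ⟨h1, h2, -⟩ := hres _ (htime t ht)
    rw [X.xiHat_eq hν hμ hr t ω (hQ _)]
    refine (norm_toLp_inv_smul_le hr (c := Cw * η + Cp * ε * K) ?_).trans ?_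
    · refine (norm_add_le _ _).trans ?_
      have h3 := (hwl _).trans (mul_le_mul_of_nonneg_left (h1 _ (hQ _)) hCw.le)
      have h4 := ((hpert' X.μ hμ').2 (pathState (X.path ω) (r ^ 2 * t))).trans
        (mul_le_mul_of_nonneg_left h2 (by positivity))
      linarith
    · rw [mul_add]; linarith
  · refine le_antisymm (iSup₂_le fun t ht => ?_) bot_le
    dsimp only
    rw [X.zetaHat_eq_zero hr hN fun s hs hdist => ?_]
    · simp
    · have hsT : s ∈ Set.Icc 0 T := ⟨hs.1.le, hs.2.trans ht.2⟩
      obtain ⟨h1, -⟩ := hres _ (htime s hsT)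
      set q := Q (net.workloadMap X.μ (pathState (X.path ω) (r ^ 2 * s))) with hq
      have hqm := hQ (net.workloadMap X.μ (pathState (X.path ω) (r ^ 2 * s)))
      rw [← hq] at hqm
      rw [X.tildeW_eq hν hμ hr s ω hqm] at hdist
      have h2 := hdist.trans_le (hface (r⁻¹ • q)
        (fun k => mul_nonneg (inv_nonneg.2 hr.le) (hqm.nonneg k)) j)
      rw [Pi.smul_apply, smul_eq_mul] at h2
      -- the multiplier of the resource is of order `r`, hence its local route is nonempty
      refine pathIdleRate_eq_zero (hloc j) (hloc' j) (htime s hsT).1 ?_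
      have h3 := (norm_le_pi_norm _ (loc j)).trans (h1 q hqm)
      rw [Pi.sub_apply, invariantState_local (hloc j) (hloc' j), Real.norm_eq_abs] at h3
      have h4 := (abs_le.1 h3).1
      have h5 : δ / Cf * r < q j := by
        rw [div_mul_eq_mul_div, div_lt_iff₀ hCf]
        have := mul_lt_mul_of_pos_right h2 hr
        calc δ * r < Cf * (r⁻¹ * q j) * r := this
          _ = q j * Cf := by field_simp
      have h6 : η * r < ν (loc j) / μ (loc j) * (q j / net.weight (loc j)) := by
        have := net.weight_pos (loc j)
        have := div_pos (hν (loc j)) (hμ (loc j))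
        calc η * r < ν (loc j) / μ (loc j) * (δ / Cf / net.weight (loc j)) * r := by
              gcongr; exact hη3 j
          _ = ν (loc j) / μ (loc j) * ((δ / Cf * r) / net.weight (loc j)) := by ring
          _ ≤ _ := by gcongr
      have h7 : 0 < pathState (X.path ω) (r ^ 2 * s) (loc j) := by linarith
      exact Nat.cast_pos.1 h7
  · obtain ⟨-, -, h3, -⟩ := hres _ (htime t ht)
    rw [hatW_eq]
    exact norm_toLp_inv_smul_le hr h3
  · obtain ⟨-, -, -, h4⟩ := hres _ (htime t ht)
    rw [X.hatU_eq r ht.1]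
    exact norm_toLp_inv_smul_le hr h4

end FlowModel

/-! ### Exponential bounds for partial sums of independent variables -/

section PartialSums

variable {Ω : Type*} [MeasurableSpace Ω] {P : Measure Ω} {Y : ℕ → Ω → ℝ} {s σ : ℝ}

lemma mgf_sum_le (hY : ∀ k, Measurable (Y k)) (hind : iIndepFun Y P)
    (hup : ∀ k, mgf (Y k) P s ≤ Real.exp σ) (S : Finset ℕ) :
    mgf (∑ i ∈ S, Y i) P s ≤ Real.exp (S.card * σ) := by
  rw [hind.mgf_sum hY, Real.exp_nat_mul]
  exact (Finset.prod_le_prod (fun i _ => mgf_nonneg) fun i _ => hup i).trans_eq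
    (Finset.prod_const _)

/-- Chernoff's bound for a sum of independent variables. -/
lemma measure_le_mul_sum_le (hY : ∀ k, Measurable (Y k)) (hind : iIndepFun Y P)
    (hint : ∀ k, Integrable (fun ω => Real.exp (s * Y k ω)) P)
    (hup : ∀ k, mgf (Y k) P s ≤ Real.exp σ) (S : Finset ℕ) (c : ℝ) :
    P {ω | c ≤ s * ∑ i ∈ S, Y i ω} ≤ ENNReal.ofReal (Real.exp (-c + S.card * σ)) := by
  have := hind.isProbabilityMeasure
  have h1 := measure_ge_le_exp_mul_mgf (μ := P) (X := fun ω => s * ∑ i ∈ S, Y i ω) (t := 1) c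
    zero_le_one (by
      have := hind.integrable_exp_mul_sum hY (s := S) fun i _ => hint i
      simpa [Finset.sum_apply] using this)
  have h2 : mgf (fun ω => s * ∑ i ∈ S, Y i ω) P 1 = mgf (∑ i ∈ S, Y i) P s := by
    simp [mgf, Finset.sum_apply]
  rw [h2, neg_one_mul] at h1
  rw [← ofReal_measureReal, Real.exp_add]
  exact ENNReal.ofReal_le_ofReal (h1.trans (mul_le_mul_of_nonneg_left
    (mgf_sum_le hY hind hup S) (Real.exp_pos _).le))

/-- The exponential maximal inequality: Doob's inequality for the submartingale `exp (s S_k)`. -/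
lemma measure_exists_le_mul_sum_le (hY : ∀ k, Measurable (Y k)) (hind : iIndepFun Y P)
    (hint : ∀ k, Integrable (fun ω => Real.exp (s * Y k ω)) P)
    (hlow : ∀ k, 1 ≤ mgf (Y k) P s) (hup : ∀ k, mgf (Y k) P s ≤ Real.exp σ) (L : ℕ) {c : ℝ}
    (hc : 0 < c) : P {ω | ∃ k ≤ L, c ≤ s * ∑ i ∈ Finset.range k, Y i ω} ≤
      ENNReal.ofReal (Real.exp (-c + (L + 1 : ℕ) * σ)) := by
  have := hind.isProbabilityMeasure
  set F := Filtration.natural Y fun k => (hY k).stronglyMeasurable with hF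
  set f : ℕ → Ω → ℝ := fun k ω => Real.exp (s * (∑ i ∈ Finset.range (k + 1), Y i) ω) with hf
  have hfint : ∀ k, Integrable (f k) P := fun k =>
    hind.integrable_exp_mul_sum hY fun i _ => hint i
  have hadp : StronglyAdapted F f := fun k => by
    have h1 : StronglyMeasurable[F k] (∑ i ∈ Finset.range (k + 1), Y i) :=
      Finset.stronglyMeasurable_sum _ fun i hi =>
        (Filtration.stronglyAdapted_natural (fun k => (hY k).stronglyMeasurable) i).mono
          (F.mono (Nat.lt_succ_iff.1 (Finset.mem_range.1 hi)))
    exact Real.continuous_exp.comp_stronglyMeasurable (h1.const_mul s)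
  have hsub : Submartingale f F P := by
    refine submartingale_nat hadp hfint fun k => ?_
    have e : f (k + 1) = f k * fun ω => Real.exp (s * Y (k + 1) ω) := by
      ext ω
      simp only [hf, Pi.mul_apply]
      rw [Finset.sum_range_succ _ (k + 1), Pi.add_apply, mul_add, Real.exp_add]
    have h1 := condExp_mul_of_stronglyMeasurable_left (μ := P) (hadp k)
      (e ▸ hfint (k + 1)) (hint (k + 1))
    have h2 : P[fun ω => Real.exp (s * Y (k + 1) ω) | F k] =ᵐ[P]
        fun _ => P[fun ω => Real.exp (s * Y (k + 1) ω)] := by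
      refine condExp_indep_eq (hY (k + 1)).comap_le (F.le k) ?_
        (hind.indep_comap_natural_of_lt (fun k => (hY k).stronglyMeasurable) k.lt_succ_self)
      exact Real.continuous_exp.comp_stronglyMeasurable
        ((comap_measurable (Y (k + 1))).stronglyMeasurable.const_mul s)
    rw [e]
    filter_upwards [h1, h2] with ω hω1 hω2
    rw [hω1, Pi.mul_apply, hω2]
    exact le_mul_of_one_le_right (Real.exp_pos _).le (hlow (k + 1))
  have hmax := maximal_ineq hsub (fun k ω => (Real.exp_pos _).le)
    (ε := ⟨Real.exp c, (Real.exp_pos c).le⟩) L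
  set A := {ω | ((⟨Real.exp c, (Real.exp_pos c).le⟩ : NNReal) : ℝ) ≤
    (Finset.range (L + 1)).sup' Finset.nonempty_range_add_one fun k => f k ω} with hA
  have hsubset : {ω | ∃ k ≤ L, c ≤ s * ∑ i ∈ Finset.range k, Y i ω} ⊆ A := by
    rintro ω ⟨k, hk, hck⟩
    obtain ⟨m, rfl⟩ : ∃ m, k = m + 1 := Nat.exists_eq_succ_of_ne_zero fun h0 => by
      subst h0; simp at hck; linarith
    refine le_trans ?_ (Finset.le_sup' (fun k => f k ω)
      (Finset.mem_range.2 (show m < L + 1 by omega)))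
    change Real.exp c ≤ Real.exp _
    rw [Real.exp_le_exp, Finset.sum_apply]
    exact hck
  have h3 : ∫ ω in A, f L ω ∂P ≤ Real.exp ((L + 1 : ℕ) * σ) := by
    refine (setIntegral_le_integral (hfint L)
      (Eventually.of_forall fun ω => (Real.exp_pos _).le)).trans ?_
    have := mgf_sum_le hY hind hup (Finset.range (L + 1))
    rwa [Finset.card_range] at this
  have h4 : ENNReal.ofReal (Real.exp c) * P A ≤ ENNReal.ofReal (Real.exp ((L + 1 : ℕ) * σ)) := by
    refine le_trans (le_of_eq ?_) (hmax.trans (ENNReal.ofReal_le_ofReal h3))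
    congr 1
    exact ENNReal.ofReal_eq_coe_nnreal _
  refine (measure_mono hsubset).trans ?_
  rw [Real.exp_add, Real.exp_neg, inv_mul_eq_div, ENNReal.ofReal_div_of_pos (Real.exp_pos c),
    ENNReal.le_div_iff_mul_le (Or.inl (by simp [Real.exp_pos])) (Or.inl ENNReal.ofReal_ne_top),
    mul_comm]
  exact h4

end PartialSums

/-! ### Exponential variables -/

section Exponential

variable {Ω : Type*} [MeasurableSpace Ω] {P : Measure Ω} {X : Ω → ℝ} {ν s : ℝ}

/-- The exponential moments of the centred exponential variable with unit rate. -/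
lemma lintegral_exp_expMeasure (hν : 0 < ν) (hs : s < 1) :
    ∫⁻ x, ENNReal.ofReal (Real.exp (s * (ν * x - 1))) ∂(expMeasure ν) =
      ENNReal.ofReal (Real.exp (-s) / (1 - s)) := by
  have hs' : 0 < 1 - s := by linarith
  have hm : Measurable fun x : ℝ => ENNReal.ofReal (Real.exp (s * (ν * x - 1))) := by fun_prop
  have hpdf : Measurable (exponentialPDF ν) := (measurable_exponentialPDFReal ν).ennreal_ofReal
  change ∫⁻ x, _ ∂(volume.withDensity (exponentialPDF ν)) = _
  rw [lintegral_withDensity_eq_lintegral_mul _ hpdf hm]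
  have e : ∀ x, (exponentialPDF ν * fun x => ENNReal.ofReal (Real.exp (s * (ν * x - 1)))) x =
      ENNReal.ofReal (Real.exp (-s) / (1 - s)) * exponentialPDF ((1 - s) * ν) x := fun x => by
    rw [Pi.mul_apply, exponentialPDF_eq, exponentialPDF_eq]
    split_ifs
    · rw [← ENNReal.ofReal_mul (mul_nonneg hν.le (Real.exp_pos _).le),
        ← ENNReal.ofReal_mul (div_nonneg (Real.exp_pos _).le hs'.le)]
      congr 1
      rw [mul_assoc, ← Real.exp_add]
      have e1 : -(ν * x) + s * (ν * x - 1) = -s + -((1 - s) * ν * x) := by ring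
      rw [e1, Real.exp_add]
      field_simp
    · simp
  rw [lintegral_congr e, lintegral_const_mul' _ _ ENNReal.ofReal_ne_top,
    lintegral_exponentialPDF_eq_one (mul_pos hs' hν), mul_one]

lemma integrable_exp_of_hasLaw (hX : HasLaw X (expMeasure ν) P) (hν : 0 < ν) (hs : s < 1) :
    Integrable (fun ω => Real.exp (s * (ν * X ω - 1))) P := by
  have hm := hX.aemeasurable
  refine ⟨(by fun_prop : AEMeasurable _ P).aestronglyMeasurable, ?_⟩
  rw [hasFiniteIntegral_iff_ofReal (Eventually.of_forall fun ω => (Real.exp_pos _).le)]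
  have := hX.lintegral_comp (f := fun x => ENNReal.ofReal (Real.exp (s * (ν * x - 1))))
    (by fun_prop)
  rw [this, lintegral_exp_expMeasure hν hs]
  exact ENNReal.ofReal_lt_top

lemma mgf_of_hasLaw (hX : HasLaw X (expMeasure ν) P) (hν : 0 < ν) (hs : s < 1) :
    mgf (fun ω => ν * X ω - 1) P s = Real.exp (-s) / (1 - s) := by
  have hs' : 0 < 1 - s := by linarith
  have hm := hX.aemeasurable
  have := hX.lintegral_comp (f := fun x => ENNReal.ofReal (Real.exp (s * (ν * x - 1))))
    (by fun_prop)
  rw [mgf, integral_eq_lintegral_of_nonneg_ae (Eventually.of_forall fun ω => (Real.exp_pos _).le)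
    (by fun_prop : AEMeasurable _ P).aestronglyMeasurable, this, lintegral_exp_expMeasure hν hs,
    ENNReal.toReal_ofReal (div_nonneg (Real.exp_pos _).le hs'.le)]

lemma one_le_mgf_of_hasLaw (hX : HasLaw X (expMeasure ν) P) (hν : 0 < ν) (hs : s < 1) :
    1 ≤ mgf (fun ω => ν * X ω - 1) P s := by
  rw [mgf_of_hasLaw hX hν hs, one_le_div (by linarith)]
  linarith [Real.add_one_le_exp (-s)]

lemma mgf_le_of_hasLaw (hX : HasLaw X (expMeasure ν) P) (hν : 0 < ν) (hs : s ≤ 1 / 2) :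
    mgf (fun ω => ν * X ω - 1) P s ≤ Real.exp (2 * s ^ 2) := by
  rw [mgf_of_hasLaw hX hν (by linarith), div_le_iff₀ (by linarith), Real.exp_neg,
    inv_le_iff_one_le_mul₀ (Real.exp_pos _), mul_assoc, mul_comm (1 - s), ← mul_assoc,
    ← Real.exp_add]
  have h1 := Real.add_one_le_exp (2 * s ^ 2 + s)
  have h2 : 1 ≤ (2 * s ^ 2 + s + 1) * (1 - s) := by nlinarith [sq_nonneg s]
  exact h2.trans (mul_le_mul_of_nonneg_right h1 (by linarith))

lemma ae_nonneg_of_hasLaw (hX : HasLaw X (expMeasure ν) P) : ∀ᵐ ω ∂P, 0 ≤ X ω := by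
  rw [hX.ae_iff (p := fun x => 0 ≤ x) (measurableSet_Ici.mem), ae_iff]
  have e : {x : ℝ | ¬0 ≤ x} = Set.Iio 0 := by ext x; simp
  rw [e]
  change (volume.withDensity (exponentialPDF ν)) (Set.Iio 0) = 0
  rw [withDensity_apply _ measurableSet_Iio]
  exact lintegral_exponentialPDF_of_nonpos le_rfl

end Exponential

/-! ### Renewal counting functions -/

section Count

variable {x : ℕ → ℝ} {t : ℝ}

lemma count_const_mul {ν : ℝ} (hν : 0 < ν) (x : ℕ → ℝ) (t : ℝ) :
    count (fun k => ν * x k) (ν * t) = count x t := by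
  simp only [count, ← Finset.mul_sum, mul_le_mul_iff_right₀ hν]

/-- If the `L`th renewal comes after time `t`, the supremum in `count` is attained; it would be the
junk value `0` if infinitely many renewals came before `t`. -/
lemma count_spec (hx : ∀ k, 0 ≤ x k) (ht : 0 ≤ t) {L : ℕ} (hL : t < ∑ k ∈ Finset.range L, x k) :
    count x t < L ∧ ∑ k ∈ Finset.range (count x t), x k ≤ t ∧
      t < ∑ k ∈ Finset.range (count x t + 1), x k := by
  have hmono : Monotone fun n => ∑ k ∈ Finset.range n, x k := fun m n hmn =>
    Finset.sum_le_sum_of_subset_of_nonneg (Finset.range_mono hmn) fun k _ _ => hx k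
  have hlt : ∀ n, ∑ k ∈ Finset.range n, x k ≤ t → n < L := fun n hn => by
    by_contra! h
    exact absurd (hL.trans_le (hmono h)) (not_lt.2 hn)
  have hbdd : BddAbove {n : ℕ | ∑ k ∈ Finset.range n, x k ≤ t} := ⟨L, fun n hn => (hlt n hn).le⟩
  have hmem : count x t ∈ {n : ℕ | ∑ k ∈ Finset.range n, x k ≤ t} :=
    Nat.sSup_mem ⟨0, by simpa using ht⟩ hbdd
  refine ⟨hlt _ hmem, hmem, ?_⟩
  by_contra! h
  exact absurd (le_csSup hbdd h) (by rw [not_le]; exact Nat.lt_succ_self _)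

/-- A law of large numbers for all windows of partial sums inverts to the same statement for the
counting function. -/
lemma abs_count_sub_count_sub_le (hx : ∀ k, 0 ≤ x k) {r ε : ℝ} (hε : 0 < ε) (hε2 : ε ≤ 1 / 2)
    (hr : 1 ≤ ε * r) {L : ℕ}
    (hwin : ∀ k m, k ≤ m → m ≤ L →
      |∑ i ∈ Finset.Ico k m, (x i - 1)| ≤ ε * (r + ((m : ℝ) - k)))
    {s t : ℝ} (hs : 0 ≤ s) (hst : s ≤ t) (ht : t < ∑ k ∈ Finset.range L, x k) :
    |((count x t : ℝ) - t) - ((count x s : ℝ) - s)| ≤ 4 * ε * (r + (t - s)) := by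
  obtain ⟨hn, hn1, hn2⟩ := count_spec hx (hs.trans hst) ht
  obtain ⟨hm, hm1, hm2⟩ := count_spec hx hs (hst.trans_lt ht)
  set n := count x t
  set m := count x s
  have hmono : Monotone fun n => ∑ k ∈ Finset.range n, x k := fun m n hmn =>
    Finset.sum_le_sum_of_subset_of_nonneg (Finset.range_mono hmn) fun k _ _ => hx k
  have hmn : m ≤ n := by
    by_contra! h
    have := hmono (show n + 1 ≤ m from h)
    simp only at this
    linarith
  have hdiff : ∀ k l, k ≤ l → ∑ i ∈ Finset.Ico k l, (x i - 1) =
      ∑ i ∈ Finset.range l, x i - ∑ i ∈ Finset.range k, x i - ((l : ℝ) - k) := fun k l hkl => by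
    rw [Finset.sum_sub_distrib, Finset.sum_Ico_eq_sub _ hkl, Finset.sum_const, Nat.card_Ico,
      nsmul_eq_mul, mul_one, Nat.cast_sub hkl]
  have hd : (m : ℝ) ≤ n := by exact_mod_cast hmn
  have hr0 : 0 < r := by
    by_contra! h
    nlinarith
  have hup : (t - s) - ((n : ℝ) - m) ≤ 1 + ε * (r + ((n : ℝ) - m + 1)) := by
    have h1 := hwin m (n + 1) (by omega) hn
    rw [hdiff m (n + 1) (by omega), Nat.cast_add_one] at h1
    have h2 := (abs_le.1 h1).2
    have e : (n : ℝ) + 1 - m = n - m + 1 := by ring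
    rw [e] at h2
    linarith
  have hlo : ((n : ℝ) - m) - (t - s) ≤ 1 + ε * (r + ((n : ℝ) - m)) := by
    rcases hmn.eq_or_lt with h | h
    · rw [h, sub_self]
      have : 0 ≤ ε * (r + 0) := by positivity
      linarith
    · have h1 := hwin (m + 1) n h hn.le
      rw [hdiff (m + 1) n h, Nat.cast_add_one] at h1
      have h2 := (abs_le.1 h1).1
      have e : (n : ℝ) - (m + 1) = n - m - 1 := by ring
      rw [e] at h2
      linarith
  have hts : 0 ≤ ε * (t - s) := mul_nonneg hε.le (by linarith)
  have e : ((n : ℝ) - t) - ((m : ℝ) - s) = (n - m) - (t - s) := by ring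
  rw [e, abs_le]
  set d := (n : ℝ) - m
  constructor
  · rcases le_total (t - s) d with h | h
    · nlinarith
    · nlinarith [mul_le_mul_of_nonneg_left h hε.le]
  · have : d * (1 / 2) ≤ d * (1 - ε) := mul_le_mul_of_nonneg_left (by linarith) (by
      simp only [d]; linarith)
    -- `d (1 - ε) ≤ (t - s) + 1 + ε r`, so that `d ≤ 2 (t - s) + 2 + 2 ε r`
    have h2 : ε * d ≤ ε * (2 * (t - s) + 2 + 2 * (ε * r)) :=
      mul_le_mul_of_nonneg_left (by nlinarith) hε.le
    have h3 : ε * (ε * r) ≤ 1 / 2 * (ε * r) := mul_le_mul_of_nonneg_right hε2 (by linarith)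
    nlinarith

lemma abs_count_sub_le (hx : ∀ k, 0 ≤ x k) {c : ℝ} {L : ℕ}
    (hmax : ∀ k ≤ L, |∑ i ∈ Finset.range k, (x i - 1)| ≤ c) (ht0 : 0 ≤ t)
    (ht : t < ∑ k ∈ Finset.range L, x k) : |(count x t : ℝ) - t| ≤ c + 1 := by
  obtain ⟨hn, hn1, hn2⟩ := count_spec hx ht0 ht
  have h1 := abs_le.1 (hmax _ hn.le)
  have h2 := abs_le.1 (hmax _ (show count x t + 1 ≤ L from hn))
  simp only [Finset.sum_sub_distrib, Finset.sum_const, Finset.card_range, nsmul_eq_mul,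
    mul_one, Nat.cast_add_one] at h1 h2
  rw [abs_le]
  constructor <;> linarith

end Count

/-! ### Deviations of the counting processes -/

section Deviations

variable {Ω : Type*} [MeasurableSpace Ω] {P : Measure Ω} {Y : ℕ → Ω → ℝ}

/-- The partial sums over all windows `[k, m)` with `m ≤ L` are small simultaneously, up to an
exponentially small probability. -/
lemma measure_exists_window_le (hY : ∀ k, Measurable (Y k)) (hind : iIndepFun Y P)
    (hint : ∀ s < 1, ∀ k, Integrable (fun ω => Real.exp (s * Y k ω)) P)
    (hup : ∀ s ≤ 1 / 2, ∀ k, mgf (Y k) P s ≤ Real.exp (2 * s ^ 2)) {ε r : ℝ} (hε : 0 < ε)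
    (hε2 : ε ≤ 1) (L : ℕ) :
    P {ω | ∃ k m : ℕ, k ≤ m ∧ m ≤ L ∧ ε * (r + ((m : ℝ) - k)) < |∑ i ∈ Finset.Ico k m, Y i ω|} ≤
      ENNReal.ofReal (((L + 1 : ℕ) : ℝ) ^ 2 * (2 * Real.exp (-(ε ^ 2 * r / 2)))) := by
  have hone : ∀ k m : ℕ, k ≤ m →
      P {ω | ε * (r + ((m : ℝ) - k)) < |∑ i ∈ Finset.Ico k m, Y i ω|} ≤
        ENNReal.ofReal (2 * Real.exp (-(ε ^ 2 * r / 2))) := fun k m hkm => by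
    -- Chernoff's bound with the exponent `s = ± ε / 2`
    have hside : ∀ s, s ^ 2 = ε ^ 2 / 4 → s ≤ 1 / 2 →
        P {ω | ε ^ 2 * (r + ((m : ℝ) - k)) / 2 ≤ s * ∑ i ∈ Finset.Ico k m, Y i ω} ≤
          ENNReal.ofReal (Real.exp (-(ε ^ 2 * r / 2))) := fun s hs hs2 => by
      refine (measure_le_mul_sum_le hY hind (hint s (by linarith)) (hup s hs2) _ _).trans_eq ?_
      rw [Nat.card_Ico, Nat.cast_sub hkm, hs]
      congr 2
      ring
    have hsub : {ω | ε * (r + ((m : ℝ) - k)) < |∑ i ∈ Finset.Ico k m, Y i ω|} ⊆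
        {ω | ε ^ 2 * (r + ((m : ℝ) - k)) / 2 ≤ (ε / 2) * ∑ i ∈ Finset.Ico k m, Y i ω} ∪
        {ω | ε ^ 2 * (r + ((m : ℝ) - k)) / 2 ≤ (-(ε / 2)) * ∑ i ∈ Finset.Ico k m, Y i ω} := by
      intro ω hω
      rw [Set.mem_ofPred_eq, lt_abs] at hω
      rcases hω with h | h
      · left
        have := mul_le_mul_of_nonneg_left h.le (half_pos hε).le
        rw [Set.mem_ofPred_eq]
        linarith
      · right
        have := mul_le_mul_of_nonneg_left h.le (half_pos hε).le
        rw [Set.mem_ofPred_eq]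
        linarith
    refine (measure_mono hsub).trans ((measure_union_le _ _).trans ?_)
    rw [two_mul, ENNReal.ofReal_add (Real.exp_pos _).le (Real.exp_pos _).le]
    exact add_le_add (hside _ (by ring) (by linarith)) (hside _ (by ring) (by linarith))
  have hsub : {ω | ∃ k m : ℕ, k ≤ m ∧ m ≤ L ∧
        ε * (r + ((m : ℝ) - k)) < |∑ i ∈ Finset.Ico k m, Y i ω|} ⊆
      ⋃ p ∈ (Finset.range (L + 1) ×ˢ Finset.range (L + 1)).filter fun p => p.1 ≤ p.2,
        {ω | ε * (r + ((p.2 : ℝ) - p.1)) < |∑ i ∈ Finset.Ico p.1 p.2, Y i ω|} := by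
    rintro ω ⟨k, m, hkm, hmL, h⟩
    simp only [Set.mem_iUnion]
    exact ⟨(k, m), by simp; omega, h⟩
  refine (measure_mono hsub).trans ((measure_biUnion_finset_le _ _).trans ?_)
  refine (Finset.sum_le_sum fun p hp => hone p.1 p.2 (Finset.mem_filter.1 hp).2).trans ?_
  rw [Finset.sum_const, nsmul_eq_mul, ← ENNReal.ofReal_natCast,
    ← ENNReal.ofReal_mul (Nat.cast_nonneg _)]
  refine ENNReal.ofReal_le_ofReal (mul_le_mul_of_nonneg_right ?_ (by positivity))
  rw [← Nat.cast_pow]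
  refine Nat.cast_le.2 ((Finset.card_filter_le _ _).trans_eq ?_)
  rw [Finset.card_product, Finset.card_range, sq]

/-- The first `L` partial sums are at most `κ r` simultaneously, up to a probability that is
exponentially small in `κ` if `L = O(r ^ 2)`. -/
lemma measure_exists_abs_sum_le (hY : ∀ k, Measurable (Y k)) (hind : iIndepFun Y P)
    (hint : ∀ s < 1, ∀ k, Integrable (fun ω => Real.exp (s * Y k ω)) P)
    (hlow : ∀ s < 1, ∀ k, 1 ≤ mgf (Y k) P s)
    (hup : ∀ s ≤ 1 / 2, ∀ k, mgf (Y k) P s ≤ Real.exp (2 * s ^ 2)) {κ r : ℝ} (hκ : 0 < κ)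
    (hr : 2 ≤ r) (L : ℕ) :
    P {ω | ∃ k ≤ L, κ * r < |∑ i ∈ Finset.range k, Y i ω|} ≤
      ENNReal.ofReal (2 * Real.exp (-κ + (L + 1 : ℕ) * (2 / r ^ 2))) := by
  have hr0 : 0 < r := by linarith
  have hinv : r⁻¹ ≤ 1 / 2 := by rw [inv_le_comm₀ hr0 (by norm_num)]; linarith
  have hinv0 : 0 < r⁻¹ := inv_pos.2 hr0
  -- the maximal inequality with the exponent `s = ± 1 / r`
  have hside : ∀ s, s ^ 2 = (r ^ 2)⁻¹ → s ≤ 1 / 2 →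
      P {ω | ∃ k ≤ L, κ ≤ s * ∑ i ∈ Finset.range k, Y i ω} ≤
        ENNReal.ofReal (Real.exp (-κ + (L + 1 : ℕ) * (2 / r ^ 2))) := fun s hs hs2 => by
    have := measure_exists_le_mul_sum_le hY hind (hint s (by linarith)) (hlow s (by linarith))
      (hup s hs2) L hκ
    rwa [hs, ← div_eq_mul_inv] at this
  have hsub : {ω | ∃ k ≤ L, κ * r < |∑ i ∈ Finset.range k, Y i ω|} ⊆
      {ω | ∃ k ≤ L, κ ≤ r⁻¹ * ∑ i ∈ Finset.range k, Y i ω} ∪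
      {ω | ∃ k ≤ L, κ ≤ (-r⁻¹) * ∑ i ∈ Finset.range k, Y i ω} := by
    rintro ω ⟨k, hk, h⟩
    rcases lt_abs.1 h with h | h
    · left
      refine ⟨k, hk, ?_⟩
      rw [inv_mul_eq_div, le_div_iff₀ hr0]
      exact h.le
    · right
      refine ⟨k, hk, ?_⟩
      rw [neg_mul, ← mul_neg, inv_mul_eq_div, le_div_iff₀ hr0]
      exact h.le
  refine (measure_mono hsub).trans ((measure_union_le _ _).trans ?_)
  rw [two_mul, ENNReal.ofReal_add (Real.exp_pos _).le (Real.exp_pos _).le]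
  exact add_le_add (hside _ (by rw [inv_pow]) hinv)
    (hside _ (by rw [neg_sq, inv_pow]) (by linarith))

/-- With high probability, the counting process of exponential variables of rate `ν` deviates from
`ν t` by at most `κ r` on the time scale `r ^ 2`, and over windows of length of order `r` its
increments deviate from their means by at most a small multiple of `r`.  The bounds are uniform in
the rate and in the probability space. -/
theorem exists_count_deviation_le {a δ : ℝ} (ha : 0 < a) (hδ : 0 < δ) :
    ∃ κ : ℝ, 0 < κ ∧ ∀ ε : ℝ, 0 < ε → ∀ᶠ r : ℝ in atTop,
      ∀ (Ω : Type*) [MeasurableSpace Ω] (P : Measure Ω) (x : ℕ → Ω → ℝ) (ν : ℝ), 0 < ν →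
      (∀ k, HasLaw (x k) (expMeasure ν) P) → iIndepFun x P →
      P {ω | ¬ ((∀ s t, 0 ≤ s → s ≤ t → ν * t ≤ a * r ^ 2 →
          |((count (fun k => x k ω) t : ℝ) - ν * t) - ((count (fun k => x k ω) s : ℝ) - ν * s)|
            ≤ ε * (r + ν * (t - s))) ∧
        ∀ t, 0 ≤ t → ν * t ≤ a * r ^ 2 →
          |(count (fun k => x k ω) t : ℝ) - ν * t| ≤ κ * r)} ≤ ENNReal.ofReal δ := by
  set b := 2 * (2 * a + 4) with hb
  obtain ⟨κ, hκ, hκδ⟩ : ∃ κ : ℝ, 0 < κ ∧ 2 * Real.exp (-κ + b) ≤ δ / 2 := by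
    have h : Tendsto (fun κ : ℝ => 2 * Real.exp (-κ + b)) atTop (𝓝 (2 * 0)) :=
      (Real.tendsto_exp_atBot.comp
        (tendsto_atBot_add_const_right _ _ tendsto_neg_atTop_atBot)).const_mul 2
    rw [mul_zero] at h
    exact ((eventually_gt_atTop 0).and (h.eventually_le_const (half_pos hδ))).exists
  refine ⟨κ + 1, by linarith, fun ε' hε' => ?_⟩
  obtain ⟨ε, hε, hε2, hεε⟩ : ∃ ε : ℝ, 0 < ε ∧ ε ≤ 1 / 2 ∧ 4 * ε ≤ ε' :=
    ⟨min (1 / 2) (ε' / 4), by positivity, min_le_left _ _, by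
      linarith [min_le_right (1 / 2) (ε' / 4)]⟩
  have hlim : Tendsto (fun r : ℝ => ((2 * a + 4) * r ^ 2) ^ 2 *
      (2 * Real.exp (-(ε ^ 2 * r / 2)))) atTop (𝓝 0) := by
    have h := (tendsto_rpow_mul_exp_neg_mul_atTop_nhds_zero 4 (ε ^ 2 / 2)
      (by positivity)).const_mul (2 * (2 * a + 4) ^ 2)
    rw [mul_zero] at h
    refine h.congr fun r => ?_
    have e1 : (r : ℝ) ^ (4 : ℝ) = r ^ 4 := by exact_mod_cast Real.rpow_natCast r 4
    have e2 : -(ε ^ 2 / 2) * r = -(ε ^ 2 * r / 2) := by ring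
    rw [e1, e2]
    ring
  filter_upwards [hlim.eventually_le_const (half_pos hδ), eventually_ge_atTop 2,
    eventually_ge_atTop ε⁻¹] with r hr hr2 hrε Ω _ P x ν hν hlaw hind
  have hr0 : 0 < r := by linarith
  have hεr : 1 ≤ ε * r := by rwa [inv_le_iff_one_le_mul₀ hε, mul_comm] at hrε
  -- on the good event, more than `a * r ^ 2` units of time elapse before the `L`th renewal
  set L := ⌈(2 * a + 2) * r ^ 2⌉₊
  have hL1 : (2 * a + 2) * r ^ 2 ≤ L := Nat.le_ceil _
  have hL2 : ((L + 1 : ℕ) : ℝ) ≤ (2 * a + 4) * r ^ 2 := by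
    have := Nat.ceil_lt_add_one (show 0 ≤ (2 * a + 2) * r ^ 2 by positivity)
    push_cast
    nlinarith
  -- measurable versions of the centred variables, which are only almost everywhere measurable
  have hxm : ∀ k, AEMeasurable (fun ω => ν * x k ω - 1) P := fun k => by
    have := (hlaw k).aemeasurable
    fun_prop
  set Y : ℕ → Ω → ℝ := fun k => (hxm k).mk with hYdef
  have hY : ∀ k, Measurable (Y k) := fun k => (hxm k).measurable_mk
  have hYx : ∀ k, (fun ω => ν * x k ω - 1) =ᵐ[P] Y k := fun k => (hxm k).ae_eq_mk
  have hYind : iIndepFun Y P :=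
    (hind.comp (fun _ y => ν * y - 1) fun _ => by fun_prop).congr hYx
  have hmgf : ∀ k s, mgf (Y k) P s = mgf (fun ω => ν * x k ω - 1) P s := fun k s =>
    mgf_congr (hYx k).symm
  have hint : ∀ s < 1, ∀ k, Integrable (fun ω => Real.exp (s * Y k ω)) P := fun s hs k =>
    (integrable_exp_of_hasLaw (hlaw k) hν hs).congr ((hYx k).mono fun ω hω => by
      simp only at hω ⊢; rw [hω])
  have hlow : ∀ s < 1, ∀ k, 1 ≤ mgf (Y k) P s := fun s hs k => by
    rw [hmgf]; exact one_le_mgf_of_hasLaw (hlaw k) hν hs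
  have hup : ∀ s ≤ 1 / 2, ∀ k, mgf (Y k) P s ≤ Real.exp (2 * s ^ 2) := fun s hs k => by
    rw [hmgf]; exact mgf_le_of_hasLaw (hlaw k) hν hs
  have hbad1 := measure_exists_window_le (r := r) hY hYind hint hup hε (by linarith) L
  have hbad2 := measure_exists_abs_sum_le hY hYind hint hlow hup hκ hr2 L
  have hsub : ({ω | ¬ ((∀ s t, 0 ≤ s → s ≤ t → ν * t ≤ a * r ^ 2 →
          |((count (fun k => x k ω) t : ℝ) - ν * t) - ((count (fun k => x k ω) s : ℝ) - ν * s)|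
            ≤ ε' * (r + ν * (t - s))) ∧
        ∀ t, 0 ≤ t → ν * t ≤ a * r ^ 2 →
          |(count (fun k => x k ω) t : ℝ) - ν * t| ≤ (κ + 1) * r)} : Set Ω) ≤ᵐ[P]
      ({ω | ∃ k m : ℕ, k ≤ m ∧ m ≤ L ∧
          ε * (r + ((m : ℝ) - k)) < |∑ i ∈ Finset.Ico k m, Y i ω|} ∪
        {ω | ∃ k ≤ L, κ * r < |∑ i ∈ Finset.range k, Y i ω|} : Set Ω) := by
    filter_upwards [ae_all_iff.2 hYx, ae_all_iff.2 fun k => ae_nonneg_of_hasLaw (hlaw k)]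
      with ω hω hpos hbad
    by_contra hgood
    refine hbad ?_
    change ¬ (_ ∨ _) at hgood
    simp only [Set.mem_ofPred_eq, not_or, not_exists, not_and, not_lt] at hgood
    obtain ⟨hwin, hmax⟩ := hgood
    have hz : ∀ k, 0 ≤ ν * x k ω := fun k => mul_nonneg hν.le (hpos k)
    have hwin' : ∀ k m, k ≤ m → m ≤ L →
        |∑ i ∈ Finset.Ico k m, (ν * x i ω - 1)| ≤ ε * (r + ((m : ℝ) - k)) := fun k m h1 h2 => by
      rw [Finset.sum_congr rfl fun i _ => hω i]
      exact hwin k m h1 h2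
    have hmax' : ∀ k ≤ L, |∑ i ∈ Finset.range k, (ν * x i ω - 1)| ≤ κ * r := fun k h => by
      rw [Finset.sum_congr rfl fun i _ => hω i]
      exact hmax k h
    have hSL : a * r ^ 2 < ∑ k ∈ Finset.range L, ν * x k ω := by
      have h := (abs_le.1 (hwin' 0 L (Nat.zero_le _) le_rfl)).1
      rw [← Finset.range_eq_Ico, Finset.sum_sub_distrib, Finset.sum_const, Finset.card_range,
        nsmul_eq_mul, mul_one, Nat.cast_zero, sub_zero] at h
      have h2 : ε * (r + L) ≤ 1 / 2 * (r + L) := mul_le_mul_of_nonneg_right hε2 (by positivity)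
      nlinarith
    constructor
    · intro s t hs hst ht
      have h := abs_count_sub_count_sub_le hz hε hε2 hεr hwin' (mul_nonneg hν.le hs)
        (mul_le_mul_of_nonneg_left hst hν.le) (ht.trans_lt hSL)
      rw [count_const_mul hν, count_const_mul hν, ← mul_sub] at h
      refine h.trans (mul_le_mul_of_nonneg_right hεε ?_)
      have := mul_nonneg hν.le (sub_nonneg.2 hst)
      linarith
    · intro t ht0 ht
      have h := abs_count_sub_le hz hmax' (mul_nonneg hν.le ht0) (ht.trans_lt hSL)
      rw [count_const_mul hν] at h
      linarith
  refine (measure_mono_ae hsub).trans ((measure_union_le _ _).trans ?_)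
  rw [← add_halves δ, ENNReal.ofReal_add (half_pos hδ).le (half_pos hδ).le]
  refine add_le_add (hbad1.trans (ENNReal.ofReal_le_ofReal (le_trans ?_ hr)))
    (hbad2.trans (ENNReal.ofReal_le_ofReal (le_trans ?_ hκδ)))
  · gcongr
  · have h : ((L + 1 : ℕ) : ℝ) * (2 / r ^ 2) ≤ b := by
      rw [mul_div_assoc', div_le_iff₀ (by positivity)]
      rw [hb]
      linarith
    gcongr

end Deviations

/-! ### Noise of a flow-level model -/

section Noise

variable [Nonempty J] [Nonempty I]

open Network

/-- The counting processes transfer their deviation bounds to the noise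
`N(t) - N(0) - ν t + μ T(t)`, since `T` is Lipschitz. -/
theorem FlowModel.exists_noise_bound (net : Network J I) (ν μ : I → ℝ) {T δ : ℝ} (hT : 0 < T)
    (hδ : 0 < δ) : ∃ κ : ℝ, 0 < κ ∧ ∀ ε : ℝ, 0 < ε → ∀ᶠ r : ℝ in atTop,
      ∀ (Ω : Type*) [MeasurableSpace Ω] (P : Measure Ω) (X : FlowModel net P),
      (∀ i, X.ν i ≤ ν i) → (∀ i, X.μ i ≤ μ i) →
      P {ω | ¬ ((∀ i s t, 0 ≤ s → s ≤ t → t ≤ r ^ 2 * T + r →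
        |net.pathNoise X.ν X.μ (X.path ω) i t - net.pathNoise X.ν X.μ (X.path ω) i s|
          ≤ ε * (r + (t - s))) ∧
      ∀ i, ∀ t ∈ Set.Icc 0 (r ^ 2 * T), |net.pathNoise X.ν X.μ (X.path ω) i t| ≤ κ * r)} ≤
        ENNReal.ofReal δ := by
  set c := ∑ j, net.capacity j with hc
  have hc0 : 0 < c := Finset.sum_pos (fun j _ => net.capacity_pos j) Finset.univ_nonempty
  obtain ⟨b, hb1, hbν, hbμ⟩ : ∃ b : ℝ, 1 ≤ b ∧ (∀ i, ν i ≤ b) ∧ ∀ i, μ i * c ≤ b := by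
    refine ⟨1 + ∑ i, |ν i| + ∑ i, |μ i * c|, ?_, fun i => ?_, fun i => ?_⟩
    · have h1 : 0 ≤ ∑ i, |ν i| := Finset.sum_nonneg fun i _ => abs_nonneg _
      have h2 : 0 ≤ ∑ i, |μ i * c| := Finset.sum_nonneg fun i _ => abs_nonneg _
      linarith
    · have h1 := Finset.single_le_sum (f := fun i => |ν i|) (fun i _ => abs_nonneg _)
        (Finset.mem_univ i)
      have h2 : 0 ≤ ∑ i, |μ i * c| := Finset.sum_nonneg fun i _ => abs_nonneg _
      have h3 := le_abs_self (ν i)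
      linarith
    · have h1 := Finset.single_le_sum (f := fun i => |μ i * c|) (fun i _ => abs_nonneg _)
        (Finset.mem_univ i)
      have h2 : 0 ≤ ∑ i, |ν i| := Finset.sum_nonneg fun i _ => abs_nonneg _
      have h3 := le_abs_self (μ i * c)
      linarith
  have hcard : 0 < (Fintype.card I : ℝ) := Nat.cast_pos.2 Fintype.card_pos
  obtain ⟨κ, hκ, hdev⟩ := exists_count_deviation_le (a := b * (T + 1))
    (δ := δ / (2 * Fintype.card I)) (by positivity) (by positivity)
  refine ⟨2 * κ, by positivity, fun ε hε => ?_⟩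
  filter_upwards [hdev (ε / (2 * b)) (by positivity), eventually_ge_atTop 1]
    with r hr hr1 Ω _ P X hXν hXμ
  have hr0 : 0 < r := by linarith
  set good : (ℕ → Ω → ℝ) → ℝ → Set Ω := fun x v => {ω |
    (∀ s t, 0 ≤ s → s ≤ t → v * t ≤ b * (T + 1) * r ^ 2 →
      |((count (fun k => x k ω) t : ℝ) - v * t) - ((count (fun k => x k ω) s : ℝ) - v * s)|
        ≤ ε / (2 * b) * (r + v * (t - s))) ∧
    ∀ t, 0 ≤ t → v * t ≤ b * (T + 1) * r ^ 2 →
      |(count (fun k => x k ω) t : ℝ) - v * t| ≤ κ * r} with hgood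
  have harr : ∀ i, P (good (X.arr i) (X.ν i))ᶜ ≤ ENNReal.ofReal (δ / (2 * Fintype.card I)) :=
    fun i => hr Ω P (X.arr i) (X.ν i) (X.ν_pos i) (X.law_arr i)
      (X.indep.precomp (g := fun k => Sum.inl (i, k)) fun k l h => by simpa using h)
  have hsize : ∀ i, P (good (X.size i) (X.μ i))ᶜ ≤ ENNReal.ofReal (δ / (2 * Fintype.card I)) :=
    fun i => hr Ω P (X.size i) (X.μ i) (X.μ_pos i) (X.law_size i)
      (X.indep.precomp (g := fun k => Sum.inr (i, k)) fun k l h => by simpa using h)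
  have hsub : ({ω | ¬ ((∀ i s t, 0 ≤ s → s ≤ t → t ≤ r ^ 2 * T + r →
        |net.pathNoise X.ν X.μ (X.path ω) i t - net.pathNoise X.ν X.μ (X.path ω) i s|
          ≤ ε * (r + (t - s))) ∧
      ∀ i, ∀ t ∈ Set.Icc 0 (r ^ 2 * T),
        |net.pathNoise X.ν X.μ (X.path ω) i t| ≤ 2 * κ * r)} : Set Ω) ≤ᵐ[P]
      (⋃ i ∈ (Finset.univ : Finset I), (good (X.arr i) (X.ν i))ᶜ ∪ (good (X.size i) (X.μ i))ᶜ :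
        Set Ω) := by
    filter_upwards [X.dynamics, X.rightContinuous] with ω hdyn hright hbad
    change ω ∈ (⋃ i ∈ (Finset.univ : Finset I), _ : Set Ω)
    by_contra hω
    refine hbad ?_
    simp only [Finset.mem_univ, Set.iUnion_true, Set.mem_iUnion, not_exists, Set.mem_union,
      not_or, Set.mem_compl_iff, not_not] at hω
    have hnoise : ∀ i t, 0 ≤ t → net.pathNoise X.ν X.μ (X.path ω) i t =
        ((count (fun k => X.arr i k ω) t : ℝ) - X.ν i * t) -
        ((count (fun k => X.size i k ω) (net.pathBandwidth (X.path ω) i t) : ℝ) -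
          X.μ i * net.pathBandwidth (X.path ω) i t) := fun i t ht => by
      have h1 := hdyn t ht i
      have h2 : net.cumulativeBandwidth (fun s => X.N s ω) i t =
        net.pathBandwidth (X.path ω) i t := cumulativeBandwidth_eq _ i ht
      rw [h2] at h1
      have h3 : (X.path ω t i : ℝ) = X.N t ω i := rfl
      have h4 : (X.path ω 0 i : ℝ) = X.N 0 ω i := rfl
      rw [pathNoise, h3, h4, h1]
      ring
    have hB : ∀ i s t, s ≤ t → net.pathBandwidth (X.path ω) i t -
        net.pathBandwidth (X.path ω) i s ∈ Set.Icc 0 (c * (t - s)) := fun i s t hst =>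
      pathBandwidth_sub_mem hright i hst
    have hB0 : ∀ i t, 0 ≤ t → 0 ≤ net.pathBandwidth (X.path ω) i t := fun i t ht => by
      simpa [pathBandwidth_zero] using (hB i 0 t ht).1
    -- the time changes stay within the range of the bounds for the counting processes
    have hrangeν : ∀ i t, 0 ≤ t → t ≤ r ^ 2 * T + r → X.ν i * t ≤ b * (T + 1) * r ^ 2 :=
      fun i t ht htr => by
        have h1 : X.ν i * t ≤ b * t :=
          mul_le_mul_of_nonneg_right ((hXν i).trans (hbν i)) ht
        have h2 : b * t ≤ b * (r ^ 2 * (T + 1)) :=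
          mul_le_mul_of_nonneg_left (by nlinarith) (by linarith)
        linarith
    have hstepμ : ∀ i s t, s ≤ t → X.μ i * (net.pathBandwidth (X.path ω) i t -
        net.pathBandwidth (X.path ω) i s) ≤ b * (t - s) := fun i s t hst => by
      have h1 := mul_le_mul_of_nonneg_left (hB i s t hst).2 (X.μ_pos i).le
      have h2 : X.μ i * c ≤ b :=
        (mul_le_mul_of_nonneg_right (hXμ i) hc0.le).trans (hbμ i)
      have h3 := mul_le_mul_of_nonneg_right h2 (sub_nonneg.2 hst)
      linarith
    have hrangeμ : ∀ i t, 0 ≤ t → t ≤ r ^ 2 * T + r →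
        X.μ i * net.pathBandwidth (X.path ω) i t ≤ b * (T + 1) * r ^ 2 := fun i t ht htr => by
      have h1 := hstepμ i 0 t ht
      rw [pathBandwidth_zero, sub_zero, sub_zero] at h1
      have h2 : b * t ≤ b * (r ^ 2 * (T + 1)) :=
        mul_le_mul_of_nonneg_left (by nlinarith) (by linarith)
      linarith
    constructor
    · intro i s t hs hst htr
      have ht := hs.trans hst
      have h1 := (hω i).1.1 s t hs hst (hrangeν i t ht htr)
      have h2 := (hω i).2.1 _ _ (hB0 i s hs) (sub_nonneg.1 (hB i s t hst).1)
        (hrangeμ i t ht htr)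
      have h3 := mul_le_mul_of_nonneg_right ((hXν i).trans (hbν i)) (sub_nonneg.2 hst)
      have h4 := hstepμ i s t hst
      rw [hnoise i t ht, hnoise i s hs]
      have h5 : ε / (2 * b) * (r + X.ν i * (t - s)) + ε / (2 * b) * (r + X.μ i *
          (net.pathBandwidth (X.path ω) i t - net.pathBandwidth (X.path ω) i s)) ≤
          ε / (2 * b) * (2 * b * (r + (t - s))) := by
        rw [← mul_add]
        refine mul_le_mul_of_nonneg_left ?_ (by positivity)
        nlinarith
      have h6 : ε / (2 * b) * (2 * b * (r + (t - s))) = ε * (r + (t - s)) := by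
        field_simp
      rw [abs_le] at h1 h2 ⊢
      constructor <;> linarith [h1.1, h1.2, h2.1, h2.2]
    · intro i t ht
      have htr : t ≤ r ^ 2 * T + r := ht.2.trans (by linarith)
      have h1 := (hω i).1.2 t ht.1 (hrangeν i t ht.1 htr)
      have h2 := (hω i).2.2 _ (hB0 i t ht.1) (hrangeμ i t ht.1 htr)
      rw [hnoise i t ht.1]
      rw [abs_le] at h1 h2 ⊢
      constructor <;> linarith [h1.1, h1.2, h2.1, h2.2]
  refine (measure_mono_ae hsub).trans ((measure_biUnion_finset_le _ _).trans ?_)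
  refine (Finset.sum_le_sum fun i _ => (measure_union_le _ _).trans
    (add_le_add (harr i) (hsize i))).trans_eq ?_
  rw [Finset.sum_const, ← ENNReal.ofReal_add (by positivity) (by positivity),
    ← ENNReal.ofReal_nsmul, Finset.card_univ, nsmul_eq_mul]
  congr 1
  field_simp
  ring

end Noise

/-! ### Tightness -/

/-- A sequence that converges in distribution is tight. -/
lemma exists_eventually_measure_norm_ge_le {E : Type*} [NormedAddCommGroup E] [MeasurableSpace E]
    [BorelSpace E] {Ω : ℕ → Type*} [∀ l, MeasurableSpace (Ω l)] {P : ∀ l, Measure (Ω l)}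
    [∀ l, IsProbabilityMeasure (P l)] {η : Measure E} [IsProbabilityMeasure η]
    {Z : ∀ l, Ω l → E} (hZ : TendstoInDistribution Z atTop id P η) {δ : ℝ} (hδ : 0 < δ) :
    ∃ κ : ℝ, 0 < κ ∧ ∀ᶠ l in atTop, P l {ω | κ ≤ ‖Z l ω‖} ≤ ENNReal.ofReal δ := by
  have hclosed : ∀ n : ℕ, IsClosed {x : E | (n : ℝ) ≤ ‖x‖} := fun n =>
    isClosed_le continuous_const continuous_norm
  have hlim : Tendsto (fun n : ℕ => η {x : E | (n : ℝ) ≤ ‖x‖}) atTop (𝓝 0) := by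
    have h := tendsto_measure_iInter_atTop (μ := η) (s := fun n : ℕ => {x : E | (n : ℝ) ≤ ‖x‖})
      (fun n => (hclosed n).measurableSet.nullMeasurableSet)
      (fun m n hmn x (hx : (n : ℝ) ≤ ‖x‖) => (Nat.cast_le.2 hmn).trans hx) ⟨0, measure_ne_top _ _⟩
    have e : ⋂ n : ℕ, {x : E | (n : ℝ) ≤ ‖x‖} = ∅ := by
      ext x
      obtain ⟨n, hn⟩ := exists_nat_gt ‖x‖
      simp only [Set.mem_iInter, Set.mem_empty_iff_false, iff_false, not_forall]
      exact ⟨n, not_le.2 hn⟩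
    rwa [e, measure_empty] at h
  obtain ⟨n, hn, hn0⟩ := ((hlim.eventually_lt_const (ENNReal.ofReal_pos.2 hδ)).and
    (eventually_gt_atTop 0)).exists
  refine ⟨n, Nat.cast_pos.2 hn0, ?_⟩
  have h1 := ProbabilityMeasure.limsup_measure_closed_le_of_tendsto hZ.tendsto (hclosed n)
  have h2 : η.map id {x : E | (n : ℝ) ≤ ‖x‖} < ENNReal.ofReal δ := by rwa [Measure.map_id]
  filter_upwards [eventually_lt_of_limsup_lt (h1.trans_lt h2)] with l hl
  refine le_of_eq_of_le ?_ hl.le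
  exact (Measure.map_apply_of_aemeasurable (hZ.forall_aemeasurable l)
    (hclosed n).measurableSet).symm

end BandwidthSharing

end

theorem lemma7p5 {J I : Type*} [Fintype J] [Fintype I] [DecidableEq J] [Nonempty J] [Nonempty I]
    (net : BandwidthSharing.Network J I)
    -- the scale parameters and the sequence of models
    (r : ℕ → ℝ) (hr_pos : ∀ l, 0 < r l) (hr_mono : Monotone r) (hr : Tendsto r atTop atTop)
    {Ω : ℕ → Type*} [∀ l, MeasurableSpace (Ω l)] (P : ∀ l, Measure (Ω l))
    [∀ l, IsProbabilityMeasure (P l)] (X : ∀ l, BandwidthSharing.FlowModel net (P l))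
    -- heavy traffic
    (ν μ : I → ℝ) (θ : J → ℝ) (hν_pos : ∀ i, 0 < ν i) (hμ_pos : ∀ i, 0 < μ i)
    (hν : ∀ i, Tendsto (fun l => (X l).ν i) atTop (𝓝 (ν i)))
    (hμ : ∀ i, Tendsto (fun l => (X l).μ i) atTop (𝓝 (μ i)))
    (hθ : ∀ j, Tendsto (fun l => r l *
      (∑ i, net.incidence j i * ((X l).ν i / (X l).μ i) - net.capacity j)) atTop (𝓝 (θ j)))
    -- the scaled initial workloads converge in distribution, to a random vector with law `η`
    (η : Measure (EuclideanSpace ℝ J)) [IsProbabilityMeasure η]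
    (hη : TendstoInDistribution (fun l ω => (X l).hatW (r l) 0 ω) atTop id P η)
    (hlocal : net.LocalTraffic)
    -- state space collapse at time zero, in probability
    (hinit : ∀ ε : ℝ, 0 < ε → Tendsto (fun l => P l
      {ω | ε ≤ ‖(X l).hatN (r l) 0 ω - net.lift ν μ ((X l).hatW (r l) 0 ω)‖}) atTop (𝓝 0)) :
    ∀ T : ℝ, 0 < T → ∀ δ : ℝ, 0 < δ → ∃ K : ℝ, 0 < K ∧ ∃ R : ℝ, 0 < R ∧ ∀ l, R ≤ r l →
      ENNReal.ofReal (1 - δ) ≤ P l {ω |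
        BandwidthSharing.supNorm (fun t =>
          (X l).hatN (r l) t ω - net.lift ν μ ((X l).hatW (r l) t ω)) T ≤ ENNReal.ofReal δ ∧
        BandwidthSharing.supNorm (fun t => (X l).xiHat ν μ (r l) t ω) T ≤ ENNReal.ofReal δ ∧
        (∀ j, BandwidthSharing.supNorm (fun t => (X l).zetaHat ν μ (r l) δ j t ω) T = 0) ∧
        BandwidthSharing.supNorm (fun t => (X l).hatW (r l) t ω) T ≤ ENNReal.ofReal K ∧
        BandwidthSharing.supNorm (fun t => (X l).hatU (r l) t ω) T ≤ ENNReal.ofReal K} := by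
  intro T hT δ hδ
  have hδ4 : 0 < δ / 4 := by linarith
  have hcrit : ∀ j, ∑ i, net.incidence j i * (ν i / μ i) = net.capacity j := fun j => by
    -- `A ρ^r - C = r⁻¹ (r (A ρ^r - C)) → 0`
    have h1 : Tendsto (fun l => ∑ i, net.incidence j i * ((X l).ν i / (X l).μ i)) atTop
        (𝓝 (∑ i, net.incidence j i * (ν i / μ i))) :=
      tendsto_finsetSum _ fun i _ => ((hν i).div (hμ i) (hμ_pos i).ne').const_mul _
    have h2 := ((tendsto_inv_atTop_zero.comp hr).mul (hθ j)).add_const (net.capacity j)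
    rw [zero_mul, zero_add] at h2
    refine tendsto_nhds_unique h1 (h2.congr fun l => ?_)
    simp only [Function.comp_apply]
    rw [inv_mul_cancel_left₀ (hr_pos l).ne', sub_add_cancel]
  -- each of the three exceptional events gets the probability `δ / 4`
  obtain ⟨κ₁, hκ₁, hnoise⟩ := BandwidthSharing.FlowModel.exists_noise_bound net
    (fun i => ν i + 1) (fun i => μ i + 1) hT hδ4
  obtain ⟨κ₂, hκ₂, htight⟩ :=
    BandwidthSharing.exists_eventually_measure_norm_ge_le hη hδ4
  have hθ0 : 0 ≤ ∑ j, |θ j| := Finset.sum_nonneg fun j _ => abs_nonneg _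
  set κ := κ₁ + κ₂ + (∑ j, |θ j| + 1) * T with hκdef
  have hκ₃ : 0 < (∑ j, |θ j| + 1) * T := by positivity
  have hload : ∀ᶠ l in atTop, ∀ j,
      |r l * (∑ i, net.incidence j i * ((X l).ν i / (X l).μ i) - net.capacity j)| * T ≤ κ := by
    refine eventually_all.2 fun j => ?_
    have h1 : |θ j| < ∑ j, |θ j| + 1 := by
      have := Finset.single_le_sum (f := fun j => |θ j|) (fun j _ => abs_nonneg _)
        (Finset.mem_univ j)
      linarith
    filter_upwards [(hθ j).abs.eventually_lt_const h1] with l hl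
    have := mul_le_mul_of_nonneg_right hl.le hT.le
    linarith
  obtain ⟨K, hK, hbound⟩ := BandwidthSharing.FlowModel.exists_scaled_bound hν_pos hμ_pos hlocal
    hcrit (κ := κ) (by positivity)
  obtain ⟨ε, hε, hε0⟩ := ((hbound δ hδ).and self_mem_nhdsWithin).exists
  replace hε0 : 0 < ε := hε0
  have hinit' := (hinit ε hε0).eventually_le_const (ENNReal.ofReal_pos.2 hδ4)
  have hparam : ∀ {f : ℕ → I → ℝ} {g : I → ℝ}, (∀ i, Tendsto (fun l => f l i) atTop (𝓝 (g i))) →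
      ∀ {e : ℝ}, 0 < e → ∀ᶠ l in atTop, ∀ i, |f l i - g i| ≤ e := fun h e he =>
    eventually_all.2 fun i => (Metric.tendsto_nhds.1 (h i) e he).mono fun l hl => hl.le
  obtain ⟨l₀, hl₀⟩ := eventually_atTop.1 (htight.and (hload.and (hinit'.and
    ((hr.eventually (hnoise ε hε0)).and ((hparam hν hε0).and ((hparam hμ hε0).and
      ((hparam hν one_pos).and (hparam hμ one_pos))))))))
  -- as `r` is monotone, `r l₀ < r l` implies `l₀ < l`
  refine ⟨K, hK, r l₀ + 1, by linarith [hr_pos l₀], fun l hl => ?_⟩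
  obtain ⟨hA, hB, hC, hD, hνε, hμε, hν1, hμ1⟩ := hl₀ l (by
    by_contra! h
    linarith [hr_mono h.le])
  have hD' := hD (Ω l) (P l) (X l) (fun i => by linarith [(abs_le.1 (hν1 i)).2])
    fun i => by linarith [(abs_le.1 (hμ1 i)).2]
  have hright := (X l).rightContinuous
  rw [ae_iff] at hright
  set good := {ω |
        BandwidthSharing.supNorm (fun t =>
          (X l).hatN (r l) t ω - net.lift ν μ ((X l).hatW (r l) t ω)) T ≤ ENNReal.ofReal δ ∧
        BandwidthSharing.supNorm (fun t => (X l).xiHat ν μ (r l) t ω) T ≤ ENNReal.ofReal δ ∧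
        (∀ j, BandwidthSharing.supNorm (fun t => (X l).zetaHat ν μ (r l) δ j t ω) T = 0) ∧
        BandwidthSharing.supNorm (fun t => (X l).hatW (r l) t ω) T ≤ ENNReal.ofReal K ∧
        BandwidthSharing.supNorm (fun t => (X l).hatU (r l) t ω) T ≤ ENNReal.ofReal K}
  set bad₀ := {ω | ¬ ∀ t, 0 ≤ t → ContinuousWithinAt (fun s => (X l).N s ω) (Set.Ici t) t}
  set bad₁ := {ω | κ₂ ≤ ‖(X l).hatW (r l) 0 ω‖}
  set bad₂ := {ω | ε ≤ ‖(X l).hatN (r l) 0 ω - net.lift ν μ ((X l).hatW (r l) 0 ω)‖}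
  set bad₃ := {ω | ¬ ((∀ i s t, 0 ≤ s → s ≤ t → t ≤ r l ^ 2 * T + r l →
        |net.pathNoise (X l).ν (X l).μ ((X l).path ω) i t -
          net.pathNoise (X l).ν (X l).μ ((X l).path ω) i s| ≤ ε * (r l + (t - s))) ∧
      ∀ i, ∀ t ∈ Set.Icc 0 (r l ^ 2 * T),
        |net.pathNoise (X l).ν (X l).μ ((X l).path ω) i t| ≤ κ₁ * r l)}
  -- the good event need not be measurable, so that its probability is bounded by subadditivity
  have hcover : (Set.univ : Set (Ω l)) ⊆ good ∪ (bad₀ ∪ (bad₁ ∪ (bad₂ ∪ bad₃))) := by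
    intro ω _
    by_contra hω
    simp only [Set.mem_union, not_or] at hω
    obtain ⟨hg, h0, h1, h2, h3⟩ := hω
    rw [Set.notMem_ofPred_iff, not_not] at h0 h3
    rw [Set.notMem_ofPred_iff, not_le] at h1 h2
    refine hg (hε (Ω l) (P l) (X l) (r l) T ω (hr_pos l) hT h0 hνε hμε h3.1 (fun i t ht => ?_) hB
      h2.le (by linarith))
    exact (h3.2 i t ht).trans (mul_le_mul_of_nonneg_right (by linarith) (hr_pos l).le)
  have hsum : 1 ≤ P l good + ENNReal.ofReal δ := by
    rw [← measure_univ (μ := P l)]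
    refine (measure_mono hcover).trans ((measure_union_le _ _).trans (add_le_add le_rfl ?_))
    calc P l (bad₀ ∪ (bad₁ ∪ (bad₂ ∪ bad₃)))
        ≤ P l bad₀ + (P l bad₁ + (P l bad₂ + P l bad₃)) :=
          (measure_union_le _ _).trans (add_le_add le_rfl ((measure_union_le _ _).trans
            (add_le_add le_rfl (measure_union_le _ _))))
      _ ≤ 0 + (ENNReal.ofReal (δ / 4) + (ENNReal.ofReal (δ / 4) + ENNReal.ofReal (δ / 4))) :=
          add_le_add hright.le (add_le_add hA (add_le_add hC hD'))
      _ ≤ ENNReal.ofReal δ := by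
          rw [zero_add, ← ENNReal.ofReal_add hδ4.le hδ4.le,
            ← ENNReal.ofReal_add hδ4.le (by positivity)]
          exact ENNReal.ofReal_le_ofReal (by linarith)
  rw [ENNReal.ofReal_sub _ hδ.le, ENNReal.ofReal_one]
  exact tsub_le_iff_right.2 hsum
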